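/- Let $\mathbb{D}=\{z\in\mathbb{C}:|z|<1\}$ be equipped with the normalized Lebesgue measure $dm$. A *bounded* Borel set of $\mathbb{D}$ means a Borel set whose closure in $\mathbb{D}$ is compact. Let $\mathrm{Conf}(\mathbb{D})$ be the space of configurations on $\mathbb{D}$, i.e. of non-negative integer-valued Radon measures $X$ on $\mathbb{D}$, with counting functions $\#B(X)=X(B)$ and with the $\sigma$-algebra generated by all $\#B$, $B\subset\mathbb{D}$ Borel (the Borel $\sigma$-algebra of the vague topology). A point process on $\mathbb{D}$ is a probability measure $\mathbb{P}$ on $\mathrm{Conf}(\mathbb{D})$. It is *determinantal with kernel* $K:\mathbb{D}\times\mathbb{D}\to\mathbb{C}$ if $$\mathbb{E}_{\mathbb{P}}\Big[\prod_{i=1}^{k}\frac{(\#B_i)!}{(\#B_i-n_i)!}\Big]=\int_{B_1^{n_1}\times\cdots\times B_k^{n_k}}\det\big[K(x_i,x_j)\big]_{i,j=1}^{n}\,dm(x_1)\cdots dm(x_n)$$ for all pairwise disjoint bounded Borel sets $B_1,\dots,B_k$ and all integers $n_i\ge1$ with $n_1+\cdots+n_k=n$ (where $N!/(N-r)!=N(N-1)\cdots(N-r+1)$,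 which is $0$ if $N<r$). It is *number rigid* if for every bounded Borel set $B\subset\mathbb{D}$ the random variable $\#B$ is measurable with respect to the $\mathbb{P}$-completion of the $\sigma$-algebra generated by all $\#C$ with $C\subset\mathbb{D}\setminus B$ Borel (the completion consists of the sets that differ from a set of this $\sigma$-algebra by a $\mathbb{P}$-null set of $\mathrm{Conf}(\mathbb{D})$). **Theorem.** Let $(\xi_n)_{n\ge0}$ be independent Bernoulli random variables with $\mathrm{Prob}(\xi_n=1)=\frac{1}{n+1}$ and $\mathrm{Prob}(\xi_n=0)=1-\frac1{n+1}$. Then for almost every realization $\xi=(\xi_n)_{n\ge 0}$ the following holds: there exists a determinantal point process on $\mathbb{D}$ with kernel $$K^{f_\xi}(z,w)=\sum_{n=0}^{\infty}\xi_n\,(n+1)\,z^n\bar w^n,\qquad z,w\in\mathbb{D},$$ and every determinantal point process on $\mathbb{D}$ with this kernel is number rigid. -/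

import Mathlib

open MeasureTheory

/-- Bounded Borel sets of the underlying space. A bounded set is a relatively compact one, as it is
for a proper metric; for the unit disc this means staying away from the unit circle. -/
def IsBoundedBorel {M : Type*} [TopologicalSpace M] [MeasurableSpace M] (B : Set M) : Prop :=
  MeasurableSet B ∧ IsCompact (closure B)

/-- Configurations over `M`: non-negative integer-valued Radon measures, that is, Borel measures
that take a (finite) natural number as value on each bounded Borel set. -/
def Conf (M : Type*) [TopologicalSpace M] [MeasurableSpace M] : Type _ :=
  {X : Measure M // ∀ B : Set M, IsBoundedBorel B → ∃ k : ℕ, X B = k}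

/-- The number of points `# B` of a configuration in `B`; it is finite if `B` is bounded Borel. -/
noncomputable def Conf.count {M : Type*} [TopologicalSpace M] [MeasurableSpace M]
    (B : Set M) (X : Conf M) : ENNReal :=
  X.1 B

/-- The σ-algebra `𝓕_C` on `Conf M` generated by all `# B` with `B ⊆ C` Borel. -/
@[reducible]
noncomputable def Conf.sigmaAlgebra {M : Type*} [TopologicalSpace M] [MeasurableSpace M] (C : Set M) :
    MeasurableSpace (Conf M) :=
  ⨆ (B : Set M) (_ : MeasurableSet B) (_ : B ⊆ C), MeasurableSpace.comap (Conf.count B) inferInstance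

/-- The σ-algebra of `Conf M`, generated by all the counting functions. For `M` locally compact,
second countable and Hausdorff it is the Borel σ-algebra of the vague topology. -/
noncomputable instance Conf.instMeasurableSpace {M : Type*} [TopologicalSpace M] [MeasurableSpace M] :
    MeasurableSpace (Conf M) :=
  Conf.sigmaAlgebra Set.univ

/-- A point process on `M`: a probability measure on the space of configurations. -/
abbrev PointProcess (M : Type*) [TopologicalSpace M] [MeasurableSpace M] : Type _ :=
  ProbabilityMeasure (Conf M)

/-- `P` is determinantal with kernel `K` (with respect to the reference measure `μ`): for pairwise
disjoint bounded Borel sets `B 1, …, B m` and integers `n i ≥ 1`,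
`𝔼 ∏ i, (# B i)! / (# B i - n i)! = ∫_{∏ B i ^ (n i)} det [K (x p) (x q)] dμ(x)`.
The factor `N! / (N - n)!` is the product `N (N - 1) ⋯ (N - n + 1)`, which is `0` for `N < n`; the
points `x p` are indexed by the pairs `p = (i, j)` with `j < n i`. -/
def IsDeterminantal {M : Type*} [TopologicalSpace M] [MeasurableSpace M]
    (μ : Measure M) (K : M → M → ℂ) (P : PointProcess M) : Prop :=
  ∀ (m : ℕ) (B : Fin m → Set M) (n : Fin m → ℕ),
    (∀ i, IsBoundedBorel (B i)) → Pairwise (fun i j => Disjoint (B i) (B j)) → (∀ i, 1 ≤ n i) →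
    Integrable (fun X : Conf M =>
        ∏ i, ∏ j ∈ Finset.range (n i), ((Conf.count (B i) X).toReal - j)) (P : Measure (Conf M)) ∧
    IntegrableOn (fun x : (Σ i, Fin (n i)) → M => (Matrix.of fun p q => K (x p) (x q)).det)
      (Set.univ.pi fun p => B p.1) (Measure.pi fun _ => μ) ∧
    ((∫ X : Conf M, ∏ i, ∏ j ∈ Finset.range (n i), ((Conf.count (B i) X).toReal - j)
        ∂(P : Measure (Conf M)) : ℝ) : ℂ) =
      ∫ x in Set.univ.pi (fun p : Σ i, Fin (n i) => B p.1),
        (Matrix.of fun p q => K (x p) (x q)).det ∂(Measure.pi fun _ => μ)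

/-- `P` is number rigid: for each bounded Borel set `B`, the variable `# B` is measurable for the
`P`-completion of `𝓕_{M \ B}`. The completed σ-algebra consists of the sets that agree with a
member of `𝓕_{M \ B}` up to a `P`-null set. -/
def IsNumberRigid {M : Type*} [TopologicalSpace M] [MeasurableSpace M]
    (P : PointProcess M) : Prop :=
  ∀ B : Set M, IsBoundedBorel B →
    Measurable[eventuallyMeasurableSpace (Conf.sigmaAlgebra Bᶜ) (ae (P : Measure (Conf M)))]
      (Conf.count B)

/-- The open unit disc, as a type. -/
abbrev Disc : Type := Metric.ball (0 : ℂ) 1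

/-- The normalized Lebesgue measure on the unit disc. -/
noncomputable def discMeasure : Measure Disc :=
  (ENNReal.ofReal Real.pi)⁻¹ • Measure.comap (Subtype.val : Disc → ℂ) volume

/-- The kernel `∑ a n (n + 1) zⁿ w̄ⁿ` on the unit disc. The series converges absolutely if `a` is
bounded. -/
noncomputable def discKernel (a : ℕ → ℂ) (z w : Disc) : ℂ :=
  ∑' n : ℕ, a n * (n + 1) * (z : ℂ) ^ n * (starRingEnd ℂ (w : ℂ)) ^ n

/-!
For almost every `ξ` the coefficients lie in `{0, 1}`, and `K` is the kernel of the projection onto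
the closed span of the monomials `zⁿ` with `ξ n = 1` in the Bergman space.

*Existence.* The partial sums of `K` are projections of finite rank `N`, and
`det [K_N (x p) (x q)] / N!` is a probability density. Integrating out variables one at a time
(`IsReproducing.integral_embedding`) shows that its points form a determinantal process
(`exists_projectionProcess`). To pass to the limit, the disc is embedded as a Borel space into
`ℕ × (ℕ → Bool)`, which has countably many compact open sets. Additive functions on these with
values in `ℕ` form a Polish space, and each of them extends to an integer-valued measure, since
countable additivity is automatic. The convergence of the factorial moments gives tightness and a
limit law with the right moments on compact open sets (`AdditiveCount.exists_limit`), and these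
extend to Borel sets by approximation (`AdditiveCount.HasMoments.borel`).

*Rigidity.* Let `T_ε` be the sum of `(-log |z|²)^ε` over the points `z` of the configuration. Under
the uniform measure `-log |z|²` is exponential, so that the weight has mean `Γ(1 + ε) / (n + 1)^ε`
under the density `(n + 1) |z|^(2n)`. The monomials are orthogonal for each radial weight, hence
`T_ε` has the variance `∑ ξ n (Γ(1 + 2ε) - Γ(1 + ε)²) / (n + 1)^(2ε)`
(`IsDeterminantal.lintegral_logWeight_sub_sq_le`). Averaged over `ξ`, this is
`(Γ(1 + 2ε) - Γ(1 + ε)²) ∑ (n + 1)^(-1 - 2ε)`: the first factor is `o(ε)`, the second one is of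
order `1 / ε`, so the product tends to `0` (`tendsto_mean_variance`). Along a suitable sequence
`ε k → 0` the variances are therefore almost surely summable, and `T_ε` is asymptotically equal to
its mean. As the weight tends to `1` on a bounded set `B`, the number of points in `B` is the limit
of the mean of `T_ε` minus the contribution to `T_ε` from outside `B`
(`IsDeterminantal.isNumberRigid`).
-/

/-! ### Determinants of reproducing kernels -/

/-- Expansion of a determinant along the row and the column of `none`: either `none` is a fixed point
of the permutation, or it is inserted into the cycle of some `i : J`. -/
theorem Matrix.det_option {J R : Type*} [Fintype J] [DecidableEq J] [CommRing R]
    (A : Matrix (Option J) (Option J) R) :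
    A.det = A none none * (A.submatrix some some).det -
      ∑ π : Equiv.Perm J, ∑ i : J, ((Equiv.Perm.sign π : ℤ) : R) *
        (A (some (π i)) none * A none (some i) *
          ∏ k ∈ Finset.univ.erase i, A (some (π k)) (some k)) := by
  classical
  rw [Matrix.det_apply', ← Equiv.Perm.decomposeOption.symm.sum_comp, Fintype.sum_prod_type,
    Fintype.sum_option, sub_eq_add_neg]
  congr 1
  · rw [Matrix.det_apply', Finset.mul_sum]
    refine Finset.sum_congr rfl fun π _ => ?_
    rw [Equiv.Perm.decomposeOption_symm_sign, Fintype.prod_option,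
      Equiv.Perm.decomposeOption_symm_apply]
    simp
    ring
  · rw [Finset.sum_comm, ← Finset.sum_neg_distrib]
    refine Finset.sum_congr rfl fun π _ => ?_
    rw [← Finset.sum_neg_distrib, ← Equiv.sum_comp π]
    refine Finset.sum_congr rfl fun i _ => ?_
    simp only [Fintype.prod_option, Equiv.Perm.decomposeOption_symm_apply]
    rw [← Finset.mul_prod_erase _ _ (Finset.mem_univ i)]
    have h : ∀ k ∈ Finset.univ.erase i,
        A ((Equiv.swap none (some (π i)) * π.optionCongr) (some k)) (some k)
          = A (some (π k)) (some k) := by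
      intro k hk
      have hk' : π k ≠ π i := fun h => Finset.ne_of_mem_erase hk (π.injective h)
      simp [Equiv.swap_apply_of_ne_of_ne, hk']
    rw [Finset.prod_congr rfl h]
    simp [Equiv.Perm.sign_mul, Equiv.optionCongr_sign]
    ring

/-- The determinant `det [K (x p) (x q)]` of the kernel `K` at the points `x p`. -/
noncomputable def kernelDet {M J : Type*} [Fintype J] [DecidableEq J] (K : M → M → ℂ) (x : J → M) :
    ℂ :=
  (Matrix.of fun p q => K (x p) (x q)).det

section KernelDet

variable {M : Type*} [MeasurableSpace M] {J : Type*} [Fintype J] [DecidableEq J]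

theorem measurable_kernelDet {K : M → M → ℂ} (hK : Measurable (Function.uncurry K)) :
    Measurable (kernelDet (J := J) K) := by
  unfold kernelDet
  simp only [Matrix.det_apply', Matrix.of_apply]
  refine Finset.measurable_sum _ fun π _ => Measurable.const_mul ?_ _
  refine Finset.measurable_prod _ fun i _ => ?_
  exact hK.comp (f := fun x : J → M => (x (π i), x i))
    ((measurable_pi_apply _).prodMk (measurable_pi_apply _))

omit [MeasurableSpace M] in
theorem norm_kernelDet_le {K : M → M → ℂ} {x : J → M} {C : ℝ}
    (hC : ∀ p q, ‖K (x p) (x q)‖ ≤ C) :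
    ‖kernelDet K x‖ ≤ (Fintype.card J).factorial * C ^ Fintype.card J := by
  unfold kernelDet
  rw [Matrix.det_apply']
  refine (norm_sum_le _ _).trans ?_
  have : ∀ π ∈ (Finset.univ : Finset (Equiv.Perm J)),
      ‖((Equiv.Perm.sign π : ℤ) : ℂ) * ∏ i, Matrix.of (fun p q => K (x p) (x q)) (π i) i‖
        ≤ C ^ Fintype.card J := by
    intro π _
    rw [norm_mul, norm_prod]
    have h1 : ‖((Equiv.Perm.sign π : ℤ) : ℂ)‖ = 1 := by
      rcases Int.units_eq_one_or (Equiv.Perm.sign π) with h | h <;> simp [h]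
    rw [h1, one_mul]
    calc _ ≤ ∏ _i : J, C := Finset.prod_le_prod (fun _ _ => norm_nonneg _) fun i _ => hC _ _
      _ = _ := by simp
  refine (Finset.sum_le_sum this).trans ?_
  simp [Fintype.card_perm]

omit [MeasurableSpace M] in
theorem kernelDet_comp_equiv {I : Type*} [Fintype I] [DecidableEq I] (K : M → M → ℂ) (e : J ≃ I)
    (x : I → M) : kernelDet K (x ∘ e) = kernelDet K x := by
  unfold kernelDet
  rw [← Matrix.det_submatrix_equiv_self e]
  rfl

/-- Bounded kernels `K` with `∫ K(x, y) K(y, z) dμ(y) = K(x, z)` and trace `N`. The example is the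
kernel of the orthogonal projection onto an `N`-dimensional space of bounded functions. -/
structure IsReproducing (μ : Measure M) (K : M → M → ℂ) (N : ℕ) : Prop where
  measurable : Measurable (Function.uncurry K)
  bounded : ∃ C, ∀ x y, ‖K x y‖ ≤ C
  integral_mul : ∀ x z, ∫ y, K x y * K y z ∂μ = K x z
  integral_diag : ∫ y, K y y ∂μ = N

variable {μ : Measure M} [IsFiniteMeasure μ] {K : M → M → ℂ} {N : ℕ}

theorem IsReproducing.integrable_kernelDet (h : IsReproducing μ K N) :
    Integrable (kernelDet (J := J) K) (Measure.pi fun _ => μ) := by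
  obtain ⟨C, hC⟩ := h.bounded
  exact .of_bound (measurable_kernelDet h.measurable).aestronglyMeasurable _
    (.of_forall fun x => norm_kernelDet_le fun p q => hC _ _)

/-- Integrating out one variable of the determinant of a reproducing kernel. -/
theorem IsReproducing.integral_kernelDet_option (h : IsReproducing μ K N) (x : J → M) :
    ∫ y, kernelDet K (fun o : Option J => o.elim y x) ∂μ
      = (N - Fintype.card J : ℂ) * kernelDet K x := by
  obtain ⟨C, hC⟩ := h.bounded
  have hm2 : ∀ a b, Integrable (fun y => K a y * K y b) μ := fun a b =>
    .of_bound (C := C * C)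
      ((h.measurable.comp (measurable_const.prodMk measurable_id)).mul
        (h.measurable.comp (measurable_id.prodMk measurable_const))).aestronglyMeasurable
      (.of_forall fun y => by
        rw [norm_mul]
        exact mul_le_mul (hC _ _) (hC _ _) (norm_nonneg _) ((norm_nonneg _).trans (hC a a)))
  have hd : Integrable (fun y => K y y) μ :=
    .of_bound (C := C) (h.measurable.comp (measurable_id.prodMk measurable_id)).aestronglyMeasurable
      (.of_forall fun y => hC _ _)
  have hexp : ∀ y, kernelDet K (fun o : Option J => o.elim y x) =
      K y y * kernelDet K x - ∑ π : Equiv.Perm J, ∑ i : J,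
        (((Equiv.Perm.sign π : ℤ) : ℂ) * ∏ k ∈ Finset.univ.erase i, K (x (π k)) (x k)) *
        (K (x (π i)) y * K y (x i)) := by
    intro y
    unfold kernelDet
    rw [Matrix.det_option]
    congr 1
    refine Finset.sum_congr rfl fun π _ => Finset.sum_congr rfl fun i _ => ?_
    simp only [Matrix.of_apply, Option.elim]
    ring
  simp_rw [hexp]
  rw [integral_sub (hd.mul_const _)
    (integrable_finsetSum _ fun π _ => integrable_finsetSum _ fun i _ => (hm2 _ _).const_mul _),
    integral_mul_const, h.integral_diag,
    integral_finsetSum _ fun π _ => integrable_finsetSum _ fun i _ => (hm2 _ _).const_mul _,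
    sub_mul]
  congr 1
  rw [kernelDet, Matrix.det_apply', Finset.mul_sum]
  refine Finset.sum_congr rfl fun π _ => ?_
  rw [integral_finsetSum _ fun i _ => (hm2 _ _).const_mul _]
  simp_rw [integral_const_mul, h.integral_mul]
  have : ∀ i ∈ (Finset.univ : Finset J),
      (((Equiv.Perm.sign π : ℤ) : ℂ) * ∏ k ∈ Finset.univ.erase i, K (x (π k)) (x k)) *
        K (x (π i)) (x i) = ((Equiv.Perm.sign π : ℤ) : ℂ) * ∏ k, K (x (π k)) (x k) := by
    intro i _
    rw [← Finset.mul_prod_erase _ _ (Finset.mem_univ i)]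
    ring
  rw [Finset.sum_congr rfl this]
  simp [Finset.card_univ]

/-- One step of the reduction of an integral against `det [K (x p) (x q)]` to fewer variables, for
an integrand that does not depend on the variable `none`. -/
theorem IsReproducing.integral_option (h : IsReproducing μ K N) {F : (J → M) → ℂ}
    (hF : Measurable F) {D : ℝ} (hD : ∀ x, ‖F x‖ ≤ D) :
    ∫ x : Option J → M, F (x ∘ some) * kernelDet K x ∂(Measure.pi fun _ => μ)
      = (N - Fintype.card J : ℂ) *
        ∫ x : J → M, F x * kernelDet K x ∂(Measure.pi fun _ => μ) := by
  obtain ⟨C, hC⟩ := h.bounded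
  have hmp : MeasurePreserving (MeasurableEquiv.piOptionEquivProd fun _ : Option J => M).symm
      ((Measure.pi fun _ : J => μ).prod μ) (Measure.pi fun _ : Option J => μ) :=
    ⟨(MeasurableEquiv.measurable _), Measure.pi_map_piOptionEquivProd fun _ : Option J => μ⟩
  rw [← hmp.integral_comp (MeasurableEquiv.measurableEmbedding _)]
  have he : ∀ z : (J → M) × M, (MeasurableEquiv.piOptionEquivProd fun _ : Option J => M).symm z
      = fun o => o.elim z.2 z.1 := by
    rintro ⟨x, y⟩
    funext o
    cases o <;> rfl
  have hint : Integrable (fun z : (J → M) × M =>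
      F z.1 * kernelDet K (fun o : Option J => o.elim z.2 z.1))
      ((Measure.pi fun _ : J => μ).prod μ) := by
    refine .of_bound (C := D * ((Fintype.card (Option J)).factorial * C ^ Fintype.card (Option J)))
      ?_ (.of_forall fun z => ?_)
    · refine Measurable.aestronglyMeasurable ((hF.comp measurable_fst).mul
        ((measurable_kernelDet h.measurable).comp (measurable_pi_lambda _ fun o => ?_)))
      cases o
      · exact measurable_snd
      · exact (measurable_pi_apply _).comp measurable_fst
    · rw [norm_mul]
      exact mul_le_mul (hD _) (norm_kernelDet_le fun p q => hC _ _) (norm_nonneg _)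
        ((norm_nonneg _).trans (hD z.1))
  simp_rw [he]
  have hs : ∀ z : (J → M) × M, (fun o : Option J => o.elim z.2 z.1) ∘ some = z.1 := fun z => rfl
  simp_rw [hs]
  rw [integral_prod _ hint, ← integral_const_mul]
  congr 1
  funext x
  simp only
  rw [integral_const_mul, h.integral_kernelDet_option]
  ring

/-- The marginals of the determinant of a reproducing kernel, along an injection `σ` of the set of
remaining variables. -/
theorem IsReproducing.integral_embedding (h : IsReproducing μ K N) {F : (J → M) → ℂ}
    (hF : Measurable F) {D : ℝ} (hD : ∀ x, ‖F x‖ ≤ D) {I : Type*} [Fintype I] [DecidableEq I]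
    (σ : J ↪ I) (hI : Fintype.card I ≤ N) :
    (N - Fintype.card I).factorial *
        ∫ x : I → M, F (x ∘ σ) * kernelDet K x ∂(Measure.pi fun _ => μ)
      = (N - Fintype.card J).factorial *
        ∫ x : J → M, F x * kernelDet K x ∂(Measure.pi fun _ => μ) := by
  obtain ⟨d, hd⟩ : ∃ d, d = Fintype.card I - Fintype.card J := ⟨_, rfl⟩
  have hJI := Fintype.card_le_of_embedding σ
  -- the variables outside the range of `σ` are integrated out one after the other
  induction d generalizing J with
  | zero =>
    have hcard : Fintype.card J = Fintype.card I := by omega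
    have hbij : Function.Bijective σ :=
      (Fintype.bijective_iff_injective_and_card σ).2 ⟨σ.injective, hcard⟩
    let e : J ≃ I := Equiv.ofBijective σ hbij
    rw [hcard]
    congr 1
    have hmp := measurePreserving_piCongrLeft (fun _ : I => μ) e
    rw [← hmp.integral_comp (MeasurableEquiv.measurableEmbedding _)]
    congr 1
    funext x
    have h1 : (MeasurableEquiv.piCongrLeft (fun _ => M) e x) ∘ e = x := by
      funext j
      exact Equiv.piCongrLeft_apply_apply (fun _ => M) e x j
    have h2 : (MeasurableEquiv.piCongrLeft (fun _ => M) e x) ∘ σ = x := h1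
    rw [h2]
    congr 1
    conv_rhs => rw [← h1]
    rw [kernelDet_comp_equiv]
  | succ d ih =>
    obtain ⟨i, hi⟩ : ∃ i, i ∉ Set.range σ := by
      by_contra hcon
      push Not at hcon
      have := Fintype.card_le_of_surjective σ (fun i => hcon i)
      omega
    let σ' : Option J ↪ I := σ.optionElim i hi
    have hs : ∀ x : I → M, (x ∘ σ') ∘ some = x ∘ σ := fun x => rfl
    have key := ih (J := Option J) (F := fun x => F (x ∘ some))
      (hF.comp (measurable_pi_lambda _ fun j => measurable_pi_apply _)) (fun x => hD _) σ'
      (by simp; omega) (Fintype.card_le_of_embedding σ')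
    simp only [hs] at key
    rw [key, h.integral_option hF hD, Fintype.card_option, ← mul_assoc]
    congr 1
    have hN : N - Fintype.card J = (N - (Fintype.card J + 1)) + 1 := by omega
    rw [hN, Nat.factorial_succ, ← hN, Nat.cast_mul, Nat.cast_sub (by omega)]
    ring

end KernelDet

/-! ### Factorial moments of the counts of finitely many points -/

section FactorialMoments

variable {M : Type*}

/-- The number of the points `x i` that lie in `B`. -/
noncomputable def pointCount {I : Type*} [Fintype I] (x : I → M) (B : Set M) : ℕ :=
  open scoped Classical in (Finset.univ.filter fun i => x i ∈ B).card

theorem prod_range_sub_eq_descFactorial (c n : ℕ) :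
    ∏ j ∈ Finset.range n, ((c : ℝ) - j) = (c.descFactorial n : ℝ) := by
  rw [← descPochhammer_eval_eq_prod_range, descPochhammer_eval_eq_descFactorial]

open scoped Classical in
/-- A choice of `n i` distinct points in each of the disjoint sets `B i`, for all `i`, is a choice of
distinct points that lie in the right sets. -/
theorem prod_descFactorial_pointCount {I : Type*} [Fintype I] (x : I → M) {m : ℕ}
    {B : Fin m → Set M} (hB : Pairwise fun i j => Disjoint (B i) (B j)) (n : Fin m → ℕ) :
    ∏ i, (pointCount x (B i)).descFactorial (n i) =
      ∑ σ : (Σ i, Fin (n i)) ↪ I, if ∀ p, x (σ p) ∈ B p.1 then 1 else 0 := by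
  let e : {σ : (Σ i, Fin (n i)) ↪ I // ∀ p, x (σ p) ∈ B p.1} ≃
      ((i : Fin m) → (Fin (n i) ↪ {l : I // x l ∈ B i})) :=
    { toFun := fun σ i => ⟨fun j => ⟨σ.1 ⟨i, j⟩, σ.2 ⟨i, j⟩⟩, fun j k h => by
        have h' : σ.1 ⟨i, j⟩ = σ.1 ⟨i, k⟩ := congrArg Subtype.val h
        simpa using σ.1.injective h'⟩
      invFun := fun τ => ⟨⟨fun p => (τ p.1 p.2).1, by
        rintro ⟨i, j⟩ ⟨i', j'⟩ h
        simp only at h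
        by_cases hii : i = i'
        · subst hii
          rw [(τ i).injective (Subtype.ext h)]
        · exact absurd (h ▸ (τ i' j').2) fun hx =>
            Set.disjoint_left.1 (hB hii) (τ i j).2 (by rw [h]; exact (τ i' j').2)⟩,
        fun p => (τ p.1 p.2).2⟩
      left_inv := fun σ => rfl
      right_inv := fun τ => rfl }
  rw [Finset.sum_boole, Nat.cast_id, ← Fintype.card_subtype, Fintype.card_congr e, Fintype.card_pi]
  refine Finset.prod_congr rfl fun i _ => ?_
  rw [Fintype.card_embedding_eq, Fintype.card_fin, Fintype.card_subtype]
  rfl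

theorem pointCount_le {I : Type*} [Fintype I] (x : I → M) (B : Set M) :
    pointCount x B ≤ Fintype.card I := by
  classical
  unfold pointCount
  exact (Finset.card_le_univ _)

theorem pointCount_empty {I : Type*} [Fintype I] (x : I → M) : pointCount x ∅ = 0 := by
  simp [pointCount]

theorem pointCount_union {I : Type*} [Fintype I] (x : I → M) {A B : Set M} (h : Disjoint A B) :
    pointCount x (A ∪ B) = pointCount x A + pointCount x B := by
  classical
  unfold pointCount
  rw [← Finset.card_union_of_disjoint, ← Finset.filter_or]
  · congr
  · rw [Finset.disjoint_filter]
    exact fun i _ h1 h2 => Set.disjoint_left.1 h h1 h2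

theorem measurable_pointCount [MeasurableSpace M] {I : Type*} [Fintype I] {B : Set M}
    (hB : MeasurableSet B) : Measurable fun x : I → M => pointCount x B := by
  classical
  unfold pointCount
  simp only [Finset.card_filter]
  exact Finset.measurable_sum _ fun i _ =>
    Measurable.ite ((measurable_pi_apply i) hB) measurable_const measurable_const

end FactorialMoments

/-! ### Determinantal processes of projections of finite rank -/

section ProjectionProcess

variable {M I : Type*} [MeasurableSpace M] [Fintype I] [DecidableEq I] {μ : Measure M}
  [IsFiniteMeasure μ] {φ : I → M → ℂ}

/-- The kernel of the orthogonal projection onto the span of the orthonormal functions `φ a`. -/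
noncomputable def projectionKernel (φ : I → M → ℂ) (x y : M) : ℂ :=
  ∑ a, φ a x * starRingEnd ℂ (φ a y)

theorem isReproducing_projectionKernel (hφ : ∀ a, Measurable (φ a)) (hb : ∀ a, ∃ C, ∀ x, ‖φ a x‖ ≤ C)
    (horth : ∀ a b, ∫ x, φ a x * starRingEnd ℂ (φ b x) ∂μ = if a = b then 1 else 0) :
    IsReproducing μ (projectionKernel φ) (Fintype.card I) := by
  choose C hC using hb
  have hstar : Measurable (starRingEnd ℂ) := Complex.continuous_conj.measurable
  have hint : ∀ a b, Integrable (fun y => φ a y * starRingEnd ℂ (φ b y)) μ := fun a b =>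
    .of_bound (C := C a * C b) ((hφ a).mul (hstar.comp (hφ b))).aestronglyMeasurable
      (.of_forall fun y => by
        rw [norm_mul, RCLike.norm_conj]
        exact mul_le_mul (hC _ _) (hC _ _) (norm_nonneg _) ((norm_nonneg _).trans (hC a y)))
  refine ⟨?_, ⟨∑ a, C a * C a, fun x y => ?_⟩, fun x z => ?_, ?_⟩
  · unfold projectionKernel Function.uncurry
    exact Finset.measurable_sum _ fun a _ =>
      ((hφ a).comp measurable_fst).mul (hstar.comp ((hφ a).comp measurable_snd))
  · refine (norm_sum_le _ _).trans (Finset.sum_le_sum fun a _ => ?_)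
    rw [norm_mul, RCLike.norm_conj]
    exact mul_le_mul (hC _ _) (hC _ _) (norm_nonneg _) ((norm_nonneg _).trans (hC a x))
  · have : ∀ y, projectionKernel φ x y * projectionKernel φ y z =
        ∑ a, ∑ b, (φ a x * starRingEnd ℂ (φ b z)) * (φ b y * starRingEnd ℂ (φ a y)) := by
      intro y
      simp only [projectionKernel, Finset.sum_mul_sum]
      exact Finset.sum_congr rfl fun a _ => Finset.sum_congr rfl fun b _ => by ring
    simp_rw [this]
    rw [integral_finsetSum _ fun a _ => integrable_finsetSum _ fun b _ => (hint _ _).const_mul _]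
    simp_rw [integral_finsetSum _ fun b _ => (hint b _).const_mul _, integral_const_mul, horth]
    simp [projectionKernel]
  · unfold projectionKernel
    rw [integral_finsetSum _ fun a _ => hint a a]
    simp [horth]

omit [MeasurableSpace M] in
theorem kernelDet_projectionKernel (x : I → M) :
    kernelDet (projectionKernel φ) x =
      ((‖(Matrix.of fun i a => φ a (x i)).det‖ ^ 2 : ℝ) : ℂ) := by
  have : (Matrix.of fun p q => projectionKernel φ (x p) (x q)) =
      (Matrix.of fun i a => φ a (x i)) * (Matrix.of fun i a => φ a (x i)).conjTranspose := by
    ext p q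
    simp [projectionKernel, Matrix.mul_apply]
  rw [kernelDet, this, Matrix.det_mul, Matrix.det_conjTranspose]
  simpa using! Complex.mul_conj' _

omit [MeasurableSpace M] [DecidableEq I] in
theorem kernelDet_projectionKernel_eq_zero {J : Type*} [Fintype J] [DecidableEq J]
    (hJ : Fintype.card I < Fintype.card J) (x : J → M) :
    kernelDet (projectionKernel φ) x = 0 := by
  have : (Matrix.of fun p q => projectionKernel φ (x p) (x q)) =
      (Matrix.of fun i a => φ a (x i)) * (Matrix.of fun i a => φ a (x i)).conjTranspose := by
    ext p q
    simp [projectionKernel, Matrix.mul_apply]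
  rw [kernelDet, this]
  by_contra h
  have h1 := Matrix.rank_of_isUnit _ ((Matrix.isUnit_iff_isUnit_det _).2 (isUnit_iff_ne_zero.2 h))
  have h2 := Matrix.rank_mul_le_left (Matrix.of fun i a => φ a (x i))
    (Matrix.of fun i a => φ a (x i)).conjTranspose
  have h3 := Matrix.rank_le_card_width (Matrix.of fun (i : J) a => φ a (x i))
  omega

/-- The determinantal process of a projection kernel of finite rank: its points, in random order,
have density `det [K (x p) (x q)] / N!`. -/
theorem exists_projectionProcess (hφ : ∀ a, Measurable (φ a)) (hb : ∀ a, ∃ C, ∀ x, ‖φ a x‖ ≤ C)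
    (horth : ∀ a b, ∫ x, φ a x * starRingEnd ℂ (φ b x) ∂μ = if a = b then 1 else 0) :
    ∃ P : Measure (I → M), IsProbabilityMeasure P ∧ ∀ (m : ℕ) (B : Fin m → Set M) (n : Fin m → ℕ),
      (∀ i, MeasurableSet (B i)) → Pairwise (fun i j => Disjoint (B i) (B j)) →
      ((∫ x, ∏ i, ((pointCount x (B i)).descFactorial (n i) : ℝ) ∂P : ℝ) : ℂ) =
        ∫ x in Set.univ.pi (fun p : Σ i, Fin (n i) => B p.1), kernelDet (projectionKernel φ) x
          ∂(Measure.pi fun _ => μ) := by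
  classical
  have hrep := isReproducing_projectionKernel hφ hb horth
  set K := projectionKernel φ
  set N := Fintype.card I
  -- the density is non-negative because `det [K (x p) (x q)]` equals `|det [φ a (x p)]|²`
  let g : (I → M) → ℝ := fun x => ‖(Matrix.of fun i a => φ a (x i)).det‖ ^ 2 / N.factorial
  have hg0 : ∀ x, 0 ≤ g x := fun x => by positivity
  have hgK : ∀ x, (g x : ℂ) = kernelDet K x / N.factorial := fun x => by
    rw [kernelDet_projectionKernel]
    simp [g]
  have hfac : (N.factorial : ℂ) ≠ 0 := by exact_mod_cast N.factorial_ne_zero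
  have hgm : Measurable g := by
    have h1 : Measurable fun x : I → M => (kernelDet K x / N.factorial).re :=
      Complex.measurable_re.comp ((measurable_kernelDet hrep.measurable).div_const _)
    convert h1 using 2 with x
    rw [← hgK, Complex.ofReal_re]
  have hgi : Integrable g (Measure.pi fun _ => μ) := by
    have h1 := (hrep.integrable_kernelDet (J := I)).div_const (N.factorial : ℂ)
    simp_rw [← hgK] at h1
    exact h1.re
  have hint1 : ∫ x, kernelDet K x ∂(Measure.pi fun _ : I => μ) = N.factorial := by
    have := hrep.integral_embedding (J := Empty) (F := fun _ => 1) measurable_const (D := 1)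
      (by simp) (Function.Embedding.ofIsEmpty : Empty ↪ I) le_rfl
    simpa [N, kernelDet, measureReal_def, Measure.pi_univ] using this
  let P : Measure (I → M) := (Measure.pi fun _ => μ).withDensity fun x => ENNReal.ofReal (g x)
  have hPint : ∀ F : (I → M) → ℝ, ((∫ x, F x ∂P : ℝ) : ℂ) =
      (∫ x, (F x : ℂ) * kernelDet K x ∂(Measure.pi fun _ => μ)) / N.factorial := by
    intro F
    have hd : P = (Measure.pi fun _ => μ).withDensity fun x => ((g x).toNNReal : ENNReal) := rfl
    rw [hd, integral_withDensity_eq_integral_smul hgm.real_toNNReal, ← integral_complex_ofReal,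
      ← integral_div]
    congr 1
    funext x
    rw [NNReal.smul_def, smul_eq_mul, Real.coe_toNNReal _ (hg0 x), Complex.ofReal_mul, hgK]
    ring
  have hP : IsProbabilityMeasure P := by
    refine ⟨?_⟩
    rw [withDensity_apply _ MeasurableSet.univ, Measure.restrict_univ,
      ← ofReal_integral_eq_lintegral_ofReal hgi (.of_forall hg0), ENNReal.ofReal_eq_one]
    have : ((∫ x, g x ∂(Measure.pi fun _ => μ) : ℝ) : ℂ) = 1 := by
      rw [← integral_complex_ofReal]
      simp_rw [hgK]
      rw [integral_div, hint1, div_self hfac]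
    exact_mod_cast this
  refine ⟨P, hP, fun m B n hBm hBd => ?_⟩
  set J := Σ i, Fin (n i)
  let F : (J → M) → ℂ := fun x => if ∀ p, x p ∈ B p.1 then 1 else 0
  have hFset : MeasurableSet {x : J → M | ∀ p, x p ∈ B p.1} := by
    rw [Set.ofPred_forall]
    exact MeasurableSet.iInter fun p => (measurable_pi_apply p) (hBm _)
  have hFm : Measurable F := Measurable.ite hFset measurable_const measurable_const
  have hF1 : ∀ x, ‖F x‖ ≤ 1 := fun x => by
    simp only [F]
    split_ifs <;> simp
  have hsum : ∀ x : I → M, ((∏ i, ((pointCount x (B i)).descFactorial (n i) : ℝ) : ℝ) : ℂ)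
      = ∑ σ : J ↪ I, F (x ∘ σ) := by
    intro x
    have := prod_descFactorial_pointCount x hBd n
    have h2 := congrArg (Nat.cast : ℕ → ℂ) this
    push_cast at h2 ⊢
    exact h2
  have hRHS : ∫ x in Set.univ.pi (fun p : J => B p.1), kernelDet K x ∂(Measure.pi fun _ => μ)
      = ∫ x, F x * kernelDet K x ∂(Measure.pi fun _ => μ) := by
    rw [← integral_indicator (MeasurableSet.univ_pi fun p => hBm _)]
    congr 1
    funext x
    by_cases hx : ∀ p, x p ∈ B p.1
    · rw [Set.indicator_of_mem (by simpa using hx)]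
      simp [F, hx]
    · rw [Set.indicator_of_notMem (by simpa using hx)]
      simp [F, hx]
  rw [hPint, hRHS]
  simp_rw [hsum, Finset.sum_mul]
  obtain ⟨C, hC⟩ := hrep.bounded
  rw [integral_finsetSum]
  swap
  · intro σ _
    refine Integrable.bdd_mul (c := 1) hrep.integrable_kernelDet
      (hFm.comp (measurable_pi_lambda _ fun j => measurable_pi_apply _)).aestronglyMeasurable
      (.of_forall fun x => hF1 _)
  -- for more than `N` points both sides vanish: there are no injections `J ↪ I`, and the rank is `N`
  by_cases hcard : Fintype.card J ≤ N
  · have key := fun σ : J ↪ I => hrep.integral_embedding hFm hF1 σ le_rfl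
    simp only [Nat.sub_self, Nat.factorial_zero, Nat.cast_one, one_mul, N] at key
    simp_rw [key]
    rw [Finset.sum_const, Finset.card_univ, Fintype.card_embedding_eq, nsmul_eq_mul, ← mul_assoc,
      ← Nat.cast_mul, mul_comm (Nat.descFactorial _ _), Nat.factorial_mul_descFactorial hcard]
    field_simp
  · have : IsEmpty (J ↪ I) := Function.Embedding.isEmpty_of_card_lt (by omega)
    have hz : ∀ x : J → M, kernelDet K x = 0 := fun x =>
      kernelDet_projectionKernel_eq_zero (by omega) x
    simp [hz]

end ProjectionProcess

/-! ### Measures from counts on compact open sets -/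

section CompactOpenRing

open TopologicalSpace Topology

variable {Y : Type*} [TopologicalSpace Y] [T2Space Y]

/-- The compact open subsets of a space, as a family of sets. -/
def compactOpenSets (Y : Type*) [TopologicalSpace Y] : Set (Set Y) := {s | IsCompact s ∧ IsOpen s}

theorem isSetRing_compactOpenSets : IsSetRing (compactOpenSets Y) where
  empty_mem := ⟨isCompact_empty, isOpen_empty⟩
  union_mem _ _ hs ht := ⟨hs.1.union ht.1, hs.2.union ht.2⟩
  sdiff_mem _ _ hs ht := ⟨hs.1.diff ht.2, hs.2.sdiff ht.1.isClosed⟩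

theorem isTopologicalBasis_compactOpenSets [LocallyCompactSpace Y] [TotallyDisconnectedSpace Y] :
    IsTopologicalBasis (compactOpenSets Y) := by
  refine isTopologicalBasis_of_isOpen_of_nhds (fun s hs => hs.2) fun y U hy hU => ?_
  obtain ⟨K, hK, hyK, hKU⟩ := exists_compact_subset hU hy
  obtain ⟨V, hV, hyV, hVK⟩ :=
    (loc_compact_Haus_tot_disc_of_zero_dim (H := Y)).exists_subset_of_mem_open hyK isOpen_interior
  have hV' : IsClopen V := hV
  exact ⟨V, ⟨hK.of_isClosed_subset hV'.1 (hVK.trans interior_subset), hV'.2⟩, hyV,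
    (hVK.trans interior_subset).trans hKU⟩

theorem generateFrom_compactOpenSets [LocallyCompactSpace Y] [TotallyDisconnectedSpace Y]
    [SecondCountableTopology Y] [MeasurableSpace Y] [BorelSpace Y] :
    ‹MeasurableSpace Y› = MeasurableSpace.generateFrom (compactOpenSets Y) := by
  rw [← isTopologicalBasis_compactOpenSets.borel_eq_generateFrom]
  exact BorelSpace.measurable_eq

omit [T2Space Y] in
theorem countable_compactOpens [SecondCountableTopology Y] : Countable (CompactOpens Y) := by
  have hb : IsTopologicalBasis (Set.range ((↑) : countableBasis Y → Set Y)) := by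
    simpa using isBasis_countableBasis Y
  have h : ∀ A : CompactOpens Y, ∃ s : Finset (countableBasis Y), (A : Set Y) = ⋃ i ∈ s, (i : Set Y) := by
    intro A
    obtain ⟨s, hs, hA⟩ :=
      eq_finite_iUnion_of_isTopologicalBasis_of_isCompact_open _ hb A A.isCompact A.isOpen
    exact ⟨hs.toFinset, by simpa using hA⟩
  choose s hs using h
  have : Countable (countableBasis Y) := (countable_countableBasis Y).to_subtype
  refine Function.Injective.countable (f := s) fun A B hAB => ?_
  apply SetLike.coe_injective
  rw [hs A, hs B, hAB]

/-- Finitely additive counts of points in the compact open subsets of `Y`. With the topology of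
pointwise convergence this is a closed subspace of a countable power of the discrete space `ℕ`. -/
abbrev AdditiveCount (Y : Type*) [TopologicalSpace Y] : Type _ :=
  {t : CompactOpens Y → ℕ //
    t ⊥ = 0 ∧ ∀ A B : CompactOpens Y, Disjoint (A : Set Y) B → t (A ⊔ B) = t A + t B}

omit [T2Space Y] in
theorem isClosed_additiveCount : IsClosed {t : CompactOpens Y → ℕ |
    t ⊥ = 0 ∧ ∀ A B : CompactOpens Y, Disjoint (A : Set Y) B → t (A ⊔ B) = t A + t B} := by
  simp only [Set.ofPred_and, Set.ofPred_forall]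
  refine (isClosed_eq (continuous_apply _) continuous_const).inter ?_
  refine isClosed_iInter fun A => isClosed_iInter fun B => isClosed_iInter fun _ => ?_
  exact isClosed_eq (continuous_apply _) ((continuous_apply A).add (continuous_apply B))

open scoped Classical in
/-- The additive content given by finitely additive counts. -/
noncomputable def AdditiveCount.content (t : AdditiveCount Y) :
    AddContent ENNReal (compactOpenSets Y) :=
  isSetRing_compactOpenSets.addContent_of_union
    (fun s => if h : s ∈ compactOpenSets Y then (t.1 ⟨⟨s, h.1⟩, h.2⟩ : ENNReal) else 0)
    (by
      rw [dif_pos isSetRing_compactOpenSets.empty_mem]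
      exact_mod_cast t.2.1)
    (fun {s u} hs hu hd => by
      rw [dif_pos hs, dif_pos hu, dif_pos (isSetRing_compactOpenSets.union_mem hs hu)]
      exact_mod_cast t.2.2 ⟨⟨s, hs.1⟩, hs.2⟩ ⟨⟨u, hu.1⟩, hu.2⟩ hd)

open scoped Classical in
theorem AdditiveCount.content_apply (t : AdditiveCount Y) (A : CompactOpens Y) :
    t.content (A : Set Y) = t.1 A := by
  have h : (A : Set Y) ∈ compactOpenSets Y := ⟨A.isCompact, A.isOpen⟩
  change (if h : (A : Set Y) ∈ compactOpenSets Y then (t.1 ⟨⟨_, h.1⟩, h.2⟩ : ENNReal) else 0) = _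
  rw [dif_pos h]
  rfl

/-- Countable subadditivity is automatic: a compact open set covered by open sets is covered by
finitely many of them. -/
theorem AdditiveCount.isSigmaSubadditive (t : AdditiveCount Y) : t.content.IsSigmaSubadditive := by
  classical
  intro f hf hU
  obtain ⟨F, hF⟩ := hU.1.elim_finite_subcover f (fun i => (hf i).2) subset_rfl
  have h1 : (⋃ i, f i) = ⋃ i ∈ F, f i :=
    hF.antisymm (Set.iUnion₂_subset fun i _ => Set.subset_iUnion f i)
  rw [h1]
  exact (addContent_biUnion_le isSetRing_compactOpenSets fun i _ => hf i).trans
    (ENNReal.sum_le_tsum F)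

variable [LocallyCompactSpace Y] [TotallyDisconnectedSpace Y] [SecondCountableTopology Y]
  [MeasurableSpace Y] [BorelSpace Y]

/-- The measure that extends finitely additive counts. -/
noncomputable def AdditiveCount.measure (t : AdditiveCount Y) : Measure Y :=
  t.content.measure isSetRing_compactOpenSets.isSetSemiring generateFrom_compactOpenSets.le
    t.isSigmaSubadditive

theorem AdditiveCount.measure_apply (t : AdditiveCount Y) (A : CompactOpens Y) :
    t.measure (A : Set Y) = t.1 A := by
  rw [AdditiveCount.measure, AddContent.measure_eq _ _ generateFrom_compactOpenSets _
    ⟨A.isCompact, A.isOpen⟩, t.content_apply]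

theorem AdditiveCount.measurable_measure_inter (A : CompactOpens Y) {B : Set Y}
    (hB : MeasurableSet B) : Measurable fun t : AdditiveCount Y => t.measure (A ∩ B) := by
  have hA : MeasurableSet (A : Set Y) := A.isOpen.measurableSet
  have hfin : ∀ t : AdditiveCount Y, IsFiniteMeasure (t.measure.restrict (A : Set Y)) := fun t =>
    ⟨by rw [Measure.restrict_apply_univ, t.measure_apply]; exact ENNReal.natCast_lt_top _⟩
  have hap : ∀ (D : CompactOpens Y), Measurable fun t : AdditiveCount Y => t.measure (D : Set Y) := by
    intro D
    simp_rw [AdditiveCount.measure_apply]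
    exact measurable_from_nat.comp ((measurable_pi_apply D).comp measurable_subtype_coe)
  have h1 : Measurable fun t : AdditiveCount Y => t.measure.restrict (A : Set Y) := by
    refine Measurable.measure_of_isPiSystem generateFrom_compactOpenSets
      isSetRing_compactOpenSets.isSetSemiring.isPiSystem (fun s hs => ?_) ?_
    · simp_rw [Measure.restrict_apply hs.2.measurableSet]
      exact hap ⟨⟨s ∩ A, hs.1.inter A.isCompact⟩, hs.2.inter A.isOpen⟩
    · simp_rw [Measure.restrict_apply_univ]
      exact hap A
  convert (Measure.measurable_coe hB).comp h1 using 2 with t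
  simp only [Function.comp_apply]
  rw [Measure.restrict_apply hB, Set.inter_comm]

/-- A measure with finite integral values on a generating ring has integral values. -/
theorem AdditiveCount.exists_nat_measure_inter (t : AdditiveCount Y) (A : CompactOpens Y) {B : Set Y}
    (hB : MeasurableSet B) : ∃ k : ℕ, t.measure (A ∩ B) = k := by
  have hA : MeasurableSet (A : Set Y) := A.isOpen.measurableSet
  have hfin : t.measure (A : Set Y) ≠ ⊤ := by
    rw [t.measure_apply]; exact ENNReal.natCast_ne_top _
  refine MeasurableSpace.induction_on_inter (C := fun (s : Set Y) _ => ∃ k : ℕ, t.measure ((A : Set Y) ∩ s) = k)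
    generateFrom_compactOpenSets isSetRing_compactOpenSets.isSetSemiring.isPiSystem
    ⟨0, by simp⟩ ?_ ?_ ?_ B hB
  · intro s hs
    exact ⟨_, t.measure_apply ⟨⟨(A : Set Y) ∩ s, A.isCompact.inter hs.1⟩, A.isOpen.inter hs.2⟩⟩
  · rintro s hs ⟨k, hk⟩
    refine ⟨t.1 A - k, ?_⟩
    have h1 : (A : Set Y) ∩ sᶜ = (A : Set Y) \ ((A : Set Y) ∩ s) := by
      rw [Set.sdiff_self_inter, Set.sdiff_eq]
    rw [h1, measure_sdiff Set.inter_subset_left (hA.inter hs).nullMeasurableSet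
      (by rw [hk]; exact ENNReal.natCast_ne_top _), hk, t.measure_apply]
    exact (ENNReal.natCast_sub _ _).symm
  · intro f hd hf ih
    choose k hk using ih
    have h1 : t.measure (A ∩ ⋃ i, f i) = ∑' i, (k i : ENNReal) := by
      rw [Set.inter_iUnion, measure_iUnion]
      · simp_rw [hk]
      · exact fun i j hij => (hd hij).mono Set.inter_subset_right Set.inter_subset_right
      · exact fun i => hA.inter (hf i)
    have h2 : ∑' i, (k i : ENNReal) ≠ ⊤ := by
      rw [← h1]
      exact ne_top_of_le_ne_top hfin (measure_mono Set.inter_subset_left)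
    have h3 : (Function.support k).Finite := by
      have := ENNReal.finite_const_le_of_tsum_ne_top h2 one_ne_zero
      refine this.subset fun i hi => ?_
      have : 1 ≤ k i := Nat.one_le_iff_ne_zero.2 hi
      change (1 : ENNReal) ≤ k i
      exact_mod_cast this
    refine ⟨∑ i ∈ h3.toFinset, k i, ?_⟩
    rw [h1, tsum_eq_sum (s := h3.toFinset)]
    · push_cast; rfl
    · intro i hi
      simpa using hi

end CompactOpenRing

/-! ### Limits of random counts -/

section LimitLaw

open TopologicalSpace Topology Filter

theorem descFactorial_mul_self (t n : ℕ) :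
    t.descFactorial n * t = t.descFactorial (n + 1) + n * t.descFactorial n := by
  rw [Nat.descFactorial_succ]
  rcases le_or_gt n t with h | h
  · obtain ⟨k, rfl⟩ := Nat.exists_eq_add_of_le h
    simp
    ring
  · simp [Nat.descFactorial_eq_zero_iff_lt.2 h]

variable {Y : Type*} [TopologicalSpace Y]

/-- The product of falling factorials of the counts of the sets `A i`. -/
noncomputable def AdditiveCount.factorialProd {m : ℕ} (A : Fin m → CompactOpens Y) (n : Fin m → ℕ)
    (t : AdditiveCount Y) : ℝ :=
  ∏ i, ((t.1 (A i)).descFactorial (n i) : ℝ)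

/-- The product of falling factorials of the counts, truncated at `c`. -/
noncomputable def AdditiveCount.truncatedProd {m : ℕ} (A : Fin m → CompactOpens Y) (n : Fin m → ℕ)
    (c : ℕ) (t : AdditiveCount Y) : ℝ :=
  ∏ i, ((min (t.1 (A i)) c).descFactorial (n i) : ℝ)

namespace AdditiveCount

variable {m : ℕ} (A : Fin m → CompactOpens Y) (n : Fin m → ℕ)

theorem factorialProd_nonneg (t : AdditiveCount Y) : 0 ≤ factorialProd A n t :=
  Finset.prod_nonneg fun _ _ => Nat.cast_nonneg _

theorem truncatedProd_nonneg (c : ℕ) (t : AdditiveCount Y) : 0 ≤ truncatedProd A n c t :=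
  Finset.prod_nonneg fun _ _ => Nat.cast_nonneg _

theorem truncatedProd_mono (t : AdditiveCount Y) : Monotone fun c => truncatedProd A n c t := by
  intro c d hcd
  refine Finset.prod_le_prod (fun _ _ => Nat.cast_nonneg _) fun i _ => ?_
  exact_mod_cast Nat.descFactorial_le _ (min_le_min le_rfl hcd)

theorem truncatedProd_le (c : ℕ) (t : AdditiveCount Y) :
    truncatedProd A n c t ≤ factorialProd A n t := by
  refine Finset.prod_le_prod (fun _ _ => Nat.cast_nonneg _) fun i _ => ?_
  exact_mod_cast Nat.descFactorial_le _ (min_le_left _ _)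

theorem truncatedProd_eq {c : ℕ} {t : AdditiveCount Y} (h : ∀ i, t.1 (A i) ≤ c) :
    truncatedProd A n c t = factorialProd A n t := by
  simp [truncatedProd, factorialProd, h]

theorem tendsto_truncatedProd (t : AdditiveCount Y) :
    Tendsto (fun c => truncatedProd A n c t) atTop (𝓝 (factorialProd A n t)) := by
  refine tendsto_const_nhds.congr' ?_
  filter_upwards [eventually_ge_atTop (Finset.univ.sup fun i => t.1 (A i))] with c hc
  exact (truncatedProd_eq A n fun i => (Finset.le_sup (f := fun i => t.1 (A i))
    (Finset.mem_univ i)).trans hc).symm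

theorem factorialProd_mul (t : AdditiveCount Y) (i : Fin m) :
    factorialProd A n t * t.1 (A i) =
      factorialProd A (Function.update n i (n i + 1)) t + n i * factorialProd A n t := by
  unfold factorialProd
  rw [← Finset.mul_prod_erase _ _ (Finset.mem_univ i),
    ← Finset.mul_prod_erase _ (fun j => ((t.1 (A j)).descFactorial
      (Function.update n i (n i + 1) j) : ℝ)) (Finset.mem_univ i)]
  have h1 : ∏ j ∈ Finset.univ.erase i, ((t.1 (A j)).descFactorial
      (Function.update n i (n i + 1) j) : ℝ) =
      ∏ j ∈ Finset.univ.erase i, ((t.1 (A j)).descFactorial (n j) : ℝ) :=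
    Finset.prod_congr rfl fun j hj => by
      rw [Function.update_of_ne (Finset.ne_of_mem_erase hj)]
  rw [h1, Function.update_self]
  have h2 := descFactorial_mul_self (t.1 (A i)) (n i)
  have h3 : ((t.1 (A i)).descFactorial (n i) : ℝ) * t.1 (A i) =
    (t.1 (A i)).descFactorial (n i + 1) + n i * (t.1 (A i)).descFactorial (n i) := by
    exact_mod_cast h2
  linear_combination (∏ j ∈ Finset.univ.erase i, ((t.1 (A j)).descFactorial (n j) : ℝ)) * h3

/-- The error of the truncation at `c` is of order `1 / c`, with a constant made of factorial
moments. -/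
theorem factorialProd_le_truncatedProd_add {c : ℕ} (hc : 0 < c) (t : AdditiveCount Y) :
    factorialProd A n t ≤ truncatedProd A n c t +
      (∑ i, (factorialProd A (Function.update n i (n i + 1)) t + n i * factorialProd A n t)) / c := by
  have hf := factorialProd_nonneg A n t
  simp_rw [← factorialProd_mul]
  have hs : ∀ i, 0 ≤ factorialProd A n t * t.1 (A i) := fun i => mul_nonneg hf (Nat.cast_nonneg _)
  by_cases h : ∀ i, t.1 (A i) ≤ c
  · rw [truncatedProd_eq A n h]
    have := Finset.sum_nonneg fun i (_ : i ∈ Finset.univ) => hs i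
    have : 0 ≤ (∑ i, factorialProd A n t * t.1 (A i)) / (c : ℝ) := by positivity
    linarith
  · push Not at h
    obtain ⟨i, hi⟩ := h
    have h1 : factorialProd A n t * c ≤ ∑ i, factorialProd A n t * t.1 (A i) :=
      (mul_le_mul_of_nonneg_left (by exact_mod_cast hi.le) hf).trans
        (Finset.single_le_sum (f := fun i => factorialProd A n t * t.1 (A i))
          (fun j _ => hs j) (Finset.mem_univ i))
    have h2 : factorialProd A n t ≤ (∑ i, factorialProd A n t * t.1 (A i)) / (c : ℝ) := by
      rwa [le_div_iff₀ (by exact_mod_cast hc)]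
    linarith [truncatedProd_nonneg A n c t]

theorem continuous_apply (B : CompactOpens Y) : Continuous fun t : AdditiveCount Y => t.1 B :=
  (_root_.continuous_apply B).comp continuous_subtype_val

theorem continuous_truncatedProd (c : ℕ) : Continuous (truncatedProd A n c) := by
  unfold truncatedProd
  refine continuous_finsetProd _ fun i _ => ?_
  exact (continuous_of_discreteTopology (f := fun k : ℕ => ((min k c).descFactorial (n i) : ℝ))).comp
    (continuous_apply _)

theorem continuous_factorialProd : Continuous (factorialProd A n) := by
  unfold factorialProd
  refine continuous_finsetProd _ fun i _ => ?_
  exact (continuous_of_discreteTopology (f := fun k : ℕ => (k.descFactorial (n i) : ℝ))).comp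
    (continuous_apply _)

theorem norm_truncatedProd_le (c : ℕ) (t : AdditiveCount Y) :
    ‖truncatedProd A n c t‖ ≤ ∏ i, (c : ℝ) ^ n i := by
  rw [Real.norm_of_nonneg (truncatedProd_nonneg A n c t)]
  refine Finset.prod_le_prod (fun _ _ => Nat.cast_nonneg _) fun i _ => ?_
  exact_mod_cast (Nat.descFactorial_le _ (min_le_right _ _)).trans (Nat.descFactorial_le_pow _ _)

variable [SecondCountableTopology Y]

/-- Bounded first moments make random counts tight: by Markov's inequality the counts of all the
countably many compact open sets stay below suitable thresholds, and such counts form a compact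
set. -/
theorem isTightMeasureSet_range {Q : ℕ → ProbabilityMeasure (AdditiveCount Y)}
    (C : CompactOpens Y → ENNReal) (hC : ∀ B, C B ≠ ⊤)
    (hQ : ∀ N B, ∫⁻ t, (t.1 B : ENNReal) ∂(Q N : Measure (AdditiveCount Y)) ≤ C B) :
    IsTightMeasureSet {x | ∃ μ ∈ Set.range Q, (μ : Measure (AdditiveCount Y)) = x} := by
  have : Countable (CompactOpens Y) := countable_compactOpens
  rw [isTightMeasureSet_iff_exists_isCompact_measure_compl_le]
  intro ε hε
  obtain ⟨δ, hδ, hδε⟩ := ENNReal.exists_pos_sum_of_countable' hε.ne' (CompactOpens Y)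
  have hc : ∀ B, ∃ c : ℕ, C B / δ B < c := fun B =>
    ENNReal.exists_nat_gt (ENNReal.div_ne_top (hC B) (hδ B).ne')
  choose c hc using hc
  refine ⟨Subtype.val ⁻¹' Set.univ.pi fun B => Set.Iic (c B), ?_, ?_⟩
  · exact isClosed_additiveCount.isClosedEmbedding_subtypeVal.isCompact_preimage
      (isCompact_univ_pi fun B => (Set.finite_Iic _).isCompact)
  · rintro _ ⟨_, ⟨N, rfl⟩, rfl⟩
    have hsub : (Subtype.val ⁻¹' Set.univ.pi fun B => Set.Iic (c B) : Set (AdditiveCount Y))ᶜ ⊆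
        ⋃ B, {t : AdditiveCount Y | (c B : ENNReal) ≤ t.1 B} := by
      intro t ht
      simp only [Set.mem_compl_iff, Set.mem_preimage, Set.mem_pi, Set.mem_univ, true_imp_iff,
        Set.mem_Iic, not_forall, not_le] at ht
      obtain ⟨B, hB⟩ := ht
      exact Set.mem_iUnion.2 ⟨B, by
        change (c B : ENNReal) ≤ t.1 B
        exact_mod_cast hB.le⟩
    refine (measure_mono hsub).trans ((measure_iUnion_le _).trans ?_)
    refine le_trans (ENNReal.tsum_le_tsum fun B => ?_) hδε.le
    have hm : Measurable fun t : AdditiveCount Y => (t.1 B : ENNReal) :=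
      measurable_from_nat.comp (continuous_apply B).measurable
    have hcB : (c B : ENNReal) ≠ 0 := (lt_of_le_of_lt zero_le (hc B)).ne'
    refine (meas_ge_le_lintegral_div hm.aemeasurable hcB (ENNReal.natCast_ne_top _)).trans ?_
    refine (ENNReal.div_le_div_right (hQ N B) _).trans ?_
    exact ENNReal.div_le_of_le_mul' ((ENNReal.div_le_iff_le_mul (.inl (hδ B).ne')
      (.inr hcB)).1 (hc B).le)

/-- If all joint factorial moments of random counts converge, then a random count with the limiting
moments exists. The convergence of moments gives both the tightness and the uniform
integrability. -/
theorem exists_limit {Q : ℕ → ProbabilityMeasure (AdditiveCount Y)}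
    {R : (m : ℕ) → (Fin m → CompactOpens Y) → (Fin m → ℕ) → ℝ}
    (hint : ∀ N m A n, Integrable (factorialProd (m := m) A n) (Q N : Measure (AdditiveCount Y)))
    (hR : ∀ m A n, (Pairwise fun i j => Disjoint (A i : Set Y) (A j)) →
      Tendsto (fun N => ∫ t, factorialProd A n t ∂(Q N : Measure (AdditiveCount Y))) atTop
        (𝓝 (R m A n))) :
    ∃ P : ProbabilityMeasure (AdditiveCount Y), ∀ m A n,
      (Pairwise fun i j => Disjoint (A i : Set Y) (A j)) →
      Integrable (factorialProd (m := m) A n) (P : Measure (AdditiveCount Y)) ∧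
        ∫ t, factorialProd A n t ∂(P : Measure (AdditiveCount Y)) = R m A n := by
  have hcount : Countable (CompactOpens Y) := countable_compactOpens
  have hbd : ∀ B : CompactOpens Y, ∃ C : ENNReal, C ≠ ⊤ ∧
      ∀ N, ∫⁻ t, (t.1 B : ENNReal) ∂(Q N : Measure (AdditiveCount Y)) ≤ C := by
    intro B
    obtain ⟨C, hC⟩ := (hR 1 (fun _ => B) (fun _ => 1) (fun i j h => absurd (Subsingleton.elim i j) h)
      ).bddAbove_range
    refine ⟨ENNReal.ofReal C, ENNReal.ofReal_ne_top, fun N => ?_⟩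
    have h1 := hC ⟨N, rfl⟩
    have h2 := ofReal_integral_eq_lintegral_ofReal (hint N 1 (fun _ => B) (fun _ => 1))
      (.of_forall fun t => factorialProd_nonneg _ _ t)
    refine le_trans (le_of_eq ?_) (ENNReal.ofReal_le_ofReal h1)
    rw [h2]
    simp [factorialProd]
  choose C hC hCQ using hbd
  have hcomp := isCompact_closure_of_isTightMeasureSet
    (isTightMeasureSet_range C hC fun N B => hCQ B N)
  -- the limit along an ultrafilter avoids the choice of a subsequence
  obtain ⟨P, -, hP⟩ := hcomp.ultrafilter_le_nhds' ((hyperfilter ℕ).map Q)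
    (Filter.mem_map.2 (Filter.univ_mem' fun N => subset_closure ⟨N, rfl⟩))
  have hPt : Tendsto Q (hyperfilter ℕ) (𝓝 P) := hP
  rw [ProbabilityMeasure.tendsto_iff_forall_integral_tendsto] at hPt
  refine ⟨P, fun m A n hA => ?_⟩
  have hlim := fun n => (hR m A n hA).mono_left Nat.hyperfilter_le_atTop
  have htr : ∀ c, Integrable (truncatedProd A n c) (P : Measure (AdditiveCount Y)) := fun c =>
    .of_bound (continuous_truncatedProd A n c).measurable.aestronglyMeasurable _
      (.of_forall (norm_truncatedProd_le A n c))
  have htrN : ∀ N c, Integrable (truncatedProd A n c) (Q N : Measure (AdditiveCount Y)) :=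
    fun N c => .of_bound (continuous_truncatedProd A n c).measurable.aestronglyMeasurable _
      (.of_forall (norm_truncatedProd_le A n c))
  have hconv : ∀ c, Tendsto (fun N => ∫ t, truncatedProd A n c t ∂(Q N : Measure (AdditiveCount Y)))
      (hyperfilter ℕ) (𝓝 (∫ t, truncatedProd A n c t ∂(P : Measure (AdditiveCount Y)))) := by
    intro c
    exact hPt (BoundedContinuousFunction.ofNormedAddCommGroup _ (continuous_truncatedProd A n c) _
      (norm_truncatedProd_le A n c))
  -- truncated products are bounded and continuous, so that their integrals converge; `D / c` bounds
  -- the loss from the truncation, uniformly in `N`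
  set D := ∑ i, (R m A (Function.update n i (n i + 1)) + n i * R m A n) with hD
  have hle : ∀ c, ∫ t, truncatedProd A n c t ∂(P : Measure (AdditiveCount Y)) ≤ R m A n := by
    intro c
    exact le_of_tendsto_of_tendsto' (hconv c) (hlim n) fun N =>
      integral_mono (htrN N c) (hint N m A n) fun t => truncatedProd_le A n c t
  have hge : ∀ c : ℕ, 0 < c → R m A n - D / c ≤
      ∫ t, truncatedProd A n c t ∂(P : Measure (AdditiveCount Y)) := by
    intro c hc
    rw [sub_le_iff_le_add]
    refine le_of_tendsto_of_tendsto' (hlim n) ((hconv c).add (Tendsto.div_const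
      (tendsto_finsetSum _ fun i _ => (hlim (Function.update n i (n i + 1))).add
        ((hlim n).const_mul (n i : ℝ))) (c : ℝ))) fun N => ?_
    have hi : ∀ i ∈ Finset.univ, Integrable (fun t => factorialProd A (Function.update n i (n i + 1)) t +
        n i * factorialProd A n t) (Q N : Measure (AdditiveCount Y)) := fun i _ =>
      (hint N m A _).add ((hint N m A n).const_mul _)
    have h1 := integral_mono (hint N m A n) ((htrN N c).add
      ((integrable_finsetSum _ hi).div_const (c : ℝ)))
      (fun t => factorialProd_le_truncatedProd_add A n hc t)
    refine h1.trans (le_of_eq ?_)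
    rw [integral_add' (htrN N c) ((integrable_finsetSum _ hi).div_const (c : ℝ)), integral_div,
      integral_finsetSum _ hi]
    congr 2
    refine Finset.sum_congr rfl fun i _ => ?_
    rw [integral_add (hint N m A _) ((hint N m A n).const_mul _), integral_const_mul]
  have hT : Tendsto (fun c => ∫ t, truncatedProd A n c t ∂(P : Measure (AdditiveCount Y))) atTop
      (𝓝 (R m A n)) := by
    have h0 : Tendsto (fun c : ℕ => R m A n - D / c) atTop (𝓝 (R m A n)) := by
      simpa using tendsto_const_nhds.sub (tendsto_const_div_atTop_nhds_zero_nat D)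
    refine tendsto_of_tendsto_of_tendsto_of_le_of_le' h0 tendsto_const_nhds ?_ (.of_forall hle)
    filter_upwards [eventually_gt_atTop 0] with c hc using hge c hc
  have hmono := lintegral_tendsto_of_tendsto_of_monotone
    (μ := (P : Measure (AdditiveCount Y))) (f := fun c t => ENNReal.ofReal (truncatedProd A n c t))
    (F := fun t => ENNReal.ofReal (factorialProd A n t))
    (fun c => (continuous_truncatedProd A n c).measurable.ennreal_ofReal.aemeasurable)
    (.of_forall fun t c d hcd => ENNReal.ofReal_le_ofReal (truncatedProd_mono A n t hcd))
    (.of_forall fun t => ENNReal.tendsto_ofReal (tendsto_truncatedProd A n t))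
  have heq : ∫⁻ t, ENNReal.ofReal (factorialProd A n t) ∂(P : Measure (AdditiveCount Y)) =
      ENNReal.ofReal (R m A n) := by
    refine tendsto_nhds_unique hmono ?_
    have h2 : ∀ c, ∫⁻ t, ENNReal.ofReal (truncatedProd A n c t) ∂(P : Measure (AdditiveCount Y)) =
        ENNReal.ofReal (∫ t, truncatedProd A n c t ∂(P : Measure (AdditiveCount Y))) := fun c =>
      (ofReal_integral_eq_lintegral_ofReal (htr c) (.of_forall (truncatedProd_nonneg A n c))).symm
    simp_rw [h2]
    exact ENNReal.tendsto_ofReal hT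
  have hmeas := (continuous_factorialProd A n).measurable
  refine ⟨⟨hmeas.aestronglyMeasurable, ?_⟩, ?_⟩
  · rw [hasFiniteIntegral_iff_ofReal (.of_forall (factorialProd_nonneg A n)), heq]
    exact ENNReal.ofReal_lt_top
  · rw [integral_eq_lintegral_of_nonneg_ae (.of_forall (factorialProd_nonneg A n))
      hmeas.aestronglyMeasurable, heq, ENNReal.toReal_ofReal]
    exact ge_of_tendsto' (hlim n) fun N => integral_nonneg (factorialProd_nonneg A n)

end AdditiveCount

end LimitLaw

/-! ### Measurability on the space of configurations -/

section ConfMeasurability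

variable {M : Type*} [TopologicalSpace M] [MeasurableSpace M]

theorem Conf.measurable_count_sigmaAlgebra {B C : Set M} (hB : MeasurableSet B) (hBC : B ⊆ C) :
    Measurable[Conf.sigmaAlgebra C] (Conf.count B) := by
  have h : MeasurableSpace.comap (Conf.count B) inferInstance ≤ Conf.sigmaAlgebra C :=
    le_iSup_of_le B (le_iSup_of_le hB (le_iSup_of_le hBC le_rfl))
  exact Measurable.mono (comap_measurable _) h le_rfl

theorem Conf.measurable_count {B : Set M} (hB : MeasurableSet B) : Measurable (Conf.count B) :=
  Conf.measurable_count_sigmaAlgebra hB (Set.subset_univ B)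

theorem Conf.measurable_of_count {α : Type*} [MeasurableSpace α] {f : α → Conf M}
    (h : ∀ B, MeasurableSet B → Measurable fun a => Conf.count B (f a)) : Measurable f := by
  rw [measurable_iff_comap_le]
  change MeasurableSpace.comap f (Conf.sigmaAlgebra Set.univ) ≤ _
  simp only [Conf.sigmaAlgebra, MeasurableSpace.comap_iSup, iSup_le_iff]
  intro B hB _
  rw [MeasurableSpace.comap_comp]
  exact (h B hB).comap_le

end ConfMeasurability

/-! ### Approximation by the sets of a ring -/

section Approximation

open Filter Topology

/-- An inequality between finite measures extends from a generating ring to all measurable sets. -/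
theorem measure_le_of_isSetRing {Y : Type*} [mY : MeasurableSpace Y] {α β : Measure Y}
    [IsFiniteMeasure α] [IsFiniteMeasure β] {C : Set (Set Y)} (hC : IsSetRing C)
    (hcov : ∃ D : Set (Set Y), D.Countable ∧ D ⊆ C ∧ ⋃₀ D = Set.univ)
    (hgen : mY = MeasurableSpace.generateFrom C) (h : ∀ s ∈ C, α s ≤ β s) {s : Set Y}
    (hs : MeasurableSet s) : α s ≤ β s := by
  refine ENNReal.le_of_forall_pos_le_add fun ε hε _ => ?_
  have hε2 : (0 : ENNReal) < ε / 2 := ENNReal.half_pos (by exact_mod_cast hε.ne')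
  obtain ⟨D, hD1, hD2, hD3⟩ := hcov
  obtain ⟨t, ht, hts⟩ := exists_measure_symmDiff_lt_of_generateFrom_isSetRing (μ := α + β) hC
    ⟨D, hD1, hD2, by simp [hD3]⟩ hgen hs hε2
  rw [Measure.add_apply] at hts
  have h1 : α s ≤ α t + ε / 2 := by
    refine (measure_mono (t := t ∪ symmDiff t s) fun x hx => ?_).trans
      ((measure_union_le _ _).trans (add_le_add le_rfl (le_self_add.trans hts.le)))
    by_cases hxt : x ∈ t
    · exact .inl hxt
    · exact .inr (.inr ⟨hx, hxt⟩)
  have h2 : β t ≤ β s + ε / 2 := by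
    refine (measure_mono (t := s ∪ symmDiff t s) fun x hx => ?_).trans
      ((measure_union_le _ _).trans (add_le_add le_rfl (le_add_self.trans hts.le)))
    by_cases hxs : x ∈ s
    · exact .inl hxs
    · exact .inr (.inl ⟨hx, hxs⟩)
  calc α s ≤ β s + ε / 2 + ε / 2 := h1.trans (add_le_add ((h t ht).trans h2) le_rfl)
    _ = β s + ε := by rw [add_assoc, ENNReal.add_halves]

/-- Sets that approximate disjoint sets, made disjoint, still approximate them. -/
theorem ae_eventually_mem_sdiff_iff {Y : Type*} [MeasurableSpace Y] {ν : Measure Y} {m : ℕ}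
    {B : Fin m → Set Y} (hB : Pairwise fun i j => Disjoint (B i) (B j)) {A : ℕ → Fin m → Set Y}
    (h : ∀ i, ∑' j, ν (symmDiff (A j i) (B i)) ≠ ⊤) :
    ∀ᵐ y ∂ν, ∀ i, ∀ᶠ j in atTop, (y ∈ A j i \ ⋃ l < i, A j l ↔ y ∈ B i) := by
  have h1 : ∀ i, ∀ᵐ y ∂ν, ∀ᶠ j in atTop, y ∉ symmDiff (A j i) (B i) := fun i =>
    ae_eventually_notMem (h i)
  filter_upwards [ae_all_iff.2 h1] with y hy i
  filter_upwards [eventually_all.2 hy] with j hj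
  have hj' : ∀ l, y ∈ A j l ↔ y ∈ B l := by
    intro l
    have := hj l
    rw [Set.mem_symmDiff] at this
    tauto
  simp only [Set.mem_sdiff, Set.mem_iUnion, not_exists, hj', exists_prop]
  constructor
  · exact fun hh => hh.1
  · exact fun hh => ⟨hh, fun l hl => Set.disjoint_left.1 (hB hl.1.ne) hl.2 hh⟩

/-- Falling factorials control powers, so that factorial moments control moments. -/
theorem pow_le_add_descFactorial (t m : ℕ) : t ^ m ≤ (2 * m) ^ m + 2 ^ m * t.descFactorial m := by
  rcases le_or_gt t (2 * m) with h | h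
  · exact (Nat.pow_le_pow_left h m).trans (Nat.le_add_right _ _)
  · calc t ^ m ≤ (2 * (t + 1 - m)) ^ m := Nat.pow_le_pow_left (by omega) m
      _ = 2 ^ m * (t + 1 - m) ^ m := mul_pow _ _ _
      _ ≤ 2 ^ m * t.descFactorial m := Nat.mul_le_mul_left _ (Nat.pow_sub_le_descFactorial t m)
      _ ≤ _ := Nat.le_add_left _ _

end Approximation

/-! ### The intensity of a random count -/

section ConfOfCount

open TopologicalSpace Topology Filter

variable {Y : Type*} [TopologicalSpace Y] [T2Space Y] [LocallyCompactSpace Y]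
  [TotallyDisconnectedSpace Y] [SecondCountableTopology Y] [MeasurableSpace Y] [BorelSpace Y]
  {M : Type*} [MeasurableSpace M]

/-- The law of a random additive count has intensity at most `C μ` on `U` if the moment formula with
a kernel bounded by `C` holds. -/
theorem AdditiveCount.lintegral_measure_inter_le {μ : Measure M} [IsFiniteMeasure μ] {ψ : M → Y}
    (hψ : Measurable ψ) {Q : Measure (AdditiveCount Y)} [IsFiniteMeasure Q] {U : CompactOpens Y}
    {C : NNReal} (hcov : ∃ D : Set (Set Y), D.Countable ∧ D ⊆ compactOpenSets Y ∧ ⋃₀ D = Set.univ)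
    (hint : ∀ A : CompactOpens Y, (A : Set Y) ⊆ U →
      ∫⁻ t, (t.1 A : ENNReal) ∂Q ≤ C * μ (ψ ⁻¹' (A : Set Y)))
    {B : Set Y} (hB : MeasurableSet B) :
    ∫⁻ t, t.measure ((U : Set Y) ∩ B) ∂Q ≤ C * μ (ψ ⁻¹' ((U : Set Y) ∩ B)) := by
  have hU : MeasurableSet (U : Set Y) := U.isOpen.measurableSet
  let α : Measure Y := Measure.ofMeasurable (fun B _ => ∫⁻ t, t.measure ((U : Set Y) ∩ B) ∂Q)
    (by simp) (fun f hf hd => by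
      have h1 : ∀ t : AdditiveCount Y, t.measure ((U : Set Y) ∩ ⋃ i, f i) =
          ∑' i, t.measure ((U : Set Y) ∩ f i) := fun t => by
        rw [Set.inter_iUnion, measure_iUnion
          (fun i j hij => (hd hij).mono Set.inter_subset_right Set.inter_subset_right)
          fun i => hU.inter (hf i)]
      simp_rw [h1]
      exact lintegral_tsum fun i => (AdditiveCount.measurable_measure_inter U (hf i)).aemeasurable)
  have hα : ∀ s, MeasurableSet s → α s = ∫⁻ t, t.measure ((U : Set Y) ∩ s) ∂Q := fun s hs =>
    Measure.ofMeasurable_apply s hs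
  let β : Measure Y := C • (μ.map ψ).restrict (U : Set Y)
  have hβ : ∀ s, MeasurableSet s → β s = C * μ (ψ ⁻¹' ((U : Set Y) ∩ s)) := fun s hs => by
    simp only [β, Measure.smul_apply]
    rw [Measure.restrict_apply hs, Measure.map_apply hψ (hs.inter hU), Set.inter_comm]
    rfl
  have hle : ∀ s ∈ compactOpenSets Y, α s ≤ β s := by
    intro s hs
    rw [hα s hs.2.measurableSet, hβ s hs.2.measurableSet]
    refine le_trans (le_of_eq ?_) (hint ⟨⟨(U : Set Y) ∩ s, U.isCompact.inter hs.1⟩,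
      U.isOpen.inter hs.2⟩ Set.inter_subset_left)
    exact lintegral_congr fun t => t.measure_apply
      ⟨⟨(U : Set Y) ∩ s, U.isCompact.inter hs.1⟩, U.isOpen.inter hs.2⟩
  have : IsFiniteMeasure α := by
    refine ⟨?_⟩
    have h1 := hle U ⟨U.isCompact, U.isOpen⟩
    have h2 : α Set.univ = α U := by
      rw [hα _ MeasurableSet.univ, hα _ hU, Set.inter_univ, Set.inter_self]
    rw [h2]
    exact h1.trans_lt (measure_lt_top β _)
  have := measure_le_of_isSetRing isSetRing_compactOpenSets hcov generateFrom_compactOpenSets hle hB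
  rwa [hα B hB, hβ B hB] at this

end ConfOfCount

/-! ### The moment formula on Borel sets -/

section BorelMoments

open TopologicalSpace Topology Filter

variable {Y : Type*} [TopologicalSpace Y] {M : Type*} [MeasurableSpace M] {μ : Measure M}
  {ψ : M → Y} {Q : Measure (AdditiveCount Y)} {K : M → M → ℂ}

/-- The joint factorial moments of the counts of disjoint compact open sets are those of a
determinantal process with kernel `K`, transported to `Y` by `ψ`. -/
def AdditiveCount.HasMoments (μ : Measure M) (ψ : M → Y) (K : M → M → ℂ)
    (Q : Measure (AdditiveCount Y)) : Prop :=
  ∀ (m : ℕ) (A : Fin m → CompactOpens Y) (n : Fin m → ℕ),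
    (Pairwise fun i j => Disjoint (A i : Set Y) (A j)) →
    Integrable (AdditiveCount.factorialProd A n) Q ∧
    ((∫ t, AdditiveCount.factorialProd A n t ∂Q : ℝ) : ℂ) =
      ∫ x in Set.univ.pi (fun p : Σ i, Fin (n i) => ψ ⁻¹' (A p.1 : Set Y)), kernelDet K x
        ∂(Measure.pi fun _ => μ)

namespace AdditiveCount

theorem HasMoments.lintegral_le [IsFiniteMeasure μ] (h : HasMoments μ ψ K Q) {U : CompactOpens Y}
    {C : NNReal} (hC : ∀ x y, ψ x ∈ U → ψ y ∈ U → ‖K x y‖ ≤ C) {A : CompactOpens Y}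
    (hA : (A : Set Y) ⊆ U) :
    ∫⁻ t, (t.1 A : ENNReal) ∂Q ≤ C * μ (ψ ⁻¹' (A : Set Y)) := by
  obtain ⟨h1, h2⟩ := h 1 (fun _ => A) (fun _ => 1)
    (fun i j hij => absurd (Subsingleton.elim i j) hij)
  have h3 := ofReal_integral_eq_lintegral_ofReal h1 (.of_forall fun t => factorialProd_nonneg _ _ t)
  have h4 : ∫⁻ t, (t.1 A : ENNReal) ∂Q =
      ∫⁻ t, ENNReal.ofReal (factorialProd (fun _ : Fin 1 => A) (fun _ => 1) t) ∂Q := by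
    refine lintegral_congr fun t => ?_
    simp [factorialProd]
  rw [h4, ← h3]
  have h5 : ‖((∫ t, factorialProd (fun _ : Fin 1 => A) (fun _ => 1) t ∂Q : ℝ) : ℂ)‖ ≤
      C * (μ (ψ ⁻¹' (A : Set Y))).toReal := by
    rw [h2]
    refine (norm_setIntegral_le_of_norm_le_const (C := C) (measure_lt_top _ _) fun x hx => ?_).trans
      (le_of_eq ?_)
    · refine (norm_kernelDet_le (C := C) fun p q => hC _ _ ?_ ?_).trans (by simp)
      · exact hA (hx p (Set.mem_univ p))
      · exact hA (hx q (Set.mem_univ q))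
    · rw [measureReal_def, Measure.pi_pi]
      simp
  rw [Complex.norm_real] at h5
  calc _ ≤ ENNReal.ofReal (C * (μ (ψ ⁻¹' (A : Set Y))).toReal) :=
        ENNReal.ofReal_le_ofReal ((le_abs_self _).trans h5)
    _ = _ := by
      rw [ENNReal.ofReal_mul C.coe_nonneg, ENNReal.ofReal_toReal (measure_ne_top _ _), ENNReal.ofReal_coe_nnreal]

/-- All moments of the counts are finite, which provides the dominating functions below. -/
theorem HasMoments.integrable_pow [SecondCountableTopology Y] [IsFiniteMeasure Q]
    (h : HasMoments μ ψ K Q) (U : CompactOpens Y) (k : ℕ) :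
    Integrable (fun t : AdditiveCount Y => (t.1 U : ℝ) ^ k) Q := by
  have : Countable (CompactOpens Y) := countable_compactOpens
  obtain ⟨h1, -⟩ := h 1 (fun _ => U) (fun _ => k)
    (fun i j hij => absurd (Subsingleton.elim i j) hij)
  have h2 : Integrable (fun t : AdditiveCount Y => ((2 * k : ℕ) : ℝ) ^ k +
      2 ^ k * factorialProd (fun _ : Fin 1 => U) (fun _ => k) t) Q :=
    (integrable_const _).add (h1.const_mul _)
  refine h2.mono' ?_ (.of_forall fun t => ?_)
  · exact ((continuous_of_discreteTopology (f := fun j : ℕ => (j : ℝ) ^ k)).comp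
      (continuous_apply U)).measurable.aestronglyMeasurable
  · rw [Real.norm_of_nonneg (by positivity)]
    simp only [factorialProd, Finset.univ_unique, Finset.prod_singleton]
    exact_mod_cast pow_le_add_descFactorial (t.1 U) k

variable [T2Space Y] [LocallyCompactSpace Y] [TotallyDisconnectedSpace Y]
  [SecondCountableTopology Y] [MeasurableSpace Y] [BorelSpace Y]

theorem factorialProd_le_pow {m : ℕ} {A : Fin m → CompactOpens Y} {U : CompactOpens Y}
    (hA : ∀ i, (A i : Set Y) ⊆ U) (n : Fin m → ℕ) (t : AdditiveCount Y) :
    factorialProd A n t ≤ (t.1 U : ℝ) ^ ∑ i, n i := by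
  rw [← Finset.prod_pow_eq_pow_sum]
  refine Finset.prod_le_prod (fun _ _ => Nat.cast_nonneg _) fun i _ => ?_
  have h1 : t.1 (A i) ≤ t.1 U := by
    have := measure_mono (μ := t.measure) (hA i)
    rw [t.measure_apply, t.measure_apply] at this
    exact_mod_cast this
  exact_mod_cast (Nat.descFactorial_le_pow _ _).trans (Nat.pow_le_pow_left h1 _)

/-- The moment formula extends from compact open sets to Borel sets, by approximation: for almost
every configuration the counts of the approximating sets are eventually equal to the limiting
ones. -/
theorem HasMoments.borel [IsFiniteMeasure μ] [IsFiniteMeasure Q] (h : HasMoments μ ψ K Q) (hψ : Measurable ψ)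
    (hcov : ∃ D : Set (Set Y), D.Countable ∧ D ⊆ compactOpenSets Y ∧ ⋃₀ D = Set.univ)
    (hK : Measurable (Function.uncurry K)) {U : CompactOpens Y}
    {C : NNReal} (hC : ∀ x y, ψ x ∈ U → ψ y ∈ U → ‖K x y‖ ≤ C) {m : ℕ} {B : Fin m → Set Y}
    (hB : ∀ i, MeasurableSet (B i)) (hBU : ∀ i, B i ⊆ U)
    (hd : Pairwise fun i j => Disjoint (B i) (B j)) (n : Fin m → ℕ) :
    Integrable (fun t : AdditiveCount Y =>
        ∏ i, ∏ j ∈ Finset.range (n i), ((t.measure (B i)).toReal - j)) Q ∧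
    IntegrableOn (kernelDet K) (Set.univ.pi fun p : Σ i, Fin (n i) => ψ ⁻¹' B p.1)
      (Measure.pi fun _ => μ) ∧
    ((∫ t : AdditiveCount Y, ∏ i, ∏ j ∈ Finset.range (n i), ((t.measure (B i)).toReal - j) ∂Q : ℝ)
        : ℂ) =
      ∫ x in Set.univ.pi (fun p : Σ i, Fin (n i) => ψ ⁻¹' B p.1), kernelDet K x
        ∂(Measure.pi fun _ => μ) := by
  classical
  have hU : MeasurableSet (U : Set Y) := U.isOpen.measurableSet
  -- approximation by compact open subsets of `U`, with summable errors
  obtain ⟨δ, hδ, hδs⟩ := ENNReal.exists_pos_sum_of_countable' (one_ne_zero (α := ENNReal)) ℕ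
  have happ : ∀ (j : ℕ) (i : Fin m), ∃ A : CompactOpens Y, (A : Set Y) ⊆ U ∧
      μ.map ψ (symmDiff (A : Set Y) (B i)) < δ j := by
    intro j i
    obtain ⟨D, hD1, hD2, hD3⟩ := hcov
    obtain ⟨s, hs, hsB⟩ := exists_measure_symmDiff_lt_of_generateFrom_isSetRing (μ := μ.map ψ)
      isSetRing_compactOpenSets ⟨D, hD1, hD2, by simp [hD3]⟩ generateFrom_compactOpenSets (hB i) (hδ j)
    refine ⟨⟨⟨s ∩ U, hs.1.inter U.isCompact⟩, hs.2.inter U.isOpen⟩, Set.inter_subset_right,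
      lt_of_le_of_lt (measure_mono ?_) hsB⟩
    rintro y (⟨hy1, hy2⟩ | ⟨hy1, hy2⟩)
    · exact .inl ⟨hy1.1, hy2⟩
    · exact .inr ⟨hy1, fun hys => hy2 ⟨hys, hBU i hy1⟩⟩
  choose A hAU hAδ using happ
  -- the moment formula needs disjoint sets
  let A' : ℕ → Fin m → CompactOpens Y := fun j i =>
    ⟨⟨(A j i : Set Y) \ ⋃ l < i, (A j l : Set Y),
      (A j i).isCompact.diff (isOpen_biUnion fun l _ => (A j l).isOpen)⟩,
      (A j i).isOpen.sdiff ((Set.toFinite {l | l < i}).isClosed_biUnion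
        fun l _ => (A j l).isCompact.isClosed)⟩
  have hA'coe : ∀ j i, (A' j i : Set Y) = (A j i : Set Y) \ ⋃ l < i, (A j l : Set Y) :=
    fun j i => rfl
  have hA'U : ∀ j i, (A' j i : Set Y) ⊆ U := fun j i => Set.sdiff_subset.trans (hAU j i)
  have hA'd : ∀ j, Pairwise fun i i' => Disjoint (A' j i : Set Y) (A' j i') := by
    intro j i i' hii
    rw [Set.disjoint_left]
    rintro y ⟨hy1, hy2⟩ ⟨hy3, hy4⟩
    rcases lt_or_gt_of_ne hii with hlt | hlt
    · exact hy4 (Set.mem_iUnion₂.2 ⟨i, hlt, hy1⟩)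
    · exact hy2 (Set.mem_iUnion₂.2 ⟨i', hlt, hy3⟩)
  have hsym : ∀ j i, MeasurableSet (symmDiff (A j i : Set Y) (B i)) := fun j i =>
    (A j i).isOpen.measurableSet.symmDiff (hB i)
  have hsymU : ∀ j i, symmDiff (A j i : Set Y) (B i) ⊆ U := fun j i y hy => by
    rcases hy with hy | hy
    · exact hAU j i hy.1
    · exact hBU i hy.1
  -- almost every configuration sees only finitely many of the errors
  have hQae : ∀ᵐ t ∂Q, ∀ i, ∑' j, t.measure ((U : Set Y) ∩ symmDiff (A j i : Set Y) (B i)) ≠ ⊤ := by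
    rw [ae_all_iff]
    intro i
    have hm : ∀ j, Measurable fun t : AdditiveCount Y =>
        t.measure ((U : Set Y) ∩ symmDiff (A j i : Set Y) (B i)) := fun j =>
      measurable_measure_inter U (hsym j i)
    have hfin : ∫⁻ t, ∑' j, t.measure ((U : Set Y) ∩ symmDiff (A j i : Set Y) (B i)) ∂Q ≠ ⊤ := by
      rw [lintegral_tsum fun j => (hm j).aemeasurable]
      refine ne_top_of_le_ne_top (b := (C : ENNReal) * 1)
        (ENNReal.mul_ne_top ENNReal.coe_ne_top ENNReal.one_ne_top) ?_
      refine (ENNReal.tsum_le_tsum (g := fun j => C * δ j) fun j => ?_).trans ?_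
      · refine (lintegral_measure_inter_le hψ hcov (fun A hA => h.lintegral_le hC hA)
          (hsym j i)).trans ?_
        gcongr
        rw [Set.inter_eq_right.2 (hsymU j i), ← Measure.map_apply hψ (hsym j i)]
        exact (hAδ j i).le
      · rw [ENNReal.tsum_mul_left]
        gcongr
    filter_upwards [ae_lt_top (Measurable.tsum hm) hfin] with t ht using ht.ne
  have hμs : ∀ i, ∑' j, μ.map ψ (symmDiff (A j i : Set Y) (B i)) ≠ ⊤ := fun i =>
    ne_top_of_le_ne_top ENNReal.one_ne_top
      ((ENNReal.tsum_le_tsum fun j => (hAδ j i).le).trans hδs.le)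
  have hnat : ∀ (t : AdditiveCount Y) i, ∃ k : ℕ, t.measure (B i) = k := fun t i => by
    have := t.exists_nat_measure_inter U (hB i)
    rwa [Set.inter_eq_right.2 (hBU i)] at this
  let f : AdditiveCount Y → ℝ := fun t =>
    ∏ i, ∏ j ∈ Finset.range (n i), ((t.measure (B i)).toReal - j)
  have hfm : AEStronglyMeasurable f Q := by
    refine Measurable.aestronglyMeasurable ?_
    refine Finset.measurable_prod _ fun i _ => Finset.measurable_prod _ fun j _ => ?_
    have h1 := measurable_measure_inter U (hB i)
    simp_rw [Set.inter_eq_right.2 (hBU i)] at h1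
    exact h1.ennreal_toReal.sub_const _
  have hconv : ∀ᵐ t ∂Q, Tendsto (fun j => factorialProd (A' j) n t) atTop (𝓝 (f t)) := by
    filter_upwards [hQae] with t ht
    have hfin : IsFiniteMeasure (t.measure.restrict (U : Set Y)) :=
      ⟨by rw [Measure.restrict_apply_univ, t.measure_apply]; exact ENNReal.natCast_lt_top _⟩
    have hae := ae_eventually_mem_sdiff_iff (ν := t.measure.restrict (U : Set Y)) hd
      (A := fun j i => (A j i : Set Y)) (fun i => by
        have := ht i
        simp_rw [Measure.restrict_apply (hsym _ i), Set.inter_comm _ (U : Set Y)]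
        exact this)
    refine tendsto_finsetProd _ fun i _ => ?_
    have h1 : Tendsto (fun j => t.measure.restrict (U : Set Y) (A' j i : Set Y)) atTop
        (𝓝 (t.measure.restrict (U : Set Y) (B i))) := by
      refine tendsto_measure_of_ae_tendsto_indicator_of_isFiniteMeasure atTop (hB i)
        (fun j => (A' j i).isOpen.measurableSet) ?_
      filter_upwards [hae] with y hy using hy i
    rw [Measure.restrict_apply (hB i), Set.inter_eq_left.2 (hBU i)] at h1
    have h2 : ∀ j, t.measure.restrict (U : Set Y) (A' j i : Set Y) = t.1 (A' j i) := fun j => by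
      rw [Measure.restrict_apply (A' j i).isOpen.measurableSet, Set.inter_eq_left.2 (hA'U j i),
        t.measure_apply]
    simp_rw [h2] at h1
    obtain ⟨k, hk⟩ := hnat t i
    have h3 : Tendsto (fun j => (t.1 (A' j i) : ℝ)) atTop (𝓝 (t.measure (B i)).toReal) := by
      have := (ENNReal.tendsto_toReal (by rw [hk]; exact ENNReal.natCast_ne_top k)).comp h1
      simpa [Function.comp_def] using this
    simp_rw [← prod_range_sub_eq_descFactorial]
    exact tendsto_finsetProd _ fun l _ => h3.sub_const _
  have hdom : ∀ j, ∀ᵐ t ∂Q, ‖factorialProd (A' j) n t‖ ≤ (t.1 U : ℝ) ^ ∑ i, n i := fun j =>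
    .of_forall fun t => by
      rw [Real.norm_of_nonneg (factorialProd_nonneg _ _ t)]
      exact factorialProd_le_pow (hA'U j) n t
  have hmeasA : ∀ j, AEStronglyMeasurable (factorialProd (A' j) n) Q := fun j =>
    (h m (A' j) n (hA'd j)).1.aestronglyMeasurable
  have hlim := tendsto_integral_of_dominated_convergence _ hmeasA (h.integrable_pow U _) hdom hconv
  have hfi : Integrable f Q := by
    refine (h.integrable_pow U (∑ i, n i)).mono' hfm ?_
    filter_upwards [hconv] with t ht
    refine le_of_tendsto' ht.norm fun j => ?_
    rw [Real.norm_of_nonneg (factorialProd_nonneg _ _ t)]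
    exact factorialProd_le_pow (hA'U j) n t
  -- the determinantal side
  set J := Σ i, Fin (n i)
  set Dc : ℝ := (Fintype.card J).factorial * (C : ℝ) ^ Fintype.card J
  have hms : ∀ j, MeasurableSet (Set.univ.pi fun p : J => ψ ⁻¹' (A' j p.1 : Set Y)) := fun j =>
    MeasurableSet.univ_pi fun p => hψ (A' j p.1).isOpen.measurableSet
  have hmB : MeasurableSet (Set.univ.pi fun p : J => ψ ⁻¹' B p.1) :=
    MeasurableSet.univ_pi fun p => hψ (hB p.1)
  have hDc : 0 ≤ Dc := by positivity
  have hbound : ∀ (S : J → Set Y), (∀ p, S p ⊆ U) → ∀ x,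
      ‖(Set.univ.pi fun p : J => ψ ⁻¹' S p).indicator (kernelDet K) x‖ ≤ Dc := by
    intro S hS x
    by_cases hx : x ∈ Set.univ.pi fun p : J => ψ ⁻¹' S p
    · rw [Set.indicator_of_mem hx]
      exact norm_kernelDet_le fun p q => hC _ _ (hS p (hx p (Set.mem_univ p)))
        (hS q (hx q (Set.mem_univ q)))
    · rw [Set.indicator_of_notMem hx, norm_zero]
      exact hDc
  have hdet := measurable_kernelDet (J := J) hK
  have hBint : IntegrableOn (kernelDet K) (Set.univ.pi fun p : J => ψ ⁻¹' B p.1)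
      (Measure.pi fun _ => μ) := by
    rw [← integrable_indicator_iff hmB]
    exact .of_bound (hdet.indicator hmB).aestronglyMeasurable Dc
      (.of_forall (hbound _ fun p => hBU p.1))
  have hdetlim : Tendsto (fun j => ∫ x in Set.univ.pi (fun p : J => ψ ⁻¹' (A' j p.1 : Set Y)),
      kernelDet K x ∂(Measure.pi fun _ => μ)) atTop
      (𝓝 (∫ x in Set.univ.pi (fun p : J => ψ ⁻¹' B p.1), kernelDet K x
        ∂(Measure.pi fun _ => μ))) := by
    rw [← integral_indicator hmB]
    simp_rw [← integral_indicator (hms _)]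
    refine tendsto_integral_of_dominated_convergence (fun _ => Dc)
      (fun j => (hdet.indicator (hms j)).aestronglyMeasurable) (integrable_const _)
      (fun j => .of_forall (hbound _ fun p => hA'U j p.1)) ?_
    have hae := ae_eventually_mem_sdiff_iff (ν := μ.map ψ) hd (A := fun j i => (A j i : Set Y)) hμs
    have hae' : ∀ᵐ z ∂μ, ∀ i, ∀ᶠ j in atTop, (ψ z ∈ (A' j i : Set Y) ↔ ψ z ∈ B i) :=
      ae_of_ae_map hψ.aemeasurable hae
    have hae2 : ∀ᵐ x ∂(Measure.pi fun _ : J => μ), ∀ p : J, ∀ i, ∀ᶠ j in atTop,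
        (ψ (x p) ∈ (A' j i : Set Y) ↔ ψ (x p) ∈ B i) := by
      rw [ae_all_iff]
      exact fun p => (Measure.tendsto_eval_ae_ae (μ := fun _ : J => μ) (i := p)).eventually hae'
    filter_upwards [hae2] with x hx
    refine tendsto_const_nhds.congr' ?_
    filter_upwards [eventually_all.2 fun p : J => hx p p.1] with j hj
    have hiff : x ∈ (Set.univ.pi fun p : J => ψ ⁻¹' (A' j p.1 : Set Y)) ↔
        x ∈ Set.univ.pi fun p : J => ψ ⁻¹' B p.1 := by
      simp only [Set.mem_pi, Set.mem_univ, true_imp_iff, Set.mem_preimage]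
      exact forall_congr' hj
    by_cases hxB : x ∈ Set.univ.pi fun p : J => ψ ⁻¹' B p.1
    · rw [Set.indicator_of_mem hxB, Set.indicator_of_mem (hiff.2 hxB)]
    · rw [Set.indicator_of_notMem hxB, Set.indicator_of_notMem (mt hiff.1 hxB)]
  refine ⟨hfi, hBint, ?_⟩
  have h1 : Tendsto (fun j => ((∫ t, factorialProd (A' j) n t ∂Q : ℝ) : ℂ)) atTop
      (𝓝 ((∫ t, f t ∂Q : ℝ) : ℂ)) := (Complex.continuous_ofReal.tendsto _).comp hlim
  simp_rw [(h m (A' _) n (hA'd _)).2] at h1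
  exact tendsto_nhds_unique h1 hdetlim

end AdditiveCount

end BorelMoments

/-! ### Existence of limits of determinantal processes -/

section Existence

open TopologicalSpace Topology Filter

/-- Determinantal integrals over bounded sets converge if the kernels converge pointwise and
stay bounded. -/
theorem tendsto_setIntegral_kernelDet {M J : Type*} [MeasurableSpace M] [Fintype J] [DecidableEq J]
    {μ : Measure M} [IsFiniteMeasure μ] {K : M → M → ℂ} {Kn : ℕ → M → M → ℂ}
    (hKn : ∀ N, Measurable (Function.uncurry (Kn N)))
    (hlim : ∀ x y, Tendsto (fun N => Kn N x y) atTop (𝓝 (K x y))) {C : ℝ} {S : J → Set M}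
    (hS : ∀ p, MeasurableSet (S p)) (hC : ∀ N p q, ∀ x ∈ S p, ∀ y ∈ S q, ‖Kn N x y‖ ≤ C) :
    Tendsto (fun N => ∫ x in Set.univ.pi S, kernelDet (Kn N) x ∂(Measure.pi fun _ => μ)) atTop
      (𝓝 (∫ x in Set.univ.pi S, kernelDet K x ∂(Measure.pi fun _ => μ))) := by
  refine tendsto_integral_of_dominated_convergence
    (fun _ => (Fintype.card J).factorial * C ^ Fintype.card J)
    (fun N => (measurable_kernelDet (hKn N)).aestronglyMeasurable) (integrable_const _)
    (fun N => (ae_restrict_mem (MeasurableSet.univ_pi hS)).mono fun x hx => ?_)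
    (.of_forall fun x => ?_)
  · exact norm_kernelDet_le fun p q => hC N p q _ (hx p (Set.mem_univ p)) _ (hx q (Set.mem_univ q))
  · have hcont : Continuous fun A : Matrix J J ℂ => A.det := continuous_id.matrix_det
    refine (hcont.tendsto (Matrix.of fun p q => K (x p) (x q))).comp ?_
    exact tendsto_pi_nhds.2 fun p => tendsto_pi_nhds.2 fun q => hlim _ _

/-- The counts of the compact open sets by the points `ψ (x i)`. -/
noncomputable def AdditiveCount.ofPoints {Y M I : Type*} [TopologicalSpace Y] [Fintype I] (ψ : M → Y)
    (x : I → M) : AdditiveCount Y :=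
  ⟨fun A => pointCount x (ψ ⁻¹' (A : Set Y)), by
    refine ⟨pointCount_empty x, fun A B h => ?_⟩
    simp only [CompactOpens.coe_sup, Set.preimage_union]
    exact pointCount_union x (h.preimage ψ)⟩

theorem AdditiveCount.measurable_ofPoints {Y M I : Type*} [TopologicalSpace Y] [MeasurableSpace Y]
    [OpensMeasurableSpace Y] [MeasurableSpace M] [Fintype I] {ψ : M → Y} (hψ : Measurable ψ) :
    Measurable (AdditiveCount.ofPoints (I := I) ψ) :=
  Measurable.subtype_mk <| measurable_pi_lambda _ fun A =>
    measurable_pointCount (hψ A.isOpen.measurableSet)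

variable {Y : Type*} [TopologicalSpace Y] [T2Space Y] [LocallyCompactSpace Y]
  [TotallyDisconnectedSpace Y] [SecondCountableTopology Y] [MeasurableSpace Y] [BorelSpace Y]
  {M : Type*} [TopologicalSpace M] [MeasurableSpace M]

/-- The configuration on `M` given by counts on `Y`, for a measurable embedding `ψ : M → Y` that
maps bounded sets into compact open sets. -/
noncomputable def AdditiveCount.toConf {ψ : M → Y} (hψ : MeasurableEmbedding ψ)
    (hbd : ∀ B : Set M, IsBoundedBorel B → ∃ U : CompactOpens Y, ψ '' B ⊆ U)
    (t : AdditiveCount Y) : Conf M :=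
  ⟨t.measure.comap ψ, fun B hB => by
    obtain ⟨U, hU⟩ := hbd B hB
    have := t.exists_nat_measure_inter U (hψ.measurableSet_image.2 hB.1)
    rwa [Set.inter_eq_right.2 hU, ← hψ.comap_apply] at this⟩

theorem AdditiveCount.count_toConf {ψ : M → Y} (hψ : MeasurableEmbedding ψ)
    (hbd : ∀ B : Set M, IsBoundedBorel B → ∃ U : CompactOpens Y, ψ '' B ⊆ U)
    (t : AdditiveCount Y) (B : Set M) : Conf.count B (t.toConf hψ hbd) = t.measure (ψ '' B) :=
  hψ.comap_apply _ _

/-- A pointwise, locally bounded limit of kernels of finite determinantal processes is the kernel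
of a determinantal process. The function `lvl` exhausts the space by bounded sets. -/
theorem exists_isDeterminantal_of_tendsto {M : Type*} [TopologicalSpace M] [MeasurableSpace M]
    [StandardBorelSpace M] {μ : Measure M} [IsFiniteMeasure μ] {lvl : M → ℕ} (hlvl : Measurable lvl)
    (hlvl_bdd : ∀ B : Set M, IsBoundedBorel B → ∃ k, ∀ x ∈ B, lvl x ≤ k) {K : M → M → ℂ}
    {Kn : ℕ → M → M → ℂ} (hK : Measurable (Function.uncurry K))
    (hKn : ∀ N, Measurable (Function.uncurry (Kn N)))
    (hlim : ∀ x y, Tendsto (fun N => Kn N x y) atTop (𝓝 (K x y))) {C : ℕ → NNReal}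
    (hC : ∀ N k x y, lvl x ≤ k → lvl y ≤ k → ‖Kn N x y‖ ≤ C k) {I : ℕ → Type*}
    [∀ N, Fintype (I N)] {P : ∀ N, Measure (I N → M)} (hPp : ∀ N, IsProbabilityMeasure (P N))
    (hP : ∀ N (m : ℕ) (B : Fin m → Set M) (n : Fin m → ℕ),
      (∀ i, MeasurableSet (B i)) → Pairwise (fun i j => Disjoint (B i) (B j)) →
      ((∫ x, ∏ i, ((pointCount x (B i)).descFactorial (n i) : ℝ) ∂(P N) : ℝ) : ℂ) =
        ∫ x in Set.univ.pi (fun p : Σ i, Fin (n i) => B p.1), kernelDet (Kn N) x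
          ∂(Measure.pi fun _ => μ)) :
    ∃ P : PointProcess M, IsDeterminantal μ K P := by
  obtain ⟨φ, hφm, hφi⟩ := MeasurableSpace.measurable_injection_nat_bool_of_countablySeparated M
  -- `M` is embedded, as a Borel space, into a zero-dimensional space; the first coordinate makes
  -- the images of bounded sets relatively compact
  let Y := ℕ × (ℕ → Bool)
  let ψ : M → Y := fun x => (lvl x, φ x)
  have hψm : Measurable ψ := hlvl.prodMk hφm
  have hψ : MeasurableEmbedding ψ :=
    hψm.measurableEmbedding fun x y h => hφi (congrArg Prod.snd h)
  let W : ℕ → CompactOpens Y := fun k => ⟨⟨Set.Iic k ×ˢ Set.univ,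
    (Set.finite_Iic k).isCompact.prod isCompact_univ⟩, (isOpen_discrete _).prod isOpen_univ⟩
  have hWmem : ∀ k (y : Y), y ∈ (W k : Set Y) ↔ y.1 ≤ k := fun k y => by
    change y ∈ Set.Iic k ×ˢ Set.univ ↔ _
    exact ⟨fun h => h.1, fun h => ⟨h, Set.mem_univ _⟩⟩
  have hcov : ∃ D : Set (Set Y), D.Countable ∧ D ⊆ compactOpenSets Y ∧ ⋃₀ D = Set.univ := by
    refine ⟨Set.range fun k => (W k : Set Y), Set.countable_range _, ?_, ?_⟩
    · rintro _ ⟨k, rfl⟩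
      exact ⟨(W k).isCompact, (W k).isOpen⟩
    · rw [Set.sUnion_range]
      exact Set.eq_univ_of_forall fun y => Set.mem_iUnion.2 ⟨y.1, (hWmem _ _).2 le_rfl⟩
  have hbdW : ∀ B : Set M, IsBoundedBorel B → ∃ k, ψ '' B ⊆ W k := fun B hB => by
    obtain ⟨k, hk⟩ := hlvl_bdd B hB
    refine ⟨k, ?_⟩
    rintro _ ⟨x, hx, rfl⟩
    exact (hWmem _ _).2 (hk x hx)
  have hbd : ∀ B : Set M, IsBoundedBorel B → ∃ U : CompactOpens Y, ψ '' B ⊆ U := fun B hB => by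
    obtain ⟨k, hk⟩ := hbdW B hB
    exact ⟨W k, hk⟩
  have hCK : ∀ k x y, lvl x ≤ k → lvl y ≤ k → ‖K x y‖ ≤ C k := fun k x y hx hy =>
    le_of_tendsto' (hlim x y).norm fun N => hC N k x y hx hy
  have hcount : Countable (CompactOpens Y) := countable_compactOpens
  -- the laws of the finite processes
  have hτ : ∀ N, Measurable (AdditiveCount.ofPoints (I := I N) ψ) := fun N =>
    AdditiveCount.measurable_ofPoints hψm
  let Q : ℕ → ProbabilityMeasure (AdditiveCount Y) := fun N =>
    ⟨(P N).map (AdditiveCount.ofPoints ψ), Measure.isProbabilityMeasure_map (hτ N).aemeasurable⟩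
  have hfm : ∀ m A n, Measurable (AdditiveCount.factorialProd (Y := Y) (m := m) A n) := fun m A n =>
    (AdditiveCount.continuous_factorialProd A n).measurable
  have hQint : ∀ N m A n,
      Integrable (AdditiveCount.factorialProd (m := m) A n) (Q N : Measure (AdditiveCount Y)) := by
    intro N m A n
    change Integrable _ ((P N).map (AdditiveCount.ofPoints ψ))
    rw [integrable_map_measure (hfm m A n).aestronglyMeasurable (hτ N).aemeasurable]
    refine .of_bound ((hfm m A n).comp (hτ N)).aestronglyMeasurable
      (∏ i, (Fintype.card (I N) : ℝ) ^ n i) (.of_forall fun x => ?_)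
    rw [Function.comp_apply, Real.norm_of_nonneg (AdditiveCount.factorialProd_nonneg _ _ _)]
    refine Finset.prod_le_prod (fun _ _ => Nat.cast_nonneg _) fun i _ => ?_
    exact_mod_cast (Nat.descFactorial_le_pow _ _).trans
      (Nat.pow_le_pow_left (pointCount_le x _) _)
  have hQval : ∀ N m A n, (Pairwise fun i j => Disjoint (A i : Set Y) (A j)) →
      ((∫ t, AdditiveCount.factorialProd (m := m) A n t ∂(Q N : Measure (AdditiveCount Y)) : ℝ) : ℂ)
        = ∫ x in Set.univ.pi (fun p : Σ i, Fin (n i) => ψ ⁻¹' (A p.1 : Set Y)), kernelDet (Kn N) x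
          ∂(Measure.pi fun _ => μ) := by
    intro N m A n hA
    change ((∫ t, AdditiveCount.factorialProd (m := m) A n t
      ∂((P N).map (AdditiveCount.ofPoints ψ)) : ℝ) : ℂ) = _
    rw [integral_map (hτ N).aemeasurable (hfm m A n).aestronglyMeasurable]
    exact hP N m (fun i => ψ ⁻¹' (A i : Set Y)) n (fun i => hψm (A i).isOpen.measurableSet)
      fun i j hij => (hA hij).preimage ψ
  have hQlim : ∀ m A n, (Pairwise fun i j => Disjoint (A i : Set Y) (A j)) →
      Tendsto (fun N => ((∫ t, AdditiveCount.factorialProd (m := m) A n t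
        ∂(Q N : Measure (AdditiveCount Y)) : ℝ) : ℂ)) atTop
        (𝓝 (∫ x in Set.univ.pi (fun p : Σ i, Fin (n i) => ψ ⁻¹' (A p.1 : Set Y)), kernelDet K x
          ∂(Measure.pi fun _ => μ))) := by
    intro m A n hA
    simp_rw [hQval _ m A n hA]
    have hk : ∀ i, ∃ k, ∀ y ∈ (A i : Set Y), y.1 ≤ k := fun i => by
      obtain ⟨k, hk⟩ := ((A i).isCompact.image continuous_fst).bddAbove
      exact ⟨k, fun y hy => hk ⟨y, hy, rfl⟩⟩
    choose k hk using hk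
    have hk' : ∀ i, ∀ y ∈ (A i : Set Y), y.1 ≤ Finset.univ.sup k := fun i y hy =>
      (hk i y hy).trans (Finset.le_sup (Finset.mem_univ i))
    exact tendsto_setIntegral_kernelDet hKn hlim (C := C (Finset.univ.sup k))
      (fun p => hψm (A p.1).isOpen.measurableSet)
      fun N p q x hx y hy => hC N _ x y (hk' _ _ hx) (hk' _ _ hy)
  obtain ⟨L, hL⟩ := AdditiveCount.exists_limit (Q := Q) (R := fun m A n =>
      (∫ x in Set.univ.pi (fun p : Σ i, Fin (n i) => ψ ⁻¹' (A p.1 : Set Y)), kernelDet K x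
          ∂(Measure.pi fun _ => μ)).re) hQint
      (fun m A n hA => (Complex.continuous_re.tendsto _).comp (hQlim m A n hA))
  have hmom : AdditiveCount.HasMoments μ ψ K (L : Measure (AdditiveCount Y)) := by
    intro m A n hA
    refine ⟨(hL m A n hA).1, ?_⟩
    rw [(hL m A n hA).2]
    refine Complex.ext (Complex.ofReal_re _) ?_
    rw [Complex.ofReal_im]
    have := (Complex.continuous_im.tendsto _).comp (hQlim m A n hA)
    simp only [Function.comp_def, Complex.ofReal_im] at this
    exact tendsto_nhds_unique tendsto_const_nhds this
  -- from counts to configurations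
  have hconf : Measurable (AdditiveCount.toConf hψ hbd) := by
    refine Conf.measurable_of_count fun B hB => ?_
    simp_rw [AdditiveCount.count_toConf]
    have hWmono : Monotone fun k => (W k : Set Y) ∩ ψ '' B := fun k l hkl y hy =>
      ⟨(hWmem _ _).2 (((hWmem _ _).1 hy.1).trans hkl), hy.2⟩
    have h1 : ∀ t : AdditiveCount Y, t.measure (ψ '' B) = ⨆ k, t.measure ((W k : Set Y) ∩ ψ '' B) := by
      intro t
      rw [← hWmono.measure_iUnion, ← Set.iUnion_inter]
      congr 1
      refine (Set.inter_eq_right.2 fun y _ => ?_).symm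
      exact Set.mem_iUnion.2 ⟨y.1, (hWmem _ _).2 le_rfl⟩
    simp_rw [h1]
    exact Measurable.iSup fun k =>
      AdditiveCount.measurable_measure_inter (W k) (hψ.measurableSet_image.2 hB)
  refine ⟨⟨(L : Measure (AdditiveCount Y)).map (AdditiveCount.toConf hψ hbd),
    Measure.isProbabilityMeasure_map hconf.aemeasurable⟩, fun m B n hB hd hn => ?_⟩
  have hk : ∀ i, ∃ k, ∀ x ∈ B i, lvl x ≤ k := fun i => hlvl_bdd (B i) (hB i)
  choose k hk using hk
  have hBU : ∀ i, ψ '' B i ⊆ W (Finset.univ.sup k) := by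
    rintro i _ ⟨x, hx, rfl⟩
    exact (hWmem _ _).2 ((hk i x hx).trans (Finset.le_sup (Finset.mem_univ i)))
  have hpre : ∀ i, ψ ⁻¹' (ψ '' B i) = B i := fun i => Set.preimage_image_eq _ hψ.injective
  obtain ⟨h1, h2, h3⟩ := hmom.borel hψm hcov hK (U := W (Finset.univ.sup k))
    (C := C (Finset.univ.sup k))
    (fun x y hx hy => hCK _ x y ((hWmem _ _).1 hx) ((hWmem _ _).1 hy)) (B := fun i => ψ '' B i)
    (fun i => hψ.measurableSet_image.2 (hB i).1) hBU
    (fun i j hij => (Set.disjoint_image_iff hψ.injective).2 (hd hij)) n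
  simp only [hpre] at h2 h3
  have hFm : Measurable fun X : Conf M =>
      ∏ i, ∏ j ∈ Finset.range (n i), ((Conf.count (B i) X).toReal - j) :=
    Finset.measurable_prod _ fun i _ => Finset.measurable_prod _ fun j _ =>
      (Conf.measurable_count (hB i).1).ennreal_toReal.sub_const _
  refine ⟨?_, h2, ?_⟩
  · change Integrable _ ((L : Measure (AdditiveCount Y)).map (AdditiveCount.toConf hψ hbd))
    rw [integrable_map_measure hFm.aestronglyMeasurable hconf.aemeasurable]
    simpa only [Function.comp_def, AdditiveCount.count_toConf] using h1
  · change ((∫ X, _ ∂((L : Measure (AdditiveCount Y)).map (AdditiveCount.toConf hψ hbd)) : ℝ) : ℂ) = _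
    rw [integral_map hconf.aemeasurable hFm.aestronglyMeasurable]
    simpa only [AdditiveCount.count_toConf] using! h3

end Existence

/-! ### The uniform measure on the disc -/

section DiscMeasure

open Filter Topology

theorem lintegral_discMeasure {F : ℂ → ENNReal} :
    ∫⁻ z : Disc, F z ∂discMeasure =
      (ENNReal.ofReal Real.pi)⁻¹ * ∫⁻ z in Metric.ball (0 : ℂ) 1, F z := by
  rw [discMeasure, lintegral_smul_measure, smul_eq_mul,
    lintegral_subtype_comap Metric.isOpen_ball.measurableSet]

theorem integral_discMeasure (F : ℂ → ℂ) :
    ∫ z : Disc, F z ∂discMeasure = (Real.pi⁻¹ : ℝ) • ∫ z in Metric.ball (0 : ℂ) 1, F z := by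
  rw [discMeasure, integral_smul_measure, integral_subtype_comap Metric.isOpen_ball.measurableSet,
    ENNReal.toReal_inv, ENNReal.toReal_ofReal Real.pi_pos.le]

/-- For a uniform point `z` of the unit disc, `-log |z|²` has a standard exponential law. -/
theorem lintegral_discMeasure_neg_log {g : ℝ → ENNReal} (hg : Measurable g) :
    ∫⁻ z : Disc, g (-Real.log (‖(z : ℂ)‖ ^ 2)) ∂discMeasure =
      ∫⁻ t in Set.Ioi 0, ENNReal.ofReal (Real.exp (-t)) * g t := by
  have hr : Measurable fun r : ℝ => g (-Real.log (r ^ 2)) := by fun_prop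
  rw [lintegral_discMeasure (F := fun z => g (-Real.log (‖z‖ ^ 2))),
    ← lintegral_indicator Metric.isOpen_ball.measurableSet,
    ← Complex.lintegral_comp_polarCoord_symm]
  have h1 : ∀ p ∈ polarCoord.target, ENNReal.ofReal p.1 • (Metric.ball (0 : ℂ) 1).indicator
      (fun z => g (-Real.log (‖z‖ ^ 2))) (Complex.polarCoord.symm p) =
      (Set.Iio (1 : ℝ)).indicator (fun r => ENNReal.ofReal r * g (-Real.log (r ^ 2))) p.1 := by
    intro p hp
    have hp0 : 0 < p.1 := hp.1
    have hn : ‖Complex.polarCoord.symm p‖ = p.1 := by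
      rw [Complex.norm_polarCoord_symm, abs_of_pos hp0]
    by_cases h : p.1 < 1
    · rw [Set.indicator_of_mem (by rw [mem_ball_zero_iff, hn]; exact h), Set.indicator_of_mem (by simpa using h), hn,
        smul_eq_mul]
    · rw [Set.indicator_of_notMem (by rw [mem_ball_zero_iff, hn]; exact h), Set.indicator_of_notMem (by simpa using h),
        smul_zero]
  rw [setLIntegral_congr_fun polarCoord.open_target.measurableSet h1, polarCoord_target,
    Measure.volume_eq_prod, ← Measure.prod_restrict]
  have hm : Measurable ((Set.Iio (1 : ℝ)).indicator
      (fun r => ENNReal.ofReal r * g (-Real.log (r ^ 2)))) :=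
    (ENNReal.measurable_ofReal.mul hr).indicator measurableSet_Iio
  have hm2 : Measurable fun x : ℝ × ℝ => (Set.Iio (1 : ℝ)).indicator
      (fun r => ENNReal.ofReal r * g (-Real.log (r ^ 2))) x.1 := hm.comp measurable_fst
  rw [lintegral_prod _ hm2.aemeasurable]
  simp only [lintegral_const, Measure.restrict_apply MeasurableSet.univ, Set.univ_inter,
    Real.volume_Ioo]
  rw [lintegral_mul_const _ hm, lintegral_indicator measurableSet_Iio,
    Measure.restrict_restrict measurableSet_Iio]
  have himg : Set.Iio (1 : ℝ) ∩ Set.Ioi 0 = (fun t : ℝ => Real.exp (-t / 2)) '' Set.Ioi 0 := by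
    ext r
    simp only [Set.mem_inter_iff, Set.mem_Iio, Set.mem_Ioi, Set.mem_image]
    constructor
    · rintro ⟨h1, h0⟩
      refine ⟨-2 * Real.log r, by linarith [Real.log_neg h0 h1], ?_⟩
      rw [show -(-2 * Real.log r) / 2 = Real.log r by ring, Real.exp_log h0]
    · rintro ⟨t, ht, rfl⟩
      exact ⟨Real.exp_zero ▸ Real.exp_lt_exp.2 (by linarith), Real.exp_pos _⟩
  rw [himg, lintegral_image_eq_lintegral_abs_deriv_mul measurableSet_Ioi
    (f' := fun t => Real.exp (-t / 2) * (-1 / 2))]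
  · have h2 : ∀ t ∈ Set.Ioi (0 : ℝ), ENNReal.ofReal |Real.exp (-t / 2) * (-1 / 2)| *
        (ENNReal.ofReal (Real.exp (-t / 2)) * g (-Real.log (Real.exp (-t / 2) ^ 2))) =
        ENNReal.ofReal (1 / 2) * (ENNReal.ofReal (Real.exp (-t)) * g t) := by
      intro t _
      have e1 : -Real.log (Real.exp (-t / 2) ^ 2) = t := by
        rw [Real.log_pow, Real.log_exp]; push_cast; ring
      rw [e1, ← mul_assoc, ← mul_assoc, ← ENNReal.ofReal_mul (abs_nonneg _),
        ← ENNReal.ofReal_mul (by norm_num)]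
      congr 2
      rw [abs_mul, abs_of_pos (Real.exp_pos _), show |(-1 / 2 : ℝ)| = 1 / 2 by norm_num [abs_of_neg],
        show Real.exp (-t) = Real.exp (-t / 2) * Real.exp (-t / 2) by
          rw [← Real.exp_add]; congr 1; ring]
      ring
    rw [setLIntegral_congr_fun measurableSet_Ioi h2, lintegral_const_mul _ (by fun_prop)]
    rw [mul_comm, mul_comm (ENNReal.ofReal (1 / 2)), mul_assoc, mul_assoc,
      ← mul_assoc (ENNReal.ofReal (1 / 2)), ← ENNReal.ofReal_mul (by norm_num)]
    rw [show (1 / 2 : ℝ) * (Real.pi - -Real.pi) = Real.pi by ring, ENNReal.mul_inv_cancel, mul_one]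
    · exact (ENNReal.ofReal_pos.2 Real.pi_pos).ne'
    · exact ENNReal.ofReal_ne_top
  · intro t _
    have h3 : HasDerivAt (fun t : ℝ => -t / 2) (-1 / 2) t := ((hasDerivAt_id t).neg).div_const 2
    exact (h3.exp).hasDerivWithinAt
  · intro s _ t _ hst
    have := Real.exp_injective hst
    linarith

theorem ae_discMeasure_ne_zero : ∀ᵐ z : Disc ∂discMeasure, (z : ℂ) ≠ 0 := by
  have h := lintegral_discMeasure (F := ({0} : Set ℂ).indicator 1)
  rw [lintegral_indicator (MeasurableSet.singleton _), Pi.one_def] at h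
  simp only [lintegral_const, one_mul, Measure.restrict_apply MeasurableSet.univ] at h
  have h0 : (volume.restrict (Metric.ball (0 : ℂ) 1)) {0} = 0 := measure_singleton 0
  rw [Set.univ_inter, h0, mul_zero] at h
  have hm : MeasurableSet {z : Disc | (z : ℂ) = 0} :=
    measurable_subtype_coe (MeasurableSet.singleton (0 : ℂ))
  have h1 : discMeasure {z : Disc | (z : ℂ) = 0} = 0 := by
    rw [← lintegral_indicator_one hm, ← h]
    exact lintegral_congr fun z => rfl
  rw [ae_iff]
  simpa using h1

/-- The Gamma integral `∫ t ^ a exp (-(n + 1) t) dt`, with one factor `exp (-t)` read as the density of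
the exponential law. -/
theorem lintegral_rpow_mul_exp {a : ℝ} (ha : 0 ≤ a) (n : ℕ) :
    ∫⁻ t in Set.Ioi 0, ENNReal.ofReal (Real.exp (-t)) * ENNReal.ofReal (t ^ a * Real.exp (-t) ^ n) =
      ENNReal.ofReal (Real.Gamma (a + 1) / ((n : ℝ) + 1) ^ (a + 1)) := by
  have hn : (0 : ℝ) < n + 1 := by positivity
  have h1 := Real.integral_rpow_mul_exp_neg_mul_Ioi (a := a + 1) (by linarith) hn
  have hg : ∫ t in Set.Ioi (0 : ℝ), t ^ (a + 1 - 1) * Real.exp (-((n + 1) * t)) ≠ 0 := by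
    rw [h1]
    have := Real.Gamma_pos_of_pos (s := a + 1) (by linarith)
    positivity
  have hint : Integrable (fun t : ℝ => t ^ (a + 1 - 1) * Real.exp (-((n + 1) * t)))
      (volume.restrict (Set.Ioi 0)) := by
    by_contra hni
    exact hg (integral_undef hni)
  have h2 := ofReal_integral_eq_lintegral_ofReal hint
    ((ae_restrict_mem measurableSet_Ioi).mono fun t (ht : 0 < t) => by positivity)
  rw [h1] at h2
  rw [show Real.Gamma (a + 1) / ((n : ℝ) + 1) ^ (a + 1) =
    (1 / ((n : ℝ) + 1)) ^ (a + 1) * Real.Gamma (a + 1) by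
      rw [Real.div_rpow zero_le_one hn.le, Real.one_rpow]; ring, h2]
  refine setLIntegral_congr_fun measurableSet_Ioi fun t ht => ?_
  have ht' : 0 < t := ht
  rw [← ENNReal.ofReal_mul (Real.exp_pos _).le]
  congr 1
  rw [← Real.exp_nat_mul, show -((n + 1 : ℝ) * t) = -t + n * -t by ring, Real.exp_add,
    add_sub_cancel_right]
  ring

/-- The moments of the powers of `-log |z|²` under the densities `|z|^(2n)`. -/
theorem lintegral_disc_rpow_mul_pow {a : ℝ} (ha : 0 ≤ a) (n : ℕ) :
    ∫⁻ z : Disc, ENNReal.ofReal ((-Real.log (‖(z : ℂ)‖ ^ 2)) ^ a * (‖(z : ℂ)‖ ^ 2) ^ n) ∂discMeasure =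
      ENNReal.ofReal (Real.Gamma (a + 1) / ((n : ℝ) + 1) ^ (a + 1)) := by
  rw [← lintegral_rpow_mul_exp ha, ← lintegral_discMeasure_neg_log (by fun_prop)]
  refine lintegral_congr_ae ?_
  filter_upwards [ae_discMeasure_ne_zero] with z hz
  have h0 : 0 < ‖(z : ℂ)‖ ^ 2 := by positivity
  rw [neg_neg, Real.exp_log h0]

theorem lintegral_disc_pow (n : ℕ) :
    ∫⁻ z : Disc, ENNReal.ofReal ((‖(z : ℂ)‖ ^ 2) ^ n) ∂discMeasure =
      ENNReal.ofReal (1 / ((n : ℝ) + 1)) := by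
  have := lintegral_disc_rpow_mul_pow le_rfl n
  simpa using this

instance : IsProbabilityMeasure discMeasure := by
  refine ⟨?_⟩
  have := lintegral_disc_pow 0
  simpa using this

/-- Monomials are orthogonal for each radial weight, by invariance under rotations. -/
theorem integral_disc_radial_mul_eq_zero (h : ℝ → ℂ) {n m : ℕ} (hnm : n ≠ m) :
    ∫ z : Disc, h ‖(z : ℂ)‖ * ((z : ℂ) ^ n * starRingEnd ℂ (z : ℂ) ^ m) ∂discMeasure = 0 := by
  rw [integral_discMeasure fun z => h ‖z‖ * (z ^ n * starRingEnd ℂ z ^ m)]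
  rw [← integral_indicator Metric.isOpen_ball.measurableSet]
  set G : ℂ → ℂ := (Metric.ball (0 : ℂ) 1).indicator fun z => h ‖z‖ * (z ^ n * starRingEnd ℂ z ^ m)
  have hd : (n : ℝ) - m ≠ 0 := sub_ne_zero.2 (by exact_mod_cast hnm)
  -- the rotation by the angle `π / (n - m)` changes the sign of the integrand
  let c : Circle := Circle.exp (Real.pi / (n - m))
  have hc : (c : ℂ) ^ n * starRingEnd ℂ (c : ℂ) ^ m = -1 := by
    have h1 : (c : ℂ) = Complex.exp ((Real.pi / (n - m) : ℝ) * Complex.I) := Circle.coe_exp _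
    rw [h1, ← Complex.exp_conj, ← Complex.exp_nat_mul, ← Complex.exp_nat_mul, ← Complex.exp_add,
      ← Complex.exp_pi_mul_I]
    congr 1
    have hd' : (n : ℂ) - m ≠ 0 := by exact_mod_cast hd
    simp only [map_mul, Complex.conj_I, Complex.conj_ofReal]
    push_cast
    field_simp
    ring
  have hG : ∀ z, G (rotation c z) = -G z := by
    intro z
    have hn : ‖rotation c z‖ = ‖z‖ := (rotation c).norm_map z
    by_cases hz : ‖z‖ < 1
    · simp only [G]
      rw [Set.indicator_of_mem (by rw [mem_ball_zero_iff, hn]; exact hz), Set.indicator_of_mem (by simpa using hz), hn,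
        rotation_apply, mul_pow, map_mul, mul_pow]
      linear_combination (h ‖z‖ * (z ^ n * starRingEnd ℂ z ^ m)) * hc
    · simp only [G]
      rw [Set.indicator_of_notMem (by rw [mem_ball_zero_iff, hn]; exact hz), Set.indicator_of_notMem (by simpa using hz),
        neg_zero]
  have hmp := (rotation c).measurePreserving
  have h2 := hmp.integral_comp (rotation c).toHomeomorph.measurableEmbedding G
  simp_rw [hG, integral_neg] at h2
  have h3 : ∫ z, G z = 0 := by
    have : (2 : ℂ) * ∫ z, G z = 0 := by linear_combination -h2
    simpa using this
  rw [h3, smul_zero]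

end DiscMeasure

/-! ### The process on the disc -/

section DiscProcess

open Filter Topology

theorem norm_disc_lt_one (z : Disc) : ‖(z : ℂ)‖ < 1 := mem_ball_zero_iff.1 z.2

theorem summable_succ_mul_pow {r : ℝ} (h0 : 0 ≤ r) (h1 : r < 1) :
    Summable fun n : ℕ => ((n : ℝ) + 1) * r ^ n := by
  have ha := summable_pow_mul_geometric_of_norm_lt_one 1 (R := ℝ) (r := r)
    (by rwa [Real.norm_of_nonneg h0])
  have hb := summable_geometric_of_lt_one h0 h1
  refine (ha.add hb).congr fun n => ?_
  simp only [pow_one]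
  ring

variable {a : ℕ → ℝ}

theorem norm_discKernel_term_le (ha : ∀ n, a n = 0 ∨ a n = 1) (z w : Disc) (n : ℕ) :
    ‖(a n : ℂ) * (n + 1) * (z : ℂ) ^ n * (starRingEnd ℂ (w : ℂ)) ^ n‖ ≤
      ((n : ℝ) + 1) * (‖(z : ℂ)‖ * ‖(w : ℂ)‖) ^ n := by
  have h1 : ‖(a n : ℂ)‖ ≤ 1 := by rcases ha n with h | h <;> simp [h]
  have h2 : ‖(n + 1 : ℂ)‖ = (n : ℝ) + 1 := by
    rw [← Nat.cast_succ, Complex.norm_natCast, Nat.cast_succ]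
  rw [norm_mul, norm_mul, norm_mul, norm_pow, norm_pow, RCLike.norm_conj, h2, mul_pow]
  calc ‖(a n : ℂ)‖ * (n + 1) * ‖(z : ℂ)‖ ^ n * ‖(w : ℂ)‖ ^ n
      ≤ 1 * (n + 1) * ‖(z : ℂ)‖ ^ n * ‖(w : ℂ)‖ ^ n := by gcongr
    _ = _ := by ring

theorem hasSum_discKernel (ha : ∀ n, a n = 0 ∨ a n = 1) (z w : Disc) :
    HasSum (fun n : ℕ => (a n : ℂ) * (n + 1) * (z : ℂ) ^ n * (starRingEnd ℂ (w : ℂ)) ^ n)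
      (discKernel (fun n => (a n : ℂ)) z w) := by
  have h1 : ‖(z : ℂ)‖ * ‖(w : ℂ)‖ < 1 :=
    mul_lt_one_of_nonneg_of_lt_one_left (norm_nonneg _) (norm_disc_lt_one z) (norm_disc_lt_one w).le
  exact (Summable.of_norm_bounded (summable_succ_mul_pow (by positivity) h1)
    (norm_discKernel_term_le ha z w)).hasSum

/-- The monomials `√(n + 1) zⁿ`, an orthonormal basis of the Bergman space. -/
noncomputable def bergmanBasis (n : ℕ) (z : Disc) : ℂ := (√((n : ℝ) + 1) : ℂ) * (z : ℂ) ^ n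

theorem measurable_bergmanBasis (n : ℕ) : Measurable (bergmanBasis n) :=
  (measurable_subtype_coe.pow_const n).const_mul _

theorem norm_bergmanBasis_le (n : ℕ) (z : Disc) : ‖bergmanBasis n z‖ ≤ √((n : ℝ) + 1) := by
  rw [bergmanBasis, norm_mul, norm_pow, Complex.norm_real, Real.norm_of_nonneg (Real.sqrt_nonneg _)]
  exact mul_le_of_le_one_right (Real.sqrt_nonneg _) (pow_le_one₀ (norm_nonneg _) (norm_disc_lt_one z).le)

theorem bergmanBasis_mul_conj (n : ℕ) (z w : Disc) :
    bergmanBasis n z * starRingEnd ℂ (bergmanBasis n w) =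
      (n + 1) * (z : ℂ) ^ n * (starRingEnd ℂ (w : ℂ)) ^ n := by
  have h : (√((n : ℝ) + 1) : ℂ) * (√((n : ℝ) + 1) : ℂ) = (n : ℂ) + 1 := by
    rw [← Complex.ofReal_mul, Real.mul_self_sqrt (by positivity)]
    push_cast
    ring
  simp only [bergmanBasis, map_mul, map_pow, Complex.conj_ofReal]
  linear_combination ((z : ℂ) ^ n * (starRingEnd ℂ (w : ℂ)) ^ n) * h

theorem integral_bergmanBasis (n m : ℕ) :
    ∫ z, bergmanBasis n z * starRingEnd ℂ (bergmanBasis m z) ∂discMeasure =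
      if n = m then 1 else 0 := by
  split_ifs with h
  · subst h
    have h1 : ∀ z, bergmanBasis n z * starRingEnd ℂ (bergmanBasis n z) =
        ((((n : ℝ) + 1) * (‖(z : ℂ)‖ ^ 2) ^ n : ℝ) : ℂ) := by
      intro z
      rw [bergmanBasis_mul_conj, mul_assoc, ← mul_pow, Complex.mul_conj']
      push_cast
      ring
    simp_rw [h1]
    rw [integral_complex_ofReal, integral_const_mul, integral_eq_lintegral_of_nonneg_ae
      (.of_forall fun z => by positivity)
      (by fun_prop), lintegral_disc_pow, ENNReal.toReal_ofReal (by positivity)]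
    have : (n : ℝ) + 1 ≠ 0 := by positivity
    rw [mul_one_div_cancel this, Complex.ofReal_one]
  · have h1 : ∀ z, bergmanBasis n z * starRingEnd ℂ (bergmanBasis m z) =
        ((√((n : ℝ) + 1) : ℂ) * (√((m : ℝ) + 1) : ℂ)) *
          (1 * ((z : ℂ) ^ n * starRingEnd ℂ (z : ℂ) ^ m)) := by
      intro z
      simp only [bergmanBasis, map_mul, map_pow, Complex.conj_ofReal]
      ring
    simp_rw [h1]
    rw [integral_const_mul]
    exact mul_eq_zero_of_right _ (integral_disc_radial_mul_eq_zero (fun _ => 1) h)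

/-- The level of a point of the disc: points of level at most `k` have norm at most
`k / (k + 1)`. -/
noncomputable def discLevel (z : Disc) : ℕ := ⌊(1 - ‖(z : ℂ)‖)⁻¹⌋₊

theorem measurable_discLevel : Measurable discLevel :=
  Nat.measurable_floor.comp (measurable_const.sub measurable_subtype_coe.norm).inv

theorem norm_le_of_discLevel_le {z : Disc} {k : ℕ} (h : discLevel z ≤ k) :
    ‖(z : ℂ)‖ ≤ 1 - ((k : ℝ) + 1)⁻¹ := by
  have h0 : 0 < 1 - ‖(z : ℂ)‖ := sub_pos.2 (norm_disc_lt_one z)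
  have h1 : (1 - ‖(z : ℂ)‖)⁻¹ < (k : ℝ) + 1 := by
    have := Nat.lt_floor_add_one (1 - ‖(z : ℂ)‖)⁻¹
    refine this.trans_le ?_
    have h' : (⌊(1 - ‖(z : ℂ)‖)⁻¹⌋₊ : ℝ) ≤ k := by exact_mod_cast h
    linarith
  have h2 := inv_lt_of_inv_lt₀ h0 h1
  linarith

theorem exists_norm_le_of_isBoundedBorel {B : Set Disc} (hB : IsBoundedBorel B) :
    ∃ r < 1, 0 ≤ r ∧ ∀ z ∈ B, ‖(z : ℂ)‖ ≤ r := by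
  rcases (closure B).eq_empty_or_nonempty with h | h
  · refine ⟨0, zero_lt_one, le_rfl, fun z hz => ?_⟩
    have : z ∈ closure B := subset_closure hz
    rw [h] at this
    exact absurd this (Set.notMem_empty z)
  · obtain ⟨w, -, hw⟩ := hB.2.exists_isMaxOn h (f := fun z : Disc => ‖(z : ℂ)‖)
      (by fun_prop)
    exact ⟨‖(w : ℂ)‖, norm_disc_lt_one w, norm_nonneg _, fun z hz => hw (subset_closure hz)⟩

theorem exists_discLevel_le_of_isBoundedBorel {B : Set Disc} (hB : IsBoundedBorel B) :
    ∃ k, ∀ z ∈ B, discLevel z ≤ k := by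
  obtain ⟨r, hr, -, h⟩ := exists_norm_le_of_isBoundedBorel hB
  refine ⟨⌊(1 - r)⁻¹⌋₊, fun z hz => Nat.floor_le_floor ?_⟩
  exact inv_anti₀ (sub_pos.2 hr) (by linarith [h z hz])

instance : StandardBorelSpace Disc := Metric.isOpen_ball.measurableSet.standardBorel

/-- The kernel of the first `N` terms of the series, for coefficients in `{0, 1}`. -/
noncomputable def discKernelTrunc (a : ℕ → ℝ) (N : ℕ) : Disc → Disc → ℂ :=
  projectionKernel fun n : {n ∈ Finset.range N | a n = 1} => bergmanBasis n

theorem discKernelTrunc_eq (ha : ∀ n, a n = 0 ∨ a n = 1) (N : ℕ) (z w : Disc) :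
    discKernelTrunc a N z w = ∑ n ∈ Finset.range N,
      (a n : ℂ) * (n + 1) * (z : ℂ) ^ n * (starRingEnd ℂ (w : ℂ)) ^ n := by
  unfold discKernelTrunc projectionKernel
  rw [Finset.sum_coe_sort {n ∈ Finset.range N | a n = 1}
    fun n => bergmanBasis n z * starRingEnd ℂ (bergmanBasis n w), Finset.sum_filter]
  refine Finset.sum_congr rfl fun n _ => ?_
  rcases ha n with h | h
  · simp [h]
  · simp [h, bergmanBasis_mul_conj]

theorem tendsto_discKernelTrunc (ha : ∀ n, a n = 0 ∨ a n = 1) (z w : Disc) :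
    Tendsto (fun N => discKernelTrunc a N z w) atTop (𝓝 (discKernel (fun n => (a n : ℂ)) z w)) := by
  simp_rw [discKernelTrunc_eq ha]
  exact (hasSum_discKernel ha z w).tendsto_sum_nat

theorem isReproducing_discKernelTrunc (a : ℕ → ℝ) (N : ℕ) :
    IsReproducing discMeasure (discKernelTrunc a N)
      (Fintype.card {n ∈ Finset.range N | a n = 1}) :=
  isReproducing_projectionKernel (fun n => measurable_bergmanBasis n)
    (fun n => ⟨_, norm_bergmanBasis_le n⟩) fun n m => by
      rw [integral_bergmanBasis]
      simp only [Subtype.ext_iff]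

theorem measurable_discKernel (ha : ∀ n, a n = 0 ∨ a n = 1) :
    Measurable (Function.uncurry (discKernel fun n => (a n : ℂ))) :=
  measurable_of_tendsto_metrizable (fun N => (isReproducing_discKernelTrunc a N).measurable)
    (tendsto_pi_nhds.2 fun p => tendsto_discKernelTrunc ha p.1 p.2)

/-- The process with kernel `∑ a n (n + 1) zⁿ w̄ⁿ`, for `a n ∈ {0, 1}`, is a limit of the finite
projection processes given by the partial sums. -/
theorem exists_isDeterminantal_discKernel (ha : ∀ n, a n = 0 ∨ a n = 1) :
    ∃ P : PointProcess Disc, IsDeterminantal discMeasure (discKernel fun n => (a n : ℂ)) P := by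
  have hfin := fun N => exists_projectionProcess (μ := discMeasure)
    (φ := fun n : {n ∈ Finset.range N | a n = 1} => bergmanBasis n)
    (fun n => measurable_bergmanBasis n) (fun n => ⟨_, norm_bergmanBasis_le n⟩) fun n m => by
      rw [integral_bergmanBasis]
      simp only [Subtype.ext_iff]
  choose P hPp hP using hfin
  have hr : ∀ k : ℕ, 0 ≤ 1 - ((k : ℝ) + 1)⁻¹ := fun k => by
    rw [sub_nonneg]
    exact inv_le_one_of_one_le₀ (by linarith [k.cast_nonneg (α := ℝ)])
  have hr1 : ∀ k : ℕ, 1 - ((k : ℝ) + 1)⁻¹ < 1 := fun k => by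
    have : (0 : ℝ) < ((k : ℝ) + 1)⁻¹ := by positivity
    linarith
  refine exists_isDeterminantal_of_tendsto measurable_discLevel
    (fun B hB => exists_discLevel_le_of_isBoundedBorel hB) (measurable_discKernel ha)
    (fun N => (isReproducing_discKernelTrunc a N).measurable) (tendsto_discKernelTrunc ha)
    (C := fun k => (∑' n : ℕ, ((n : ℝ) + 1) * (1 - ((k : ℝ) + 1)⁻¹) ^ n).toNNReal) ?_ hPp hP
  intro N k z w hz hw
  refine le_trans ?_ (Real.le_coe_toNNReal _)
  rw [discKernelTrunc_eq ha]
  refine (norm_sum_le _ _).trans ?_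
  refine le_trans (Finset.sum_le_sum fun n _ => ?_)
    ((summable_succ_mul_pow (hr k) (hr1 k)).sum_le_tsum (Finset.range N)
      fun n _ => mul_nonneg (by positivity) (pow_nonneg (hr k) n))
  refine (norm_discKernel_term_le ha z w n).trans ?_
  gcongr
  calc ‖(z : ℂ)‖ * ‖(w : ℂ)‖ ≤ ‖(z : ℂ)‖ * 1 := by gcongr; exact (norm_disc_lt_one w).le
    _ ≤ _ := by rw [mul_one]; exact norm_le_of_discLevel_le hz

end DiscProcess

/-! ### Second moments of the counts of a determinantal process -/

section SecondMoment

open Filter Topology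

variable {M : Type*} [TopologicalSpace M] [MeasurableSpace M]

/-- The restriction of a configuration to `C` depends only on the counts of subsets of `C`. -/
theorem Conf.measurable_restrict {C : Set M} (hC : MeasurableSet C) :
    Measurable[Conf.sigmaAlgebra C] fun X : Conf M => X.1.restrict C := by
  refine @Measure.measurable_of_measurable_coe _ _ _ (Conf.sigmaAlgebra C) _ fun B hB => ?_
  simp_rw [Measure.restrict_apply hB]
  exact Conf.measurable_count_sigmaAlgebra (hB.inter hC) Set.inter_subset_right

theorem Conf.sigmaAlgebra_le (C : Set M) : Conf.sigmaAlgebra C ≤ Conf.instMeasurableSpace := by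
  refine iSup_le fun B => iSup_le fun hB => iSup_le fun _ => ?_
  exact (Conf.measurable_count hB).comap_le

theorem Conf.measurable_lintegral {C : Set M} (hC : MeasurableSet C) {f : M → ENNReal}
    (hf : Measurable f) : Measurable[Conf.sigmaAlgebra C] fun X : Conf M => ∫⁻ x in C, f x ∂X.1 :=
  (Measure.measurable_lintegral hf).comp (Conf.measurable_restrict hC)

omit [TopologicalSpace M] in
theorem setIntegral_kernelDet_of_equiv_fin_one {μ : Measure M} [SigmaFinite μ] (K : M → M → ℂ)
    {J : Type*} [Fintype J] [DecidableEq J] (e : Fin 1 ≃ J) (S : Set M) :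
    ∫ x in Set.univ.pi (fun _ : J => S), kernelDet K x ∂(Measure.pi fun _ => μ) =
      ∫ x in S, K x x ∂μ ∧
    (IntegrableOn (kernelDet K) (Set.univ.pi (fun _ : J => S)) (Measure.pi fun _ => μ) →
      IntegrableOn (fun x => K x x) S μ) := by
  have hmp : MeasurePreserving (fun (x : M) (_ : J) => x) μ (Measure.pi fun _ : J => μ) := by
    have h1 := (measurePreserving_funUnique μ (Fin 1)).symm
    have h2 := measurePreserving_piCongrLeft (fun _ : J => μ) e
    convert h2.comp h1 using 1
    funext x j
    obtain ⟨i, rfl⟩ := e.surjective j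
    exact (Equiv.piCongrLeft_apply_apply (fun _ => M) e
      ((MeasurableEquiv.funUnique (Fin 1) M).symm x) i).symm
  have hemb : MeasurableEmbedding (fun (x : M) (_ : J) => x) := by
    have h1 := (MeasurableEquiv.funUnique (Fin 1) M).symm.measurableEmbedding
    have h2 := (MeasurableEquiv.piCongrLeft (fun _ : J => M) e).measurableEmbedding
    convert h2.comp h1 using 1
    funext x j
    obtain ⟨i, rfl⟩ := e.surjective j
    exact (Equiv.piCongrLeft_apply_apply (fun _ => M) e
      ((MeasurableEquiv.funUnique (Fin 1) M).symm x) i).symm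
  have hpre : (fun (x : M) (_ : J) => x) ⁻¹' (Set.univ.pi fun _ : J => S) = S := by
    ext x
    simp only [Set.mem_preimage, Set.mem_pi, Set.mem_univ, true_imp_iff]
    exact ⟨fun h => h (e 0), fun h _ => h⟩
  have hdet : ∀ x : M, kernelDet K (fun _ : J => x) = K x x := fun x => by
    rw [← kernelDet_comp_equiv K e]
    simp [kernelDet]
  refine ⟨?_, fun h => ?_⟩
  · rw [← hmp.setIntegral_preimage_emb hemb, hpre]
    simp_rw [hdet]
  · have := (hmp.integrableOn_comp_preimage hemb).2 h
    rw [hpre] at this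
    simpa only [Function.comp_def, hdet] using this

omit [TopologicalSpace M] in
theorem setIntegral_kernelDet_of_equiv_fin_two {μ : Measure M} [SigmaFinite μ] (K : M → M → ℂ)
    {J : Type*} [Fintype J] [DecidableEq J] (e : Fin 2 ≃ J) (S : J → Set M) :
    ∫ x in Set.univ.pi S, kernelDet K x ∂(Measure.pi fun _ => μ) =
      ∫ z in S (e 0) ×ˢ S (e 1), (K z.1 z.1 * K z.2 z.2 - K z.1 z.2 * K z.2 z.1) ∂(μ.prod μ) ∧
    (IntegrableOn (kernelDet K) (Set.univ.pi S) (Measure.pi fun _ => μ) →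
      IntegrableOn (fun z : M × M => K z.1 z.1 * K z.2 z.2 - K z.1 z.2 * K z.2 z.1)
        (S (e 0) ×ˢ S (e 1)) (μ.prod μ)) := by
  let F : M × M ≃ᵐ (J → M) :=
    (MeasurableEquiv.finTwoArrow (α := M)).symm.trans (MeasurableEquiv.piCongrLeft (fun _ : J => M) e)
  have hmp : MeasurePreserving F (μ.prod μ) (Measure.pi fun _ : J => μ) :=
    (measurePreserving_piCongrLeft (fun _ : J => μ) e).comp (measurePreserving_finTwoArrow μ).symm
  have hF : ∀ z i, F z (e i) = ![z.1, z.2] i := fun z i =>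
    Equiv.piCongrLeft_apply_apply (fun _ => M) e _ i
  have hpre : F ⁻¹' (Set.univ.pi S) = S (e 0) ×ˢ S (e 1) := by
    ext z
    simp only [Set.mem_preimage, Set.mem_pi, Set.mem_univ, true_imp_iff, Set.mem_prod]
    rw [← e.forall_congr_right]
    simp [hF]
  have hdet : ∀ z, kernelDet K (F z) = K z.1 z.1 * K z.2 z.2 - K z.1 z.2 * K z.2 z.1 := fun z => by
    rw [← kernelDet_comp_equiv K e]
    have : F z ∘ e = ![z.1, z.2] := funext (hF z)
    rw [this, kernelDet, Matrix.det_fin_two]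
    simp
  refine ⟨?_, fun h => ?_⟩
  · rw [← hmp.setIntegral_preimage_emb F.measurableEmbedding, hpre]
    simp_rw [hdet]
  · have := (hmp.integrableOn_comp_preimage F.measurableEmbedding).2 h
    rw [hpre] at this
    simpa only [Function.comp_def, hdet] using this

/-- Kernels that satisfy the Cauchy–Schwarz inequality, with diagonal `k`. Of the Hermitian symmetry
only the consequence `K x y * K y x = |K x y|²` is recorded. -/
structure IsPositiveKernel (K : M → M → ℂ) (k : M → ℝ) : Prop where
  measurable : Measurable (Function.uncurry K)
  diag : ∀ x, K x x = k x
  diag_nonneg : ∀ x, 0 ≤ k x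
  mul_swap : ∀ x y, K x y * K y x = ((‖K x y‖ ^ 2 : ℝ) : ℂ)
  norm_sq_le : ∀ x y, ‖K x y‖ ^ 2 ≤ k x * k y

variable {μ : Measure M} [SigmaFinite μ] {K : M → M → ℂ} {k : M → ℝ} {P : PointProcess M}

omit [TopologicalSpace M] in
theorem IsPositiveKernel.measurable_diag (hK : IsPositiveKernel K k) : Measurable k := by
  have h1 : Measurable fun x => (K x x).re :=
    Complex.measurable_re.comp (hK.measurable.comp (measurable_id.prodMk measurable_id))
  simpa only [hK.diag, Complex.ofReal_re] using h1

omit [TopologicalSpace M] in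
theorem IsPositiveKernel.measurable_norm_sq (hK : IsPositiveKernel K k) :
    Measurable fun z : M × M => ‖K z.1 z.2‖ ^ 2 :=
  hK.measurable.norm.pow_const 2

omit [TopologicalSpace M] in
theorem IsPositiveKernel.det_eq (hK : IsPositiveKernel K k) (x y : M) :
    K x x * K y y - K x y * K y x = ((k x * k y - ‖K x y‖ ^ 2 : ℝ) : ℂ) := by
  rw [hK.diag, hK.diag, hK.mul_swap]
  push_cast
  ring

theorem Conf.exists_nat_count {B : Set M} (hB : IsBoundedBorel B) (X : Conf M) :
    ∃ c : ℕ, Conf.count B X = c := X.2 B hB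

theorem IsBoundedBorel.mono {A B : Set M} (hB : IsBoundedBorel B) (hA : MeasurableSet A)
    (hAB : A ⊆ B) : IsBoundedBorel A :=
  ⟨hA, hB.2.of_isClosed_subset isClosed_closure (closure_mono hAB)⟩

theorem IsDeterminantal.lintegral_count (hP : IsDeterminantal μ K P) (hK : IsPositiveKernel K k)
    {A : Set M} (hA : IsBoundedBorel A) :
    ∫⁻ X, Conf.count A X ∂(P : Measure (Conf M)) = ∫⁻ x in A, ENNReal.ofReal (k x) ∂μ := by
  obtain ⟨h1, h2, h3⟩ := hP 1 (fun _ => A) (fun _ => 1) (fun _ => hA)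
    (fun i j hij => absurd (Subsingleton.elim i j) hij) fun _ => le_rfl
  let e : Fin 1 ≃ (Σ _ : Fin 1, Fin 1) := (Equiv.uniqueSigma fun _ => Fin 1).symm
  obtain ⟨h4, h5⟩ := setIntegral_kernelDet_of_equiv_fin_one (μ := μ) K e A
  have h6 := h3.trans h4
  have h7 := h5 h2
  simp only [hK.diag] at h6 h7
  rw [integral_complex_ofReal] at h6
  have h8 := Complex.ofReal_injective h6
  have h9 := congrArg ENNReal.ofReal h8
  have h7' : IntegrableOn k A μ := by
    simpa only [IntegrableOn, RCLike.re_to_complex, Complex.ofReal_re] using h7.re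
  rw [ofReal_integral_eq_lintegral_ofReal h7' (.of_forall hK.diag_nonneg),
    ofReal_integral_eq_lintegral_ofReal h1 (.of_forall fun X => by simp)] at h9
  rw [← h9]
  refine lintegral_congr fun X => ?_
  obtain ⟨c, hc⟩ := Conf.exists_nat_count hA X
  simp [hc]

/-- The second moment measure of a determinantal process: a diagonal part, and a part with
density `K(x, x) K(y, y) - |K(x, y)|²`. -/
noncomputable def pairMeasure (μ : Measure M) (K : M → M → ℂ) (k : M → ℝ) : Measure (M × M) :=
  (μ.withDensity fun x => ENNReal.ofReal (k x)).map (fun x => (x, x)) +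
    (μ.prod μ).withDensity fun z => ENNReal.ofReal (k z.1 * k z.2 - ‖K z.1 z.2‖ ^ 2)

omit [TopologicalSpace M] in
theorem pairMeasure_prod (μ : Measure M) (K : M → M → ℂ) (k : M → ℝ) [SigmaFinite μ] {A B : Set M}
    (hA : MeasurableSet A) (hB : MeasurableSet B) :
    pairMeasure μ K k (A ×ˢ B) = ∫⁻ x in A ∩ B, ENNReal.ofReal (k x) ∂μ +
      ∫⁻ z in A ×ˢ B, ENNReal.ofReal (k z.1 * k z.2 - ‖K z.1 z.2‖ ^ 2) ∂(μ.prod μ) := by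
  have hd : Measurable fun x : M => (x, x) := measurable_id.prodMk measurable_id
  rw [pairMeasure, Measure.add_apply, Measure.map_apply hd (hA.prod hB),
    withDensity_apply _ (hA.prod hB), withDensity_apply _ (hd (hA.prod hB))]
  rfl

theorem IsDeterminantal.lintegral_count_mul_of_disjoint (hP : IsDeterminantal μ K P)
    (hK : IsPositiveKernel K k) {A B : Set M} (hA : IsBoundedBorel A) (hB : IsBoundedBorel B)
    (hAB : Disjoint A B) :
    ∫⁻ X, Conf.count A X * Conf.count B X ∂(P : Measure (Conf M)) = pairMeasure μ K k (A ×ˢ B) := by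
  obtain ⟨h1, h2, h3⟩ := hP 2 ![A, B] (fun _ => 1) (fun i => by fin_cases i <;> assumption)
    (fun i j hij => by
      fin_cases i <;> fin_cases j <;> first | exact absurd rfl hij | exact hAB | exact hAB.symm)
    fun _ => le_rfl
  let e : Fin 2 ≃ (Σ _ : Fin 2, Fin 1) := (Equiv.sigmaUnique (Fin 2) fun _ => Fin 1).symm
  obtain ⟨h4, h5⟩ := setIntegral_kernelDet_of_equiv_fin_two (μ := μ) K e
    (fun p => (![A, B] : Fin 2 → Set M) p.1)
  have h6 := h3.trans h4
  have h7 := h5 h2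
  change _ = ∫ z in A ×ˢ B, _ ∂_ at h6
  change IntegrableOn _ (A ×ˢ B) _ at h7
  simp only [hK.det_eq] at h6 h7
  rw [integral_complex_ofReal] at h6
  have h9 := congrArg ENNReal.ofReal (Complex.ofReal_injective h6)
  have h7' : IntegrableOn (fun z : M × M => k z.1 * k z.2 - ‖K z.1 z.2‖ ^ 2) (A ×ˢ B) (μ.prod μ) := by
    simpa only [IntegrableOn, RCLike.re_to_complex, Complex.ofReal_re] using h7.re
  rw [ofReal_integral_eq_lintegral_ofReal h7' (.of_forall fun z => sub_nonneg.2 (hK.norm_sq_le _ _)),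
    ofReal_integral_eq_lintegral_ofReal h1 (.of_forall fun X => by
      simp only [Finset.prod_range_one, Fin.prod_univ_two]; simp; positivity)] at h9
  rw [pairMeasure_prod μ K k hA.1 hB.1, hAB.inter_eq, Measure.restrict_empty, lintegral_zero_measure,
    zero_add, ← h9]
  refine lintegral_congr fun X => ?_
  obtain ⟨c, hc⟩ := Conf.exists_nat_count hA X
  obtain ⟨d, hd⟩ := Conf.exists_nat_count hB X
  simp [hc, hd, Fin.prod_univ_two, ENNReal.ofReal_mul]

theorem IsDeterminantal.lintegral_count_mul_self (hP : IsDeterminantal μ K P)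
    (hK : IsPositiveKernel K k) {A : Set M} (hA : IsBoundedBorel A) :
    ∫⁻ X, Conf.count A X * Conf.count A X ∂(P : Measure (Conf M)) = pairMeasure μ K k (A ×ˢ A) := by
  obtain ⟨h1, h2, h3⟩ := hP 1 (fun _ => A) (fun _ => 2) (fun _ => hA)
    (fun i j hij => absurd (Subsingleton.elim i j) hij) fun _ => one_le_two
  let e : Fin 2 ≃ (Σ _ : Fin 1, Fin 2) := (Equiv.uniqueSigma fun _ : Fin 1 => Fin 2).symm
  obtain ⟨h4, h5⟩ := setIntegral_kernelDet_of_equiv_fin_two (μ := μ) K e (fun _ => A)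
  have h6 := h3.trans h4
  have h7 := h5 h2
  simp only [hK.det_eq] at h6 h7
  rw [integral_complex_ofReal] at h6
  have h9 := congrArg ENNReal.ofReal (Complex.ofReal_injective h6)
  have h7' : IntegrableOn (fun z : M × M => k z.1 * k z.2 - ‖K z.1 z.2‖ ^ 2) (A ×ˢ A) (μ.prod μ) := by
    simpa only [IntegrableOn, RCLike.re_to_complex, Complex.ofReal_re] using h7.re
  have hnat : ∀ X : Conf M, ∃ c : ℕ, Conf.count A X = c := Conf.exists_nat_count hA
  have hval : ∀ X : Conf M, ∏ i : Fin 1, ∏ j ∈ Finset.range 2, ((Conf.count A X).toReal - j) =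
      (Conf.count A X).toReal * ((Conf.count A X).toReal - 1) := fun X => by
    simp [Finset.prod_range_succ]
  simp only [hval] at h9 h1
  have hnn : ∀ X : Conf M, 0 ≤ (Conf.count A X).toReal * ((Conf.count A X).toReal - 1) := fun X => by
    obtain ⟨c, hc⟩ := hnat X
    rw [hc, ENNReal.toReal_natCast]
    rcases c with _ | c
    · simp
    · push_cast
      rw [add_sub_cancel_right]
      positivity
  rw [ofReal_integral_eq_lintegral_ofReal h7' (.of_forall fun z => sub_nonneg.2 (hK.norm_sq_le _ _)),
    ofReal_integral_eq_lintegral_ofReal h1 (.of_forall hnn)] at h9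
  rw [pairMeasure_prod μ K k hA.1 hA.1, Set.inter_self, ← hP.lintegral_count hK hA, ← h9,
    ← lintegral_add_left (Conf.measurable_count hA.1)]
  refine lintegral_congr fun X => ?_
  obtain ⟨c, hc⟩ := hnat X
  rw [hc, ENNReal.toReal_natCast, ← ENNReal.ofReal_natCast c, ← ENNReal.ofReal_mul c.cast_nonneg]
  have := hnn X
  rw [hc, ENNReal.toReal_natCast] at this
  rw [← ENNReal.ofReal_add c.cast_nonneg this]
  congr 1
  ring

/-- The general case splits `A` and `B` into `A \ B`, `A ∩ B` and `B \ A`. -/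
theorem IsDeterminantal.lintegral_count_mul (hP : IsDeterminantal μ K P)
    (hK : IsPositiveKernel K k) {A B : Set M} (hA : IsBoundedBorel A) (hB : IsBoundedBorel B) :
    ∫⁻ X, Conf.count A X * Conf.count B X ∂(P : Measure (Conf M)) = pairMeasure μ K k (A ×ˢ B) := by
  have hI : IsBoundedBorel (A ∩ B) := hA.mono (hA.1.inter hB.1) Set.inter_subset_left
  have ha : IsBoundedBorel (A \ B) := hA.mono (hA.1.diff hB.1) Set.sdiff_subset
  have hb : IsBoundedBorel (B \ A) := hB.mono (hB.1.diff hA.1) Set.sdiff_subset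
  have daI : Disjoint (A \ B) (A ∩ B) := Set.disjoint_sdiff_inter
  have dIb : Disjoint (A ∩ B) (B \ A) :=
    Set.disjoint_left.2 fun x hx hx' => hx'.2 hx.1
  have dab : Disjoint (A \ B) (B \ A) := Set.disjoint_left.2 fun x hx hx' => hx.2 hx'.1
  have eA : A = (A \ B) ∪ (A ∩ B) := (Set.sdiff_union_inter A B).symm
  have eB : B = (B \ A) ∪ (A ∩ B) := by rw [Set.inter_comm]; exact (Set.sdiff_union_inter B A).symm
  have cA : ∀ X : Conf M, Conf.count A X = Conf.count (A \ B) X + Conf.count (A ∩ B) X := fun X => by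
    conv_lhs => rw [eA]
    exact measure_union daI hI.1
  have cB : ∀ X : Conf M, Conf.count B X = Conf.count (B \ A) X + Conf.count (A ∩ B) X := fun X => by
    conv_lhs => rw [eB]
    exact measure_union dIb.symm hI.1
  have hm : ∀ {S T : Set M}, IsBoundedBorel S → IsBoundedBorel T →
      Measurable fun X : Conf M => Conf.count S X * Conf.count T X := fun hS hT =>
    (Conf.measurable_count hS.1).mul (Conf.measurable_count hT.1)
  have hL : ∀ X : Conf M, Conf.count A X * Conf.count B X =
      Conf.count (A \ B) X * Conf.count (B \ A) X + (Conf.count (A \ B) X * Conf.count (A ∩ B) X +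
      (Conf.count (A ∩ B) X * Conf.count (B \ A) X + Conf.count (A ∩ B) X * Conf.count (A ∩ B) X)) :=
    fun X => by rw [cA, cB]; ring
  simp_rw [hL]
  rw [lintegral_add_left (hm ha hb), lintegral_add_left (hm ha hI), lintegral_add_left (hm hI hb),
    hP.lintegral_count_mul_of_disjoint hK ha hb dab, hP.lintegral_count_mul_of_disjoint hK ha hI daI,
    hP.lintegral_count_mul_of_disjoint hK hI hb dIb, hP.lintegral_count_mul_self hK hI]
  rw [← add_assoc, ← measure_union (Set.disjoint_prod.2 (.inr dIb.symm)) (ha.1.prod hI.1), ← Set.prod_union, ← eB,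
    ← measure_union (Set.disjoint_prod.2 (.inr dIb.symm)) (hI.1.prod hI.1), ← Set.prod_union, ← eB,
    ← measure_union (Set.disjoint_prod.2 (.inl daI)) (hI.1.prod hB.1), ← Set.union_prod, ← eA]

end SecondMoment

/-! ### Linear statistics of a determinantal process -/

section LinearStatistics

open Filter Topology

variable {M : Type*} [TopologicalSpace M] [MeasurableSpace M] {μ : Measure M} [SigmaFinite μ]
  {K : M → M → ℂ} {k : M → ℝ} {P : PointProcess M}

/-- First moment of a linear statistic restricted to a bounded set. -/
theorem IsDeterminantal.setLIntegral_lintegral (hP : IsDeterminantal μ K P)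
    (hK : IsPositiveKernel K k) {U : Set M} (hU : IsBoundedBorel U) {f : M → ENNReal}
    (hf : Measurable f) :
    ∫⁻ X, ∫⁻ x in U, f x ∂X.1 ∂(P : Measure (Conf M)) =
      ∫⁻ x in U, f x * ENNReal.ofReal (k x) ∂μ := by
  have hr : Measurable fun X : Conf M => X.1.restrict U :=
    (Conf.measurable_restrict hU.1).mono (Conf.sigmaAlgebra_le U) le_rfl
  have hbind : (P : Measure (Conf M)).bind (fun X => X.1.restrict U) =
      (μ.withDensity fun x => ENNReal.ofReal (k x)).restrict U := by
    refine Measure.ext fun s hs => ?_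
    rw [Measure.bind_apply hs hr.aemeasurable, Measure.restrict_apply hs,
      withDensity_apply _ (hs.inter hU.1), ← hP.lintegral_count hK
        (hU.mono (hs.inter hU.1) Set.inter_subset_right)]
    exact lintegral_congr fun X => Measure.restrict_apply hs
  rw [← Measure.lintegral_bind hr.aemeasurable hf.aemeasurable, hbind,
    restrict_withDensity hU.1, lintegral_withDensity_eq_lintegral_mul _
      hK.measurable_diag.ennreal_ofReal hf]
  exact lintegral_congr fun x => mul_comm _ _

/-- Second moment of a linear statistic restricted to a bounded set. -/
theorem IsDeterminantal.setLIntegral_sq (hP : IsDeterminantal μ K P)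
    (hK : IsPositiveKernel K k) {U : Set M} (hU : IsBoundedBorel U) {f : M → ENNReal}
    (hf : Measurable f) :
    ∫⁻ X, (∫⁻ x in U, f x ∂X.1) ^ 2 ∂(P : Measure (Conf M)) =
      ∫⁻ z in U ×ˢ U, f z.1 * f z.2 ∂(pairMeasure μ K k) := by
  have hr : Measurable fun X : Conf M => X.1.restrict U :=
    (Conf.measurable_restrict hU.1).mono (Conf.sigmaAlgebra_le U) le_rfl
  have hfin : ∀ X : Conf M, IsFiniteMeasure (X.1.restrict U) := fun X => ⟨by
    obtain ⟨c, hc⟩ := X.2 U hU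
    rw [Measure.restrict_apply_univ, hc]
    exact ENNReal.natCast_lt_top c⟩
  have hrap : ∀ {s : Set M}, MeasurableSet s → Measurable fun X : Conf M => X.1.restrict U s :=
    fun hs => (Measure.measurable_coe hs).comp hr
  have hprod : Measurable fun X : Conf M => (X.1.restrict U).prod (X.1.restrict U) := by
    refine Measurable.measure_of_isPiSystem generateFrom_prod.symm isPiSystem_prod ?_ ?_
    · rintro _ ⟨s, hs, t, ht, rfl⟩
      simp_rw [Measure.prod_prod]
      exact (hrap hs).mul (hrap ht)
    · simp_rw [← Set.univ_prod_univ, Measure.prod_prod]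
      exact (hrap MeasurableSet.univ).mul (hrap MeasurableSet.univ)
  have hrect : ∀ s t : Set M, MeasurableSet s → MeasurableSet t →
      (P : Measure (Conf M)).bind (fun X => (X.1.restrict U).prod (X.1.restrict U)) (s ×ˢ t) =
        (pairMeasure μ K k).restrict (U ×ˢ U) (s ×ˢ t) := by
    intro s t hs ht
    rw [Measure.bind_apply (hs.prod ht) hprod.aemeasurable, Measure.restrict_apply (hs.prod ht),
      Set.prod_inter_prod, ← hP.lintegral_count_mul hK
        (hU.mono (hs.inter hU.1) Set.inter_subset_right)
        (hU.mono (ht.inter hU.1) Set.inter_subset_right)]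
    refine lintegral_congr fun X => ?_
    rw [Measure.prod_prod, Measure.restrict_apply hs, Measure.restrict_apply ht]
    rfl
  have huniv : (P : Measure (Conf M)).bind (fun X => (X.1.restrict U).prod (X.1.restrict U)) Set.univ
      = (pairMeasure μ K k).restrict (U ×ˢ U) Set.univ := by
    rw [← Set.univ_prod_univ]
    exact hrect _ _ MeasurableSet.univ MeasurableSet.univ
  have hfinL : (P : Measure (Conf M)).bind (fun X => (X.1.restrict U).prod (X.1.restrict U)) Set.univ
      < ⊤ := by
    obtain ⟨h1, -, -⟩ := hP 1 (fun _ => U) (fun _ => 2) (fun _ => hU)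
      (fun i j hij => absurd (Subsingleton.elim i j) hij) fun _ => one_le_two
    obtain ⟨h2, -, -⟩ := hP 1 (fun _ => U) (fun _ => 1) (fun _ => hU)
      (fun i j hij => absurd (Subsingleton.elim i j) hij) fun _ => le_rfl
    have h3 := (h1.add h2).lintegral_lt_top
    rw [Measure.bind_apply MeasurableSet.univ hprod.aemeasurable]
    refine lt_of_le_of_lt (le_of_eq (lintegral_congr fun X => ?_)) h3
    obtain ⟨c, hc⟩ := X.2 U hU
    rw [← Set.univ_prod_univ, Measure.prod_prod, Measure.restrict_apply_univ, hc]
    simp only [Finset.univ_unique, Finset.prod_singleton, Finset.prod_range_succ, Finset.prod_range_zero,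
      Conf.count, hc, ENNReal.toReal_natCast, Pi.add_apply]
    rw [← ENNReal.ofReal_natCast, ← ENNReal.ofReal_mul c.cast_nonneg]
    congr 1
    push_cast
    ring
  have hbind : (P : Measure (Conf M)).bind (fun X => (X.1.restrict U).prod (X.1.restrict U)) =
      (pairMeasure μ K k).restrict (U ×ˢ U) := by
    have : IsFiniteMeasure ((P : Measure (Conf M)).bind
      (fun X => (X.1.restrict U).prod (X.1.restrict U))) := ⟨hfinL⟩
    refine ext_of_generate_finite _ generateFrom_prod.symm isPiSystem_prod ?_ huniv
    rintro _ ⟨s, hs, t, ht, rfl⟩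
    exact hrect s t hs ht
  have hff : Measurable fun z : M × M => f z.1 * f z.2 :=
    (hf.comp measurable_fst).mul (hf.comp measurable_snd)
  rw [← hbind, Measure.lintegral_bind hprod.aemeasurable hff.aemeasurable]
  refine lintegral_congr fun X => ?_
  rw [lintegral_prod_mul hf.aemeasurable hf.aemeasurable, sq]

theorem tendsto_setLIntegral_of_monotone {α : Type*} [MeasurableSpace α] (ν : Measure α)
    {U : ℕ → Set α} (hU : Monotone U) (hUm : ∀ r, MeasurableSet (U r)) (hun : ⋃ r, U r = Set.univ)
    (f : α → ENNReal) :
    Tendsto (fun r => ∫⁻ x in U r, f x ∂ν) atTop (𝓝 (∫⁻ x, f x ∂ν)) := by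
  have h := tendsto_measure_iUnion_atTop (μ := ν.withDensity f) hU
  rw [hun, withDensity_apply _ MeasurableSet.univ, Measure.restrict_univ] at h
  refine h.congr fun r => ?_
  exact withDensity_apply _ (hUm r)

theorem IsDeterminantal.lintegral_lintegral (hP : IsDeterminantal μ K P)
    (hK : IsPositiveKernel K k) {U : ℕ → Set M} (hUb : ∀ r, IsBoundedBorel (U r)) (hU : Monotone U)
    (hun : ⋃ r, U r = Set.univ) {f : M → ENNReal} (hf : Measurable f) :
    ∫⁻ X, ∫⁻ x, f x ∂X.1 ∂(P : Measure (Conf M)) = ∫⁻ x, f x * ENNReal.ofReal (k x) ∂μ := by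
  have h1 := tendsto_setLIntegral_of_monotone μ hU (fun r => (hUb r).1) hun
    fun x => f x * ENNReal.ofReal (k x)
  simp_rw [← hP.setLIntegral_lintegral hK (hUb _) hf] at h1
  refine tendsto_nhds_unique (lintegral_tendsto_of_tendsto_of_monotone (fun r => ?_) ?_ ?_) h1
  · exact ((Conf.measurable_lintegral (hUb r).1 hf).mono (Conf.sigmaAlgebra_le _) le_rfl).aemeasurable
  · exact .of_forall fun X r s hrs => lintegral_mono_set (hU hrs)
  · exact .of_forall fun X => tendsto_setLIntegral_of_monotone X.1 hU (fun r => (hUb r).1) hun f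

/-- The second moment of a linear statistic, with the part that repels points brought to the
left-hand side. -/
theorem IsDeterminantal.lintegral_sq_add (hP : IsDeterminantal μ K P)
    (hK : IsPositiveKernel K k) {U : ℕ → Set M} (hUb : ∀ r, IsBoundedBorel (U r)) (hU : Monotone U)
    (hun : ⋃ r, U r = Set.univ) {f : M → ENNReal} (hf : Measurable f) :
    ∫⁻ X, (∫⁻ x, f x ∂X.1) ^ 2 ∂(P : Measure (Conf M)) +
        ∫⁻ x, ∫⁻ y, f x * f y * ENNReal.ofReal (‖K x y‖ ^ 2) ∂μ ∂μ =
      ∫⁻ x, f x ^ 2 * ENNReal.ofReal (k x) ∂μ + (∫⁻ x, f x * ENNReal.ofReal (k x) ∂μ) ^ 2 := by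
  have hUU : Monotone fun r => U r ×ˢ U r := fun r s hrs => Set.prod_mono (hU hrs) (hU hrs)
  have hUUn : ⋃ r, U r ×ˢ U r = Set.univ := by
    refine Set.eq_univ_of_forall fun z => ?_
    obtain ⟨r, hr⟩ := Set.mem_iUnion.1 (hun ▸ Set.mem_univ z.1 : z.1 ∈ ⋃ r, U r)
    obtain ⟨s, hs⟩ := Set.mem_iUnion.1 (hun ▸ Set.mem_univ z.2 : z.2 ∈ ⋃ r, U r)
    exact Set.mem_iUnion.2 ⟨max r s, hU (le_max_left r s) hr, hU (le_max_right r s) hs⟩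
  have hff : Measurable fun z : M × M => f z.1 * f z.2 :=
    (hf.comp measurable_fst).mul (hf.comp measurable_snd)
  have hk := hK.measurable_diag
  have hρ : Measurable fun z : M × M => k z.1 * k z.2 - ‖K z.1 z.2‖ ^ 2 :=
    ((hk.comp measurable_fst).mul (hk.comp measurable_snd)).sub hK.measurable_norm_sq
  have hsq : ∫⁻ X, (∫⁻ x, f x ∂X.1) ^ 2 ∂(P : Measure (Conf M)) =
      ∫⁻ z, f z.1 * f z.2 ∂(pairMeasure μ K k) := by
    have h1 := tendsto_setLIntegral_of_monotone (pairMeasure μ K k) hUU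
      (fun r => (hUb r).1.prod (hUb r).1) hUUn fun z => f z.1 * f z.2
    simp_rw [← hP.setLIntegral_sq hK (hUb _) hf] at h1
    refine tendsto_nhds_unique (lintegral_tendsto_of_tendsto_of_monotone (fun r => ?_) ?_ ?_) h1
    · exact (((Conf.measurable_lintegral (hUb r).1 hf).mono
        (Conf.sigmaAlgebra_le _) le_rfl).pow_const 2).aemeasurable
    · exact .of_forall fun X r s hrs => pow_le_pow_left₀ zero_le (lintegral_mono_set (hU hrs)) 2
    · exact .of_forall fun X => ((ENNReal.continuous_pow 2).tendsto _).comp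
        (tendsto_setLIntegral_of_monotone X.1 hU (fun r => (hUb r).1) hun f)
  have hd : Measurable fun x : M => (x, x) := measurable_id.prodMk measurable_id
  have hf2 : Measurable fun x => f x * f x := hf.mul hf
  have hdiag : ∫⁻ x, f x * f x ∂(μ.withDensity fun x => ENNReal.ofReal (k x)) =
      ∫⁻ x, f x ^ 2 * ENNReal.ofReal (k x) ∂μ := by
    rw [lintegral_withDensity_eq_lintegral_mul _ hk.ennreal_ofReal hf2]
    refine lintegral_congr fun x => ?_
    simp only [Pi.mul_apply]
    ring
  rw [hsq, pairMeasure, lintegral_add_measure, lintegral_map hff hd, hdiag,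
    lintegral_withDensity_eq_lintegral_mul _ hρ.ennreal_ofReal hff, add_assoc]
  congr 1
  · have hm2 : Measurable fun z : M × M => f z.1 * f z.2 * ENNReal.ofReal (‖K z.1 z.2‖ ^ 2) :=
      hff.mul hK.measurable_norm_sq.ennreal_ofReal
    have hm1 : Measurable ((fun z : M × M => ENNReal.ofReal (k z.1 * k z.2 - ‖K z.1 z.2‖ ^ 2)) *
        fun z : M × M => f z.1 * f z.2) := hρ.ennreal_ofReal.mul hff
    have hfk : Measurable fun x => f x * ENNReal.ofReal (k x) := hf.mul hk.ennreal_ofReal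
    rw [← lintegral_prod (fun z : M × M => f z.1 * f z.2 * ENNReal.ofReal (‖K z.1 z.2‖ ^ 2))
      hm2.aemeasurable, ← lintegral_add_left hm1, sq,
      ← lintegral_prod_mul hfk.aemeasurable hfk.aemeasurable]
    refine lintegral_congr fun z => ?_
    simp only [Pi.mul_apply]
    rw [mul_comm, ← mul_add, ← ENNReal.ofReal_add (sub_nonneg.2 (hK.norm_sq_le _ _)) (sq_nonneg _),
      sub_add_cancel, ENNReal.ofReal_mul (hK.diag_nonneg _)]
    ring

end LinearStatistics

/-! ### Linear statistics of radial weights on the disc -/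

section DiscMoments

open Filter Topology

variable {a : ℕ → ℝ}

/-- The intensity `K(z, z)` of the kernel. -/
noncomputable def discIntensity (a : ℕ → ℝ) (z : Disc) : ℝ :=
  ∑' n : ℕ, a n * ((n : ℝ) + 1) * (‖(z : ℂ)‖ ^ 2) ^ n

theorem discKernel_self (a : ℕ → ℝ) (z : Disc) :
    discKernel (fun n => (a n : ℂ)) z z = discIntensity a z := by
  rw [discKernel, discIntensity, Complex.ofReal_tsum]
  refine tsum_congr fun n => ?_
  rw [mul_assoc _ ((z : ℂ) ^ n), ← mul_pow, Complex.mul_conj']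
  push_cast
  ring

theorem conj_discKernel (a : ℕ → ℝ) (z w : Disc) :
    starRingEnd ℂ (discKernel (fun n => (a n : ℂ)) z w) = discKernel (fun n => (a n : ℂ)) w z := by
  rw [discKernel, discKernel, Complex.conj_tsum]
  refine tsum_congr fun n => ?_
  simp only [map_mul, map_pow, map_add, map_one, Complex.conj_ofReal, map_natCast, Complex.conj_conj]
  ring

theorem intensity_term_nonneg (ha : ∀ n, a n = 0 ∨ a n = 1) (z : Disc) (n : ℕ) :
    0 ≤ a n * ((n : ℝ) + 1) * (‖(z : ℂ)‖ ^ 2) ^ n := by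
  rcases ha n with h | h <;> rw [h] <;> positivity

/-- The Cauchy–Schwarz inequality for the finite sums. -/
theorem norm_sq_discKernelTrunc_le (a : ℕ → ℝ) (N : ℕ) (z w : Disc) :
    ‖discKernelTrunc a N z w‖ ^ 2 ≤ ‖discKernelTrunc a N z z‖ * ‖discKernelTrunc a N w w‖ := by
  have hd : ∀ u : Disc, ‖discKernelTrunc a N u u‖ =
      ∑ n : {n ∈ Finset.range N | a n = 1}, ‖bergmanBasis n u‖ ^ 2 := by
    intro u
    have h1 : discKernelTrunc a N u u =
        ((∑ n : {n ∈ Finset.range N | a n = 1}, ‖bergmanBasis n u‖ ^ 2 : ℝ) : ℂ) := by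
      rw [discKernelTrunc, projectionKernel]
      simp only [Complex.mul_conj']
      push_cast
      rfl
    rw [h1, Complex.norm_real, Real.norm_of_nonneg (by positivity)]
  rw [hd, hd]
  refine le_trans ?_ (Finset.sum_mul_sq_le_sq_mul_sq _ _ _)
  gcongr
  rw [discKernelTrunc, projectionKernel]
  refine (norm_sum_le _ _).trans (le_of_eq (Finset.sum_congr rfl fun n _ => ?_))
  rw [norm_mul, RCLike.norm_conj]

theorem isPositiveKernel_discKernel (ha : ∀ n, a n = 0 ∨ a n = 1) :
    IsPositiveKernel (discKernel fun n => (a n : ℂ)) (discIntensity a) where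
  measurable := measurable_discKernel ha
  diag := discKernel_self a
  diag_nonneg z := tsum_nonneg (intensity_term_nonneg ha z)
  mul_swap z w := by
    rw [← conj_discKernel a z w, Complex.mul_conj']
    push_cast
    rfl
  norm_sq_le z w := by
    have hn : ∀ u, discIntensity a u = ‖discKernel (fun n => (a n : ℂ)) u u‖ := fun u => by
      rw [discKernel_self, Complex.norm_real]
      exact (Real.norm_of_nonneg (tsum_nonneg (intensity_term_nonneg ha u))).symm
    rw [hn, hn]
    exact le_of_tendsto_of_tendsto' ((tendsto_discKernelTrunc ha z w).norm.pow 2)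
      ((tendsto_discKernelTrunc ha z z).norm.mul (tendsto_discKernelTrunc ha w w).norm)
      fun N => norm_sq_discKernelTrunc_le a N z w

/-- The closed discs of radius `1 - 1 / (r + 1)` exhaust the disc by bounded sets. -/
theorem isBoundedBorel_norm_le (r : ℕ) :
    IsBoundedBorel {z : Disc | ‖(z : ℂ)‖ ≤ 1 - ((r : ℝ) + 1)⁻¹} := by
  have hcl : IsClosed {z : Disc | ‖(z : ℂ)‖ ≤ 1 - ((r : ℝ) + 1)⁻¹} :=
    isClosed_le (by fun_prop) continuous_const
  refine ⟨hcl.measurableSet, ?_⟩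
  rw [hcl.closure_eq, Topology.IsEmbedding.subtypeVal.isCompact_iff]
  convert isCompact_closedBall (0 : ℂ) (1 - ((r : ℝ) + 1)⁻¹) using 1
  ext z
  simp only [Set.mem_image, mem_closedBall_zero_iff]
  constructor
  · rintro ⟨w, hw, rfl⟩
    exact hw
  · intro hz
    have : (0 : ℝ) < ((r : ℝ) + 1)⁻¹ := by positivity
    exact ⟨⟨z, mem_ball_zero_iff.2 (by linarith)⟩, hz, rfl⟩

theorem monotone_norm_le :
    Monotone fun r : ℕ => {z : Disc | ‖(z : ℂ)‖ ≤ 1 - ((r : ℝ) + 1)⁻¹} := by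
  intro r s hrs z (hz : ‖(z : ℂ)‖ ≤ 1 - ((r : ℝ) + 1)⁻¹)
  have : ((s : ℝ) + 1)⁻¹ ≤ ((r : ℝ) + 1)⁻¹ := by gcongr
  exact hz.trans (by linarith)

theorem iUnion_norm_le : ⋃ r : ℕ, {z : Disc | ‖(z : ℂ)‖ ≤ 1 - ((r : ℝ) + 1)⁻¹} = Set.univ :=
  Set.eq_univ_of_forall fun z =>
    Set.mem_iUnion.2 ⟨discLevel z, norm_le_of_discLevel_le le_rfl⟩

/-- The test function `(-log |z|²)^ε`. For small `ε` it is close to `1` on compact subsets of the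
punctured disc, and it tends to `0` at the unit circle. The value at the centre, where `log 0 = 0`
enters, does not matter: almost surely there is no point of the process there. -/
noncomputable def logWeight (ε : ℝ) (z : Disc) : ENNReal :=
  ENNReal.ofReal ((-Real.log (‖(z : ℂ)‖ ^ 2)) ^ ε)

theorem measurable_logWeight (ε : ℝ) : Measurable (logWeight ε) := by
  unfold logWeight
  fun_prop

theorem neg_log_norm_sq_nonneg (z : Disc) : 0 ≤ -Real.log (‖(z : ℂ)‖ ^ 2) :=
  neg_nonneg.2 (Real.log_nonpos (by positivity)
    (pow_le_one₀ (norm_nonneg _) (norm_disc_lt_one z).le))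

theorem logWeight_sq (ε : ℝ) (z : Disc) : logWeight ε z ^ 2 = logWeight (2 * ε) z := by
  rw [logWeight, ← ENNReal.ofReal_pow (Real.rpow_nonneg (neg_log_norm_sq_nonneg z) _), logWeight,
    mul_comm, Real.rpow_mul (neg_log_norm_sq_nonneg z), Real.rpow_two]

/-- The mean of `logWeight ε` under the probability density `(n + 1) |z|^(2n)`. -/
noncomputable def logWeightMean (ε : ℝ) (n : ℕ) : ℝ := Real.Gamma (ε + 1) / ((n : ℝ) + 1) ^ ε

theorem logWeightMean_nonneg {ε : ℝ} (hε : 0 ≤ ε) (n : ℕ) : 0 ≤ logWeightMean ε n := by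
  have := Real.Gamma_pos_of_pos (s := ε + 1) (by linarith)
  unfold logWeightMean
  positivity

theorem lintegral_logWeight_mul_pow {ε : ℝ} (hε : 0 ≤ ε) (n : ℕ) :
    ∫⁻ z, logWeight ε z * ENNReal.ofReal ((‖(z : ℂ)‖ ^ 2) ^ n) ∂discMeasure =
      ENNReal.ofReal (logWeightMean ε n / ((n : ℝ) + 1)) := by
  rw [logWeightMean, div_div, ← Real.rpow_add_one (by positivity), ← lintegral_disc_rpow_mul_pow hε]
  refine lintegral_congr fun z => ?_
  rw [logWeight, ← ENNReal.ofReal_mul (Real.rpow_nonneg (neg_log_norm_sq_nonneg z) _)]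

theorem lintegral_logWeight_mul_tsum {ε : ℝ} (hε : 0 ≤ ε) {c : ℕ → ℝ} (hc : ∀ n, 0 ≤ c n) :
    ∫⁻ z, logWeight ε z * ∑' n : ℕ, ENNReal.ofReal (c n * ((n : ℝ) + 1) * (‖(z : ℂ)‖ ^ 2) ^ n)
      ∂discMeasure = ∑' n, ENNReal.ofReal (c n * logWeightMean ε n) := by
  have hm := measurable_logWeight ε
  simp_rw [← ENNReal.tsum_mul_left]
  rw [lintegral_tsum fun n => by fun_prop]
  refine tsum_congr fun n => ?_
  have h1 : ∀ z : Disc, logWeight ε z * ENNReal.ofReal (c n * ((n : ℝ) + 1) * (‖(z : ℂ)‖ ^ 2) ^ n) =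
      ENNReal.ofReal (c n * ((n : ℝ) + 1)) *
        (logWeight ε z * ENNReal.ofReal ((‖(z : ℂ)‖ ^ 2) ^ n)) := fun z => by
    rw [ENNReal.ofReal_mul (mul_nonneg (hc n) (by positivity))]
    ring
  simp_rw [h1]
  rw [lintegral_const_mul _ (by fun_prop), lintegral_logWeight_mul_pow hε,
    ← ENNReal.ofReal_mul (mul_nonneg (hc n) (by positivity))]
  congr 1
  field_simp

theorem lintegral_logWeight_mul_intensity (ha : ∀ n, a n = 0 ∨ a n = 1) {ε : ℝ} (hε : 0 ≤ ε) :
    ∫⁻ z, logWeight ε z * ENNReal.ofReal (discIntensity a z) ∂discMeasure =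
      ∑' n, ENNReal.ofReal (a n * logWeightMean ε n) := by
  rw [← lintegral_logWeight_mul_tsum hε fun n => by rcases ha n with h | h <;> simp [h]]
  refine lintegral_congr fun z => ?_
  rw [discIntensity, ENNReal.ofReal_tsum_of_nonneg (intensity_term_nonneg ha z)]
  refine Summable.of_nonneg_of_le (intensity_term_nonneg ha z) (fun n => ?_)
    (summable_succ_mul_pow (r := ‖(z : ℂ)‖ ^ 2) (by positivity)
      (pow_lt_one₀ (norm_nonneg _) (norm_disc_lt_one z) two_ne_zero))
  have h1 : a n ≤ 1 := by rcases ha n with h | h <;> simp [h]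
  gcongr
  exact mul_le_of_le_one_left (by positivity) h1

theorem hasSum_mul_conj {t : ℕ → ℂ} {s : ℂ} (h : HasSum t s) (hs : Summable fun n => ‖t n‖) :
    HasSum (fun p : ℕ × ℕ => t p.1 * starRingEnd ℂ (t p.2)) ((‖s‖ ^ 2 : ℝ) : ℂ) := by
  have h' : HasSum (fun n => starRingEnd ℂ (t n)) (starRingEnd ℂ s) := Complex.hasSum_conj'.2 h
  have hs' : Summable fun n => ‖starRingEnd ℂ (t n)‖ := hs.congr fun n => (RCLike.norm_conj _).symm
  have hp : Summable fun p : ℕ × ℕ => t p.1 * starRingEnd ℂ (t p.2) :=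
    summable_mul_of_summable_norm (f := t) (g := fun n => starRingEnd ℂ (t n)) hs hs'
  have := h.mul h' hp
  rwa [Complex.mul_conj', ← Complex.ofReal_pow] at this

theorem integrable_neg_log_rpow {ε : ℝ} (hε : 0 ≤ ε) :
    Integrable (fun y : Disc => (-Real.log (‖(y : ℂ)‖ ^ 2)) ^ ε) discMeasure := by
  have hm : Measurable fun y : Disc => (-Real.log (‖(y : ℂ)‖ ^ 2)) ^ ε := by fun_prop
  refine ⟨hm.aestronglyMeasurable, ?_⟩
  rw [hasFiniteIntegral_iff_ofReal (.of_forall fun y => Real.rpow_nonneg (neg_log_norm_sq_nonneg y) _)]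
  have := lintegral_disc_rpow_mul_pow hε 0
  simp only [pow_zero, mul_one] at this
  rw [this]
  exact ENNReal.ofReal_lt_top

theorem norm_mul_conj_pow_le (c : ℂ) (q : ℕ) (y : Disc) :
    ‖c * starRingEnd ℂ (y : ℂ) ^ q‖ ≤ ‖c‖ := by
  rw [norm_mul, norm_pow, RCLike.norm_conj]
  exact mul_le_of_le_one_right (norm_nonneg _) (pow_le_one₀ (norm_nonneg _) (norm_disc_lt_one y).le)

theorem summable_mul_conj_pow {c : ℕ → ℂ} (hc : Summable fun n => ‖c n‖) (y : Disc) :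
    Summable fun n => ‖c n * starRingEnd ℂ (y : ℂ) ^ n‖ :=
  Summable.of_nonneg_of_le (fun _ => norm_nonneg _) (fun n => norm_mul_conj_pow_le (c n) n y) hc

/-- The terms of the double series of `|∑ c n ȳⁿ|²`, with the weight `(-log |y|²)^ε`. -/
noncomputable def weightedTerm (ε : ℝ) (c : ℕ → ℂ) (p : ℕ × ℕ) (y : Disc) : ℂ :=
  (((-Real.log (‖(y : ℂ)‖ ^ 2)) ^ ε : ℝ) : ℂ) * ((c p.1 * starRingEnd ℂ (y : ℂ) ^ p.1) *
    starRingEnd ℂ (c p.2 * starRingEnd ℂ (y : ℂ) ^ p.2))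

theorem measurable_weightedTerm (ε : ℝ) (c : ℕ → ℂ) (p : ℕ × ℕ) :
    Measurable (weightedTerm ε c p) := by
  have hstar : Measurable fun y : Disc => starRingEnd ℂ (y : ℂ) :=
    Complex.continuous_conj.measurable.comp measurable_subtype_coe
  have h1 : ∀ q : ℕ, Measurable fun y : Disc => c q * starRingEnd ℂ (y : ℂ) ^ q :=
    fun q => (hstar.pow_const q).const_mul _
  have h2 : Measurable fun y : Disc => (((-Real.log (‖(y : ℂ)‖ ^ 2)) ^ ε : ℝ) : ℂ) := by fun_prop
  exact h2.mul ((h1 _).mul (Complex.continuous_conj.measurable.comp (h1 _)))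

theorem norm_weightedTerm_le (ε : ℝ) (c : ℕ → ℂ) (p : ℕ × ℕ) (y : Disc) :
    ‖weightedTerm ε c p y‖ ≤ (‖c p.1‖ * ‖c p.2‖) * (-Real.log (‖(y : ℂ)‖ ^ 2)) ^ ε := by
  have h0 := Real.rpow_nonneg (neg_log_norm_sq_nonneg y) ε
  rw [weightedTerm, norm_mul, norm_mul, RCLike.norm_conj, Complex.norm_real, Real.norm_of_nonneg h0,
    mul_comm]
  exact mul_le_mul_of_nonneg_right (mul_le_mul (norm_mul_conj_pow_le _ _ y)
    (norm_mul_conj_pow_le _ _ y) (norm_nonneg _) (norm_nonneg _)) h0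

theorem integral_weightedTerm_diag {ε : ℝ} (hε : 0 ≤ ε) (c : ℕ → ℂ) (n : ℕ) :
    ∫ y, weightedTerm ε c (n, n) y ∂discMeasure =
      ((‖c n‖ ^ 2 * (logWeightMean ε n / ((n : ℝ) + 1)) : ℝ) : ℂ) := by
  have h1 : ∀ y, weightedTerm ε c (n, n) y =
      ((‖c n‖ ^ 2 * ((-Real.log (‖(y : ℂ)‖ ^ 2)) ^ ε * (‖(y : ℂ)‖ ^ 2) ^ n) : ℝ) : ℂ) := fun y => by
    rw [weightedTerm, Complex.mul_conj', norm_mul, norm_pow, RCLike.norm_conj]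
    push_cast
    ring
  simp_rw [h1]
  rw [integral_complex_ofReal, integral_const_mul, integral_eq_lintegral_of_nonneg_ae
    (.of_forall fun y => mul_nonneg (Real.rpow_nonneg (neg_log_norm_sq_nonneg y) _) (by positivity))
    (by fun_prop), lintegral_disc_rpow_mul_pow hε, ENNReal.toReal_ofReal, logWeightMean, div_div,
    ← Real.rpow_add_one (by positivity)]
  have := Real.Gamma_pos_of_pos (s := ε + 1) (by linarith)
  positivity

theorem integral_weightedTerm_of_ne (ε : ℝ) (c : ℕ → ℂ) {n m : ℕ} (hnm : n ≠ m) :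
    ∫ y, weightedTerm ε c (n, m) y ∂discMeasure = 0 := by
  have h1 : ∀ y, weightedTerm ε c (n, m) y = (c n * starRingEnd ℂ (c m)) *
      ((fun r : ℝ => (((-Real.log (r ^ 2)) ^ ε : ℝ) : ℂ)) ‖(y : ℂ)‖ *
        ((y : ℂ) ^ m * starRingEnd ℂ (y : ℂ) ^ n)) := fun y => by
    simp only [weightedTerm, map_mul, map_pow, Complex.conj_conj]
    ring
  simp_rw [h1]
  rw [integral_const_mul]
  exact mul_eq_zero_of_right _ (integral_disc_radial_mul_eq_zero
    (fun r : ℝ => (((-Real.log (r ^ 2)) ^ ε : ℝ) : ℂ)) hnm.symm)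

theorem tsum_weightedTerm (ε : ℝ) {c : ℕ → ℂ} (hc : Summable fun n => ‖c n‖) (y : Disc) :
    ∑' p, weightedTerm ε c p y = (((-Real.log (‖(y : ℂ)‖ ^ 2)) ^ ε *
      ‖∑' n, c n * starRingEnd ℂ (y : ℂ) ^ n‖ ^ 2 : ℝ) : ℂ) := by
  have hs := summable_mul_conj_pow hc y
  simp only [weightedTerm]
  rw [tsum_mul_left, (hasSum_mul_conj hs.of_norm.hasSum hs).tsum_eq, ← Complex.ofReal_mul]

/-- Parseval's identity for power series with a radial weight. -/
theorem lintegral_logWeight_mul_norm_sq_tsum {ε : ℝ} (hε : 0 ≤ ε) {c : ℕ → ℂ}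
    (hc : Summable fun n => ‖c n‖) :
    ∫⁻ y, logWeight ε y * ENNReal.ofReal (‖∑' n, c n * starRingEnd ℂ (y : ℂ) ^ n‖ ^ 2) ∂discMeasure =
      ∑' n : ℕ, ENNReal.ofReal (‖c n‖ ^ 2 * (logWeightMean ε n / ((n : ℝ) + 1))) := by
  have hi := integrable_neg_log_rpow hε
  have hFi : ∀ p, Integrable (weightedTerm ε c p) discMeasure := fun p =>
    (hi.const_mul _).mono' (measurable_weightedTerm ε c p).aestronglyMeasurable
      (.of_forall (norm_weightedTerm_le ε c p))
  have hFs : Summable fun p => ∫ y, ‖weightedTerm ε c p y‖ ∂discMeasure := by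
    refine Summable.of_nonneg_of_le (fun p => integral_nonneg fun y => norm_nonneg _)
      (fun p => (integral_mono (hFi p).norm (hi.const_mul _) (norm_weightedTerm_le ε c p)).trans_eq
        (integral_const_mul _ _)) ?_
    exact (hc.mul_of_nonneg hc (fun _ => norm_nonneg _) fun _ => norm_nonneg _).mul_right _
  have hsum := hasSum_integral_of_summable_integral_norm hFi hFs
  have hinj : Function.Injective fun n : ℕ => (n, n) := fun n m hnm => (Prod.mk.inj hnm).1
  rw [← hinj.hasSum_iff ?_] at hsum
  swap
  · rintro ⟨n, m⟩ hp
    exact integral_weightedTerm_of_ne ε c fun hh => hp ⟨n, by rw [hh]⟩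
  simp only [Function.comp_def, integral_weightedTerm_diag hε, tsum_weightedTerm ε hc] at hsum
  rw [integral_complex_ofReal, Complex.hasSum_ofReal] at hsum
  have hnn : ∀ n : ℕ, 0 ≤ ‖c n‖ ^ 2 * (logWeightMean ε n / ((n : ℝ) + 1)) := fun n => by
    have := logWeightMean_nonneg hε n
    positivity
  rw [← ENNReal.ofReal_tsum_of_nonneg hnn hsum.summable, hsum.tsum_eq,
    ofReal_integral_eq_lintegral_ofReal]
  · refine lintegral_congr fun y => ?_
    rw [logWeight, ← ENNReal.ofReal_mul (Real.rpow_nonneg (neg_log_norm_sq_nonneg y) _)]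
  · have hm : Measurable fun y : Disc => ∑' n, c n * starRingEnd ℂ (y : ℂ) ^ n :=
      Measurable.tsum fun n => ((Complex.continuous_conj.measurable.comp
        measurable_subtype_coe).pow_const n).const_mul _
    refine (hi.mul_const ((∑' n, ‖c n‖) ^ 2)).mono'
      (hi.aestronglyMeasurable.mul (hm.norm.pow_const 2).aestronglyMeasurable) (.of_forall fun y => ?_)
    have h0 := Real.rpow_nonneg (neg_log_norm_sq_nonneg y) ε
    rw [Real.norm_of_nonneg (by positivity)]
    gcongr
    exact (summable_mul_conj_pow hc y).of_norm.hasSum.norm_le_of_bounded hc.hasSum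
      fun n => norm_mul_conj_pow_le (c n) n y
  · exact .of_forall fun y =>
      mul_nonneg (Real.rpow_nonneg (neg_log_norm_sq_nonneg y) _) (by positivity)

theorem lintegral_logWeight_mul_norm_sq_discKernel (ha : ∀ n, a n = 0 ∨ a n = 1) {ε : ℝ}
    (hε : 0 ≤ ε) (x : Disc) :
    ∫⁻ y, logWeight ε y * ENNReal.ofReal (‖discKernel (fun n => (a n : ℂ)) x y‖ ^ 2) ∂discMeasure =
      ∑' n : ℕ, ENNReal.ofReal (a n * logWeightMean ε n * ((n : ℝ) + 1) * (‖(x : ℂ)‖ ^ 2) ^ n) := by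
  have hcn : ∀ n : ℕ, ‖(a n : ℂ) * (n + 1) * (x : ℂ) ^ n‖ = a n * ((n : ℝ) + 1) * ‖(x : ℂ)‖ ^ n := by
    intro n
    have h0 : 0 ≤ a n := by rcases ha n with h | h <;> simp [h]
    have h2 : ‖(n + 1 : ℂ)‖ = (n : ℝ) + 1 := by
      rw [← Nat.cast_succ, Complex.norm_natCast, Nat.cast_succ]
    rw [norm_mul, norm_mul, norm_pow, h2, Complex.norm_real, Real.norm_of_nonneg h0]
  have hcs : Summable fun n : ℕ => ‖(a n : ℂ) * (n + 1) * (x : ℂ) ^ n‖ := by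
    refine Summable.of_nonneg_of_le (fun n => norm_nonneg _) (fun n => ?_)
      (summable_succ_mul_pow (norm_nonneg (x : ℂ)) (norm_disc_lt_one x))
    have h1 : a n ≤ 1 := by rcases ha n with h | h <;> simp [h]
    rw [hcn]
    gcongr
    exact mul_le_of_le_one_left (by positivity) h1
  simp only [discKernel]
  rw [lintegral_logWeight_mul_norm_sq_tsum hε hcs]
  refine tsum_congr fun n => ?_
  have h0 : a n ^ 2 = a n := by rcases ha n with h | h <;> simp [h]
  rw [hcn, mul_pow, mul_pow, h0]
  congr 1
  field_simp
  ring

/-- The second moment of the linear statistic of `logWeight ε`. -/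
theorem IsDeterminantal.lintegral_logWeight_sq_add (ha : ∀ n, a n = 0 ∨ a n = 1)
    {P : PointProcess Disc} (hP : IsDeterminantal discMeasure (discKernel fun n => (a n : ℂ)) P)
    {ε : ℝ} (hε : 0 ≤ ε) :
    ∫⁻ X, (∫⁻ z, logWeight ε z ∂X.1) ^ 2 ∂(P : Measure (Conf Disc)) +
        ∑' n, ENNReal.ofReal (a n * logWeightMean ε n ^ 2) =
      ∑' n, ENNReal.ofReal (a n * logWeightMean (2 * ε) n) +
        (∑' n, ENNReal.ofReal (a n * logWeightMean ε n)) ^ 2 := by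
  have h := hP.lintegral_sq_add (isPositiveKernel_discKernel ha) isBoundedBorel_norm_le
    monotone_norm_le iUnion_norm_le (measurable_logWeight ε)
  rw [lintegral_logWeight_mul_intensity ha hε] at h
  simp_rw [logWeight_sq] at h
  rw [lintegral_logWeight_mul_intensity ha (by positivity)] at h
  rw [← h]
  congr 1
  have hw := measurable_logWeight ε
  have h1 : ∀ x : Disc, ∫⁻ y, logWeight ε x * logWeight ε y *
      ENNReal.ofReal (‖discKernel (fun n => (a n : ℂ)) x y‖ ^ 2) ∂discMeasure =
      logWeight ε x * ∑' n : ℕ, ENNReal.ofReal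
        (a n * logWeightMean ε n * ((n : ℝ) + 1) * (‖(x : ℂ)‖ ^ 2) ^ n) := fun x => by
    have hm : Measurable fun y => logWeight ε y *
        ENNReal.ofReal (‖discKernel (fun n => (a n : ℂ)) x y‖ ^ 2) :=
      hw.mul ((((measurable_discKernel ha).comp
        (measurable_const.prodMk measurable_id)).norm.pow_const 2).ennreal_ofReal)
    rw [← lintegral_logWeight_mul_norm_sq_discKernel ha hε, ← lintegral_const_mul _ hm]
    exact lintegral_congr fun y => mul_assoc _ _ _
  simp_rw [h1]
  rw [lintegral_logWeight_mul_tsum hε fun n => mul_nonneg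
    (by rcases ha n with h | h <;> simp [h]) (logWeightMean_nonneg hε n)]
  refine tsum_congr fun n => ?_
  congr 1
  ring

/-- The mean of the linear statistic of `logWeight ε`. -/
theorem IsDeterminantal.lintegral_logWeight (ha : ∀ n, a n = 0 ∨ a n = 1)
    {P : PointProcess Disc} (hP : IsDeterminantal discMeasure (discKernel fun n => (a n : ℂ)) P)
    {ε : ℝ} (hε : 0 ≤ ε) :
    ∫⁻ X, ∫⁻ z, logWeight ε z ∂X.1 ∂(P : Measure (Conf Disc)) =
      ∑' n, ENNReal.ofReal (a n * logWeightMean ε n) := by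
  rw [hP.lintegral_lintegral (isPositiveKernel_discKernel ha) isBoundedBorel_norm_le
    monotone_norm_le iUnion_norm_le (measurable_logWeight ε), lintegral_logWeight_mul_intensity ha hε]

end DiscMoments

/-! ### Number rigidity -/

section Rigidity

open Filter Topology

/-- A variance bound from first and second moments in `[0, ∞]`. -/
theorem lintegral_sub_sq_le {α : Type*} [MeasurableSpace α] {ν : Measure α} [IsProbabilityMeasure ν]
    {T : α → ENNReal} (hT : Measurable T) {m s q : ℝ} (hm0 : 0 ≤ m) (hs0 : 0 ≤ s) (hq0 : 0 ≤ q)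
    (hm : ∫⁻ x, T x ∂ν = ENNReal.ofReal m)
    (hq : ∫⁻ x, T x ^ 2 ∂ν + ENNReal.ofReal s = ENNReal.ofReal q + ENNReal.ofReal m ^ 2) :
    ∫⁻ x, ENNReal.ofReal (((T x).toReal - m) ^ 2) ∂ν ≤ ENNReal.ofReal (q - s) := by
  have hfin : ∀ᵐ x ∂ν, T x < ⊤ := ae_lt_top hT (by rw [hm]; exact ENNReal.ofReal_ne_top)
  have hE2 : ∫⁻ x, T x ^ 2 ∂ν ≠ ⊤ := fun h => by
    rw [h, top_add] at hq
    exact (ENNReal.add_lt_top.2 ⟨ENNReal.ofReal_lt_top,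
      ENNReal.pow_lt_top ENNReal.ofReal_lt_top⟩).ne hq.symm
  have h1 : ∫⁻ x, ENNReal.ofReal (((T x).toReal - m) ^ 2) ∂ν + 2 * ENNReal.ofReal m * ENNReal.ofReal m
      = ∫⁻ x, T x ^ 2 ∂ν + ENNReal.ofReal m ^ 2 := by
    have hL : Measurable fun x => ENNReal.ofReal (((T x).toReal - m) ^ 2) := by fun_prop
    have hT2 : Measurable fun x => T x ^ 2 := hT.pow_const 2
    calc ∫⁻ x, ENNReal.ofReal (((T x).toReal - m) ^ 2) ∂ν + 2 * ENNReal.ofReal m * ENNReal.ofReal m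
        = ∫⁻ x, (ENNReal.ofReal (((T x).toReal - m) ^ 2) + 2 * ENNReal.ofReal m * T x) ∂ν := by
          rw [lintegral_add_left hL, lintegral_const_mul _ hT, hm]
      _ = ∫⁻ x, (T x ^ 2 + ENNReal.ofReal m ^ 2) ∂ν := by
          refine lintegral_congr_ae ?_
          filter_upwards [hfin] with x hx
          lift T x to NNReal using hx.ne with t
          rw [ENNReal.coe_toReal, ← ENNReal.ofReal_coe_nnreal (p := t),
            ← ENNReal.ofReal_ofNat 2, ← ENNReal.ofReal_mul (by norm_num), ← ENNReal.ofReal_mul (by positivity),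
            ← ENNReal.ofReal_pow (by positivity), ← ENNReal.ofReal_pow (by positivity),
            ← ENNReal.ofReal_add (by positivity) (by positivity),
            ← ENNReal.ofReal_add (by positivity) (by positivity)]
          congr 1
          ring
      _ = _ := by
          rw [lintegral_add_left hT2, lintegral_const, measure_univ, mul_one]
  set V := ∫⁻ x, ENNReal.ofReal (((T x).toReal - m) ^ 2) ∂ν
  have hVfin : V ≠ ⊤ := fun h => by
    rw [h, top_add] at h1
    exact (ENNReal.add_lt_top.2 ⟨hE2.lt_top, ENNReal.pow_lt_top ENNReal.ofReal_lt_top⟩).ne h1.symm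
  have h1' := congrArg ENNReal.toReal h1
  have hq' := congrArg ENNReal.toReal hq
  have hm2 : (ENNReal.ofReal m ^ 2) ≠ ⊤ := (ENNReal.pow_lt_top ENNReal.ofReal_lt_top).ne
  have hmm : 2 * ENNReal.ofReal m * ENNReal.ofReal m ≠ ⊤ :=
    ENNReal.mul_ne_top (ENNReal.mul_ne_top (by norm_num) ENNReal.ofReal_ne_top) ENNReal.ofReal_ne_top
  rw [ENNReal.toReal_add hVfin hmm, ENNReal.toReal_add hE2 hm2, ENNReal.toReal_mul, ENNReal.toReal_mul,
    ENNReal.toReal_ofReal hm0, ENNReal.toReal_pow, ENNReal.toReal_ofReal hm0, ENNReal.toReal_ofNat] at h1'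
  rw [ENNReal.toReal_add hE2 ENNReal.ofReal_ne_top, ENNReal.toReal_add ENNReal.ofReal_ne_top hm2,
    ENNReal.toReal_pow, ENNReal.toReal_ofReal hm0, ENNReal.toReal_ofReal hs0,
    ENNReal.toReal_ofReal hq0] at hq'
  rw [← ENNReal.ofReal_toReal hVfin]
  exact ENNReal.ofReal_le_ofReal (by linarith)

/-- Log-convexity of the Gamma function. -/
theorem Real.Gamma_sq_le {ε : ℝ} (hε : 0 ≤ ε) :
    Real.Gamma (ε + 1) ^ 2 ≤ Real.Gamma (2 * ε + 1) := by
  have h := Real.Gamma_mul_add_mul_le_rpow_Gamma_mul_rpow_Gamma (s := 1) (t := 2 * ε + 1)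
    (a := 1 / 2) (b := 1 / 2) one_pos (by linarith) (by norm_num) (by norm_num) (by norm_num)
  rw [Real.Gamma_one, Real.one_rpow, one_mul, ← Real.sqrt_eq_rpow,
    show (1 / 2 * 1 + 1 / 2 * (2 * ε + 1) : ℝ) = ε + 1 by ring] at h
  have h0 := (Real.Gamma_pos_of_pos (s := 2 * ε + 1) (by linarith)).le
  have h1 := (Real.Gamma_pos_of_pos (s := ε + 1) (by linarith)).le
  exact (Real.le_sqrt h1 h0).1 h

theorem measurable_lintegral_conf {f : Disc → ENNReal} (hf : Measurable f) :
    Measurable fun X : Conf Disc => ∫⁻ z, f z ∂X.1 := by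
  simpa only [Measure.restrict_univ] using Conf.measurable_lintegral MeasurableSet.univ hf

variable {a : ℕ → ℝ} {P : PointProcess Disc}

/-- A bound for (in fact, the value of) the variance of the linear statistic of `logWeight ε`. It is
the sum of the variances of the weight under the densities `(n + 1) |z|^(2n)` with `a n = 1`. -/
theorem IsDeterminantal.lintegral_logWeight_sub_sq_le (ha : ∀ n, a n = 0 ∨ a n = 1)
    (hP : IsDeterminantal discMeasure (discKernel fun n => (a n : ℂ)) P) {ε : ℝ} (hε : 0 ≤ ε)
    (hs : Summable fun n : ℕ => a n / ((n : ℝ) + 1) ^ ε) :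
    ∫⁻ X, ENNReal.ofReal (((∫⁻ z, logWeight ε z ∂X.1).toReal - ∑' n, a n * logWeightMean ε n) ^ 2)
        ∂(P : Measure (Conf Disc)) ≤
      ∑' n, ENNReal.ofReal (a n * (logWeightMean (2 * ε) n - logWeightMean ε n ^ 2)) := by
  have ha0 : ∀ n, 0 ≤ a n := fun n => by rcases ha n with h | h <;> simp [h]
  have hε2 : 0 ≤ 2 * ε := by positivity
  have hs2 : Summable fun n : ℕ => a n / ((n : ℝ) + 1) ^ (2 * ε) := by
    refine hs.of_nonneg_of_le (fun n => div_nonneg (ha0 n) (by positivity)) fun n => ?_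
    refine div_le_div_of_nonneg_left (ha0 n) (by positivity) ?_
    exact Real.rpow_le_rpow_of_exponent_le (by linarith [n.cast_nonneg (α := ℝ)]) (by linarith)
  have e2 : ∀ n : ℕ, ((n : ℝ) + 1) ^ (2 * ε) = (((n : ℝ) + 1) ^ ε) ^ 2 := fun n => by
    rw [mul_comm, Real.rpow_mul (by positivity), Real.rpow_two]
  have h1 : Summable fun n => a n * logWeightMean ε n :=
    (hs.mul_left (Real.Gamma (ε + 1))).congr fun n => by rw [logWeightMean]; ring
  have h2 : Summable fun n => a n * logWeightMean (2 * ε) n :=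
    (hs2.mul_left (Real.Gamma (2 * ε + 1))).congr fun n => by rw [logWeightMean]; ring
  have h3 : Summable fun n => a n * logWeightMean ε n ^ 2 :=
    (hs2.mul_left (Real.Gamma (ε + 1) ^ 2)).congr fun n => by
      rw [logWeightMean, e2, div_pow]; ring
  have n1 : ∀ n, 0 ≤ a n * logWeightMean ε n := fun n => mul_nonneg (ha0 n) (logWeightMean_nonneg hε n)
  have n2 : ∀ n, 0 ≤ a n * logWeightMean (2 * ε) n :=
    fun n => mul_nonneg (ha0 n) (logWeightMean_nonneg hε2 n)
  have n3 : ∀ n, 0 ≤ a n * logWeightMean ε n ^ 2 := fun n => mul_nonneg (ha0 n) (sq_nonneg _)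
  have hmom := hP.lintegral_logWeight_sq_add ha hε
  have hmean := hP.lintegral_logWeight ha hε
  rw [← ENNReal.ofReal_tsum_of_nonneg n1 h1] at hmom hmean
  rw [← ENNReal.ofReal_tsum_of_nonneg n2 h2, ← ENNReal.ofReal_tsum_of_nonneg n3 h3] at hmom
  refine (lintegral_sub_sq_le (measurable_lintegral_conf (measurable_logWeight ε)) (tsum_nonneg n1)
    (tsum_nonneg n3) (tsum_nonneg n2) hmean hmom).trans (le_of_eq ?_)
  rw [← h2.tsum_sub h3, ← ENNReal.ofReal_tsum_of_nonneg]
  · simp only [mul_sub]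
  · intro n
    refine mul_nonneg (ha0 n) (sub_nonneg.2 ?_)
    rw [logWeightMean, logWeightMean, e2, div_pow]
    gcongr
    exact Real.Gamma_sq_le hε
  · simpa only [mul_sub] using h2.sub h3

theorem logWeight_le {ε : ℝ} (h0 : 0 ≤ ε) (h1 : ε ≤ 1) (z : Disc) :
    logWeight ε z ≤ 1 + logWeight 1 z := by
  have hL := neg_log_norm_sq_nonneg z
  rw [logWeight, logWeight, ← ENNReal.ofReal_one, ← ENNReal.ofReal_add zero_le_one
    (Real.rpow_nonneg hL _), Real.rpow_one]
  refine ENNReal.ofReal_le_ofReal ?_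
  rcases le_total (-Real.log (‖(z : ℂ)‖ ^ 2)) 1 with h | h
  · linarith [Real.rpow_le_one hL h h0]
  · have := Real.rpow_le_rpow_of_exponent_le h h1
    rw [Real.rpow_one] at this
    linarith

theorem tendsto_logWeight {ε : ℕ → ℝ} (hε : Tendsto ε atTop (𝓝 0)) {z : Disc} (hz : (z : ℂ) ≠ 0) :
    Tendsto (fun k => logWeight (ε k) z) atTop (𝓝 1) := by
  have hp : 0 < -Real.log (‖(z : ℂ)‖ ^ 2) :=
    neg_pos.2 (Real.log_neg (by positivity)
      (pow_lt_one₀ (norm_nonneg _) (norm_disc_lt_one z) two_ne_zero))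
  have h := ((Real.continuous_const_rpow hp.ne').tendsto 0).comp hε
  rw [Real.rpow_zero] at h
  have h2 := ENNReal.tendsto_ofReal h
  rwa [ENNReal.ofReal_one] at h2

/-- Almost surely no point sits at the centre of the disc. -/
theorem IsDeterminantal.ae_ne_zero (ha : ∀ n, a n = 0 ∨ a n = 1)
    (hP : IsDeterminantal discMeasure (discKernel fun n => (a n : ℂ)) P) :
    ∀ᵐ X : Conf Disc ∂(P : Measure (Conf Disc)), ∀ᵐ z : Disc ∂X.1, (z : ℂ) ≠ 0 := by
  have hset : {z : Disc | ¬ (z : ℂ) ≠ 0} = {⟨0, by simp⟩} := by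
    ext z
    exact not_not.trans ⟨fun h => Subtype.ext h, fun h => congrArg Subtype.val h⟩
  have hB : IsBoundedBorel {z : Disc | ¬ (z : ℂ) ≠ 0} := by
    rw [hset]
    exact ⟨MeasurableSet.singleton _, by rw [closure_singleton]; exact isCompact_singleton⟩
  have h := hP.lintegral_count (isPositiveKernel_discKernel ha) hB
  rw [setLIntegral_measure_zero _ _ (ae_iff.1 ae_discMeasure_ne_zero),
    lintegral_eq_zero_iff (Conf.measurable_count hB.1)] at h
  filter_upwards [h] with X hX
  exact ae_iff.2 hX

/-- A determinantal process is number rigid if the linear statistics of `logWeight ε` have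
summable variances along some sequence `ε → 0`: the statistic is then close to its mean, which is
not random, and its contribution from `B` is close to the number of points in `B`. -/
theorem IsDeterminantal.isNumberRigid (ha : ∀ n, a n = 0 ∨ a n = 1)
    (hP : IsDeterminantal discMeasure (discKernel fun n => (a n : ℂ)) P) {ε : ℕ → ℝ}
    (hε0 : ∀ k, 0 ≤ ε k) (hε1 : ∀ k, ε k ≤ 1) (hε : Tendsto ε atTop (𝓝 0))
    (hs : ∀ k, Summable fun n : ℕ => a n / ((n : ℝ) + 1) ^ ε k)
    (hV : ∑' k, ∑' n, ENNReal.ofReal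
      (a n * (logWeightMean (2 * ε k) n - logWeightMean (ε k) n ^ 2)) ≠ ⊤) :
    IsNumberRigid P := by
  have ha0 : ∀ n, 0 ≤ a n := fun n => by rcases ha n with h | h <;> simp [h]
  let T : ℕ → Conf Disc → ENNReal := fun k X => ∫⁻ z, logWeight (ε k) z ∂X.1
  let m : ℕ → ℝ := fun k => ∑' n, a n * logWeightMean (ε k) n
  have hT : ∀ k, Measurable (T k) := fun k => measurable_lintegral_conf (measurable_logWeight _)
  have hfin : ∀ {δ : ℝ}, 0 ≤ δ → (Summable fun n : ℕ => a n / ((n : ℝ) + 1) ^ δ) →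
      ∀ᵐ X : Conf Disc ∂(P : Measure (Conf Disc)), ∫⁻ z, logWeight δ z ∂X.1 ≠ ⊤ := by
    intro δ hδ hsδ
    have h1 : Summable fun n => a n * logWeightMean δ n :=
      (hsδ.mul_left (Real.Gamma (δ + 1))).congr fun n => by rw [logWeightMean]; ring
    have h2 := hP.lintegral_logWeight ha hδ
    rw [← ENNReal.ofReal_tsum_of_nonneg (fun n => mul_nonneg (ha0 n) (logWeightMean_nonneg hδ n)) h1]
      at h2
    filter_upwards [ae_lt_top (measurable_lintegral_conf (measurable_logWeight δ))
      (by rw [h2]; exact ENNReal.ofReal_ne_top)] with X hX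
    exact hX.ne
  have hs1 : Summable fun n : ℕ => a n / ((n : ℝ) + 1) ^ (1 : ℝ) := by
    refine (hs 0).of_nonneg_of_le (fun n => div_nonneg (ha0 n) (by positivity)) fun n => ?_
    refine div_le_div_of_nonneg_left (ha0 n) (by positivity) ?_
    exact Real.rpow_le_rpow_of_exponent_le (by linarith [n.cast_nonneg (α := ℝ)]) (hε1 0)
  -- the deviations from the means have summable second moments
  have hlim : ∀ᵐ X : Conf Disc ∂(P : Measure (Conf Disc)),
      Tendsto (fun k => (T k X).toReal - m k) atTop (𝓝 0) := by
    have hm : ∀ k, Measurable fun X => ENNReal.ofReal (((T k X).toReal - m k) ^ 2) := fun k => by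
      have := hT k
      fun_prop
    have h1 : ∫⁻ X, ∑' k, ENNReal.ofReal (((T k X).toReal - m k) ^ 2) ∂(P : Measure (Conf Disc))
        ≠ ⊤ := by
      rw [lintegral_tsum fun k => (hm k).aemeasurable]
      exact ne_top_of_le_ne_top hV (ENNReal.tsum_le_tsum fun k =>
        hP.lintegral_logWeight_sub_sq_le ha (hε0 k) (hs k))
    filter_upwards [ae_lt_top (Measurable.tsum hm) h1] with X hX
    have h2 := ENNReal.tendsto_atTop_zero_of_tsum_ne_top hX.ne
    have h3 := (ENNReal.tendsto_toReal ENNReal.zero_ne_top).comp h2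
    have h4 : Tendsto (fun k => ((T k X).toReal - m k) ^ 2) atTop (𝓝 0) := by
      refine h3.congr fun k => ?_
      exact ENNReal.toReal_ofReal (sq_nonneg _)
    have h5 := h4.sqrt
    simp only [Real.sqrt_sq_eq_abs, Real.sqrt_zero] at h5
    exact (tendsto_zero_iff_abs_tendsto_zero _).2 h5
  intro B hB
  have hR : ∀ k, Measurable[Conf.sigmaAlgebra Bᶜ] fun X : Conf Disc =>
      ∫⁻ z in Bᶜ, logWeight (ε k) z ∂X.1 :=
    fun k => Conf.measurable_lintegral hB.1.compl (measurable_logWeight _)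
  have hG : Measurable[Conf.sigmaAlgebra Bᶜ] fun X : Conf Disc => liminf (fun k =>
      ENNReal.ofReal (m k - (∫⁻ z in Bᶜ, logWeight (ε k) z ∂X.1).toReal)) atTop := by
    refine Measurable.liminf fun k => ?_
    exact ENNReal.measurable_ofReal.comp (measurable_const.sub (ENNReal.measurable_toReal.comp (hR k)))
  refine hG.eventuallyMeasurable_of_eventuallyEq ?_
  filter_upwards [hlim, hP.ae_ne_zero ha, hfin zero_le_one hs1,
    ae_all_iff.2 fun k => hfin (hε0 k) (hs k)] with X hX hX0 hX1 hXk
  have hcB : X.1 B ≠ ⊤ := by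
    obtain ⟨c, hc⟩ := X.2 B hB
    rw [hc]
    exact ENNReal.natCast_ne_top c
  -- on `B` the test functions tend to `1`
  have hB1 : Tendsto (fun k => ∫⁻ z in B, logWeight (ε k) z ∂X.1) atTop (𝓝 (X.1 B)) := by
    have h := tendsto_lintegral_of_dominated_convergence (μ := X.1.restrict B)
      (F := fun k => logWeight (ε k)) (f := 1)
      (fun z => 1 + logWeight 1 z) (fun k => measurable_logWeight _)
      (fun k => .of_forall (logWeight_le (hε0 k) (hε1 k))) ?_
      ((ae_restrict_of_ae hX0).mono fun z hz => tendsto_logWeight hε hz)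
    · simpa using h
    · rw [lintegral_add_left measurable_const, setLIntegral_one]
      exact ENNReal.add_ne_top.2 ⟨hcB, ne_top_of_le_ne_top hX1 (setLIntegral_le_lintegral _ _)⟩
  have hB2 := (ENNReal.tendsto_toReal hcB).comp hB1
  have hB3 : Tendsto (fun k => m k - (∫⁻ z in Bᶜ, logWeight (ε k) z ∂X.1).toReal) atTop
      (𝓝 (X.1 B).toReal) := by
    have h := hB2.sub hX
    rw [sub_zero] at h
    refine h.congr fun k => ?_
    have h1 := lintegral_add_compl (μ := X.1) (logWeight (ε k)) hB.1
    have hle : ∀ s : Set Disc, ∫⁻ z in s, logWeight (ε k) z ∂X.1 ≠ ⊤ := fun s =>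
      ne_top_of_le_ne_top (hXk k) (setLIntegral_le_lintegral _ _)
    have h2 : (T k X).toReal = _ := congrArg ENNReal.toReal h1.symm
    rw [ENNReal.toReal_add (hle _) (hle _)] at h2
    simp only [Function.comp_def]
    rw [h2]
    ring
  have hB4 := ENNReal.tendsto_ofReal hB3
  rw [ENNReal.ofReal_toReal hcB] at hB4
  exact hB4.liminf_eq.symm

end Rigidity

/-! ### Random coefficients -/

section RandomCoefficients

open Filter Topology

/-- The two terms agree to first order in `ε`: both have the value `1` and the derivative `2 Γ'(1)`
at `0`. -/
theorem tendsto_Gamma_variance :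
    Tendsto (fun ε : ℝ => (Real.Gamma (2 * ε + 1) - Real.Gamma (ε + 1) ^ 2) / ε) (𝓝[>] 0) (𝓝 0) := by
  have hΓ : HasDerivAt Real.Gamma (deriv Real.Gamma 1) 1 :=
    (Real.differentiableAt_Gamma fun m h => by
      have := m.cast_nonneg (α := ℝ)
      linarith).hasDerivAt
  have l1 : HasDerivAt (fun ε : ℝ => 2 * ε + 1) 2 0 := by
    simpa using ((hasDerivAt_id (0 : ℝ)).const_mul 2).add_const 1
  have l2 : HasDerivAt (fun ε : ℝ => ε + 1) 1 0 := (hasDerivAt_id (0 : ℝ)).add_const 1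
  have h1 : HasDerivAt (fun ε : ℝ => Real.Gamma (2 * ε + 1)) (deriv Real.Gamma 1 * 2) 0 :=
    HasDerivAt.comp (h₂ := Real.Gamma) (0 : ℝ) (by rwa [mul_zero, zero_add]) l1
  have h2 : HasDerivAt (fun ε : ℝ => Real.Gamma (ε + 1)) (deriv Real.Gamma 1 * 1) 0 :=
    HasDerivAt.comp (h₂ := Real.Gamma) (0 : ℝ) (by rwa [zero_add]) l2
  have h3 := h1.sub (h2.pow 2)
  have h4 := h3.tendsto_slope.mono_left (nhdsWithin_mono (0 : ℝ) fun x (hx : 0 < x) => hx.ne')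
  simp only [zero_add, Real.Gamma_one, one_pow] at h4
  norm_num at h4
  refine (h4.congr fun ε => ?_).trans (le_of_eq ?_)
  · simp [slope_def_field]
  · congr 1
    ring

theorem summable_succ_rpow {ε : ℝ} (hε : 0 < ε) :
    Summable fun n : ℕ => 1 / ((n : ℝ) + 1) * (1 / ((n : ℝ) + 1) ^ ε) := by
  have h := (summable_nat_add_iff 1).2 (Real.summable_one_div_nat_rpow.2 (by linarith : 1 < 1 + ε))
  refine h.congr fun n => ?_
  rw [Nat.cast_succ, Real.rpow_add (by positivity), Real.rpow_one, one_div_mul_one_div]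

/-- The variance of the linear statistic of `logWeight ε`, averaged over the coefficients, tends to
zero: the sum over `n` grows like `1 / (2 ε)`, but the prefactor has a double zero. -/
theorem tendsto_mean_variance :
    Tendsto (fun ε : ℝ => (Real.Gamma (2 * ε + 1) - Real.Gamma (ε + 1) ^ 2) *
      ∑' n : ℕ, 1 / ((n : ℝ) + 1) * (1 / ((n : ℝ) + 1) ^ (2 * ε))) (𝓝[>] 0) (𝓝 0) := by
  have hl : Tendsto (fun ε : ℝ => 1 + 2 * ε) (𝓝[>] 0) (𝓝[>] 1) := by
    refine tendsto_nhdsWithin_iff.2 ⟨?_, ?_⟩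
    · have : Tendsto (fun ε : ℝ => 1 + 2 * ε) (𝓝 0) (𝓝 (1 + 2 * 0)) := by
        exact (by fun_prop : Continuous fun ε : ℝ => 1 + 2 * ε).tendsto 0
      rw [mul_zero, add_zero] at this
      exact this.mono_left nhdsWithin_le_nhds
    · filter_upwards [self_mem_nhdsWithin] with ε (hε : 0 < ε)
      exact Set.mem_Ioi.2 (by linarith)
  have h := (tendsto_Gamma_variance.div_const 2).mul (tendsto_sub_mul_tsum_nat_rpow.comp hl)
  rw [zero_div, zero_mul] at h
  refine h.congr' ?_
  filter_upwards [self_mem_nhdsWithin] with ε (hε : 0 < ε)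
  have hs : ∑' n : ℕ, 1 / (n : ℝ) ^ (1 + 2 * ε) =
      ∑' n : ℕ, 1 / ((n : ℝ) + 1) * (1 / ((n : ℝ) + 1) ^ (2 * ε)) := by
    rw [(Real.summable_one_div_nat_rpow.2 (by linarith : 1 < 1 + 2 * ε)).tsum_eq_zero_add,
      Nat.cast_zero, Real.zero_rpow (by positivity), div_zero, zero_add]
    refine tsum_congr fun n => ?_
    rw [Nat.cast_succ, Real.rpow_add (by positivity), Real.rpow_one, one_div_mul_one_div]
  simp only [Function.comp_def]
  rw [hs]
  field_simp
  ring

theorem exists_seq_mean_variance_le :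
    ∃ ε : ℕ → ℝ, (∀ k, 0 < ε k) ∧ (∀ k, ε k ≤ 1) ∧ Tendsto ε atTop (𝓝 0) ∧
      ∀ k, (Real.Gamma (2 * ε k + 1) - Real.Gamma (ε k + 1) ^ 2) *
        ∑' n : ℕ, 1 / ((n : ℝ) + 1) * (1 / ((n : ℝ) + 1) ^ (2 * ε k)) ≤ (1 / 2) ^ k := by
  have h : ∀ k : ℕ, ∃ ε : ℝ, (0 < ε ∧ ε < 1 / ((k : ℝ) + 1)) ∧
      (Real.Gamma (2 * ε + 1) - Real.Gamma (ε + 1) ^ 2) *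
        ∑' n : ℕ, 1 / ((n : ℝ) + 1) * (1 / ((n : ℝ) + 1) ^ (2 * ε)) ≤ (1 / 2) ^ k := by
    intro k
    have h1 := tendsto_mean_variance.eventually (ge_mem_nhds (by positivity : (0 : ℝ) < (1 / 2) ^ k))
    have h2 := Ioo_mem_nhdsGT (show (0 : ℝ) < 1 / ((k : ℝ) + 1) by positivity)
    exact ((Filter.eventually_of_mem h2 fun x hx => hx).and h1).exists
  choose ε h1 h2 using h
  refine ⟨ε, fun k => (h1 k).1, fun k => (h1 k).2.le.trans ?_, ?_, h2⟩
  · rw [div_le_one (by positivity)]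
    linarith [k.cast_nonneg (α := ℝ)]
  · exact squeeze_zero (fun k => (h1 k).1.le) (fun k => (h1 k).2.le) tendsto_one_div_add_atTop_nhds_zero_nat

variable {Ω : Type*} [MeasurableSpace Ω] {ℙ : Measure Ω} [IsProbabilityMeasure ℙ]

theorem ae_eq_zero_or_one {x : Ω → ℝ} (hx : Measurable x) {p : ℝ} (hp0 : 0 ≤ p) (hp1 : p ≤ 1)
    (h1 : ℙ {ω | x ω = 1} = ENNReal.ofReal p) (h0 : ℙ {ω | x ω = 0} = ENNReal.ofReal (1 - p)) :
    ∀ᵐ ω ∂ℙ, x ω = 0 ∨ x ω = 1 := by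
  have m0 : MeasurableSet {ω | x ω = 0} := hx (measurableSet_singleton 0)
  have m1 : MeasurableSet {ω | x ω = 1} := hx (measurableSet_singleton 1)
  have hd : Disjoint {ω | x ω = 0} {ω | x ω = 1} := by
    refine Set.disjoint_left.2 fun ω (h : x ω = 0) (h' : x ω = 1) => ?_
    rw [h] at h'
    exact zero_ne_one h'
  have hu : ℙ ({ω | x ω = 0} ∪ {ω | x ω = 1}) = 1 := by
    rw [measure_union hd m1, h0, h1, ← ENNReal.ofReal_add (by linarith) hp0, sub_add_cancel,
      ENNReal.ofReal_one]
  exact (prob_compl_eq_zero_iff (m0.union m1)).2 hu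

omit [IsProbabilityMeasure ℙ] in
theorem lintegral_mul_of_eq_zero_or_one {x : Ω → ℝ} (hx : Measurable x) {p : ℝ} (hp0 : 0 ≤ p)
    (hx01 : ∀ᵐ ω ∂ℙ, x ω = 0 ∨ x ω = 1) (h1 : ℙ {ω | x ω = 1} = ENNReal.ofReal p) (c : ℝ) :
    ∫⁻ ω, ENNReal.ofReal (x ω * c) ∂ℙ = ENNReal.ofReal (p * c) := by
  have m1 : MeasurableSet {ω | x ω = 1} := hx (measurableSet_singleton 1)
  rw [ENNReal.ofReal_mul hp0, ← h1, mul_comm, ← lintegral_indicator_const m1]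
  refine lintegral_congr_ae ?_
  filter_upwards [hx01] with ω hω
  rcases hω with h | h
  · rw [Set.indicator_of_notMem (by simp [h]), h, zero_mul, ENNReal.ofReal_zero]
  · rw [Set.indicator_of_mem (by exact h), h, one_mul]

end RandomCoefficients

theorem theorem1p3 {Ω : Type*} [MeasurableSpace Ω] (ℙ : Measure Ω) [IsProbabilityMeasure ℙ]
    (ξ : ℕ → Ω → ℝ) (hξ_meas : ∀ n, Measurable (ξ n)) (hξ_indep : ProbabilityTheory.iIndepFun ξ ℙ)
    (hξ_one : ∀ n : ℕ, ℙ {ω | ξ n ω = 1} = ENNReal.ofReal (1 / ((n : ℝ) + 1)))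
    (hξ_zero : ∀ n : ℕ, ℙ {ω | ξ n ω = 0} = ENNReal.ofReal (1 - 1 / ((n : ℝ) + 1))) :
    ∀ᵐ ω ∂ℙ,
      (∃ P : PointProcess Disc,
        IsDeterminantal discMeasure (discKernel fun n => (ξ n ω : ℂ)) P) ∧
      ∀ P : PointProcess Disc,
        IsDeterminantal discMeasure (discKernel fun n => (ξ n ω : ℂ)) P → IsNumberRigid P := by
  obtain ⟨ε, hε0, hε1, hε, hV⟩ := exists_seq_mean_variance_le
  have hp0 : ∀ n : ℕ, 0 ≤ 1 / ((n : ℝ) + 1) := fun n => by positivity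
  have hp1 : ∀ n : ℕ, 1 / ((n : ℝ) + 1) ≤ 1 := fun n => by
    rw [div_le_one (by positivity)]
    linarith [n.cast_nonneg (α := ℝ)]
  have h01 : ∀ n, ∀ᵐ ω ∂ℙ, ξ n ω = 0 ∨ ξ n ω = 1 := fun n =>
    ae_eq_zero_or_one (hξ_meas n) (hp0 n) (hp1 n) (hξ_one n) (hξ_zero n)
  have hmean : ∀ (n : ℕ) (c : ℝ), ∫⁻ ω, ENNReal.ofReal (ξ n ω * c) ∂ℙ =
      ENNReal.ofReal (1 / ((n : ℝ) + 1) * c) := fun n c =>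
    lintegral_mul_of_eq_zero_or_one (hξ_meas n) (hp0 n) (h01 n) (hξ_one n) c
  have hmeas : ∀ (n : ℕ) (c : ℝ), Measurable fun ω => ENNReal.ofReal (ξ n ω * c) := fun n c =>
    ((hξ_meas n).mul_const c).ennreal_ofReal
  have hmeasum : ∀ c : ℕ → ℝ, Measurable fun ω => ∑' n, ENNReal.ofReal (ξ n ω * c n) := fun c =>
    Measurable.tsum fun n => hmeas n (c n)
  -- the means of the linear statistics are almost surely finite
  have hsumm : ∀ k, ∀ᵐ ω ∂ℙ, ∑' n : ℕ, ENNReal.ofReal (ξ n ω * (1 / ((n : ℝ) + 1) ^ ε k)) < ⊤ := by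
    intro k
    refine ae_lt_top (hmeasum _) ?_
    rw [lintegral_tsum fun n => (hmeas n _).aemeasurable]
    simp_rw [hmean]
    exact (summable_succ_rpow (hε0 k)).tsum_ofReal_ne_top
  let v : ℕ → ℕ → ℝ := fun k n => logWeightMean (2 * ε k) n - logWeightMean (ε k) n ^ 2
  have hv : ∀ k (n : ℕ), 1 / ((n : ℝ) + 1) * v k n =
      (Real.Gamma (2 * ε k + 1) - Real.Gamma (ε k + 1) ^ 2) *
        (1 / ((n : ℝ) + 1) * (1 / ((n : ℝ) + 1) ^ (2 * ε k))) := by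
    intro k n
    have e2 : ((n : ℝ) + 1) ^ (2 * ε k) = (((n : ℝ) + 1) ^ ε k) ^ 2 := by
      rw [mul_comm, Real.rpow_mul (by positivity), Real.rpow_two]
    simp only [v, logWeightMean]
    rw [e2, div_pow]
    ring
  -- the variances are almost surely summable, as their expectations are
  have hvar : ∀ᵐ ω ∂ℙ, ∑' k, ∑' n, ENNReal.ofReal (ξ n ω * v k n) < ⊤ := by
    refine ae_lt_top (Measurable.tsum fun k => hmeasum (v k)) ?_
    rw [lintegral_tsum fun k => (hmeasum (v k)).aemeasurable]
    refine ne_top_of_le_ne_top (b := ∑' k : ℕ, ENNReal.ofReal ((1 / 2) ^ k)) ?_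
      (ENNReal.tsum_le_tsum fun k => ?_)
    · exact summable_geometric_two.tsum_ofReal_ne_top
    · rw [lintegral_tsum fun n => (hmeas n _).aemeasurable]
      simp_rw [hmean, hv]
      have hΓ : 0 ≤ Real.Gamma (2 * ε k + 1) - Real.Gamma (ε k + 1) ^ 2 :=
        sub_nonneg.2 (Real.Gamma_sq_le (hε0 k).le)
      rw [← ENNReal.ofReal_tsum_of_nonneg (fun n => mul_nonneg hΓ (by positivity))
        ((summable_succ_rpow (by linarith [hε0 k])).mul_left _), tsum_mul_left]
      exact ENNReal.ofReal_le_ofReal (hV k)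
  filter_upwards [ae_all_iff.2 h01, ae_all_iff.2 hsumm, hvar] with ω ha hs hVω
  refine ⟨exists_isDeterminantal_discKernel ha, fun P hP =>
    hP.isNumberRigid ha (fun k => (hε0 k).le) hε1 hε (fun k => ?_) hVω.ne⟩
  have h := ENNReal.summable_toReal (hs k).ne
  refine h.congr fun n => ?_
  rw [ENNReal.toReal_ofReal, mul_one_div]
  have : 0 ≤ ξ n ω := by rcases ha n with h | h <;> simp [h]
  positivity
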